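/- **Diagrams.** A virtual knotoid diagram $K$ is a generic immersed open curve in $S^2$, oriented from its tail to its head, with finitely many transversal double points, each of which is a positive or negative classical crossing or a virtual crossing. Virtual knotoids are virtual knotoid diagrams up to isotopy of $S^2$ and the extended (classical, virtual and mixed) Reidemeister moves, performed away from the endpoints. Classical knotoids are diagrams without virtual crossings up to isotopy of $S^2$ and the classical moves. The semi-arcs of $K$ are the pieces of the curve between consecutive crossings (or endpoints). **Biquandles and colorings.** A biquandle is a set $X$ with operations $\underline{\triangleright},\overline{\triangleright}$ such that $x\,\underline{\triangleright}\,x=x\,\overline{\triangleright}\,x$; the maps $x\mapsto x\,\overline{\triangleright}\,y$, $x\mapsto x\,\underline{\triangleright}\,y$ and $(x,y)\mapsto(y\,\overline{\triangleright}\,x,\,x\,\underline{\triangleright}\,y)$ are bijective; and $(x\underline{\triangleright}y)\underline{\triangleright}(z\underline{\triangleright}y)=(x\underline{\triangleright}z)\underline{\triangleright}(y\overline{\triangleright}z)$, $(x\underline{\triangleright}y)\overline{\triangleright}(z\underline{\triangleright}y)=(x\overline{\triangleright}z)\underline{\triangleright}(y\overline{\triangleright}z)$, $(x\overline{\triangleright}y)\overline{\triangleright}(z\overline{\triangleright}y)=(x\overline{\triangleright}z)\overline{\triangleright}(y\underline{\triangleright}z)$.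 Write $x^y=x\,\underline{\triangleright}\,y$ and $x_y=x\,\overline{\triangleright}\,y$. An $X$-coloring $f$ of $K$ labels the semi-arcs by elements of $X$ such that: at a positive crossing with label $x$ on the incoming under-arc and $y$ on the outgoing over-arc, the outgoing under-arc has $x^y$ and the incoming over-arc has $y_x$; at a negative crossing with $x$ on the outgoing under-arc and $y$ on the incoming over-arc, the incoming under-arc has $x^y$ and the outgoing over-arc has $y_x$; labels do not change along a strand through a virtual crossing. The pair $(x,y)$ is called the pair of labels of the crossing. The fundamental biquandle $\mathcal B(K)$ is the biquandle generated by the semi-arcs with these crossing relations. **Virtual brackets.** Let $R$ be a commutative unitary ring. An $X$-virtual bracket $\beta$ over $R$ consists of maps $A,B,V,C,D,U:X\times X\to R$ and elements $\delta\in R$, $\omega\in R^\times$ such that for all $x,y,z\in X$: $\omega=\delta A_{x,x}+B_{x,x}+V_{x,x}$ and $\omega^{-1}=\delta C_{x,x}+D_{x,x}+U_{x,x}$; with all indices equal to $x,y$: $1=AC+VU$, $1=BD+VU$, $0=AU+VC$, $0=BU+VD$, $0=\delta BD+AD+BC$, $0=\delta AC+AD+BC$; and, writing $[FGH]=F_{x,y}\,G_{x^y,z_y}\,H_{y,z}$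 and $\langle FGH\rangle=F_{y_x,z_x}\,G_{x,z}\,H_{x^z,y^z}$, $$[AAA]+[VAV]=\langle AAA\rangle+\langle VAV\rangle,$$ $$[AAB]+[BAA]+\delta[BAB]+[BAV]+[BBB]+[BVB]+[VAB]=\langle ABA\rangle,$$ $$[ABA]=\langle AAB\rangle+\langle BAA\rangle+\delta\langle BAB\rangle+\langle BAV\rangle+\langle BBB\rangle+\langle BVB\rangle+\langle VAB\rangle,$$ $$[AVA]=\langle AAV\rangle+\langle VAA\rangle,\qquad [AAV]+[VAA]=\langle AVA\rangle,$$ $$[BBA]+[BVV]=\langle ABB\rangle+\langle VVB\rangle,\qquad [ABB]+[VVB]=\langle BBA\rangle+\langle BVV\rangle,$$ $$[BBV]+[BVA]=\langle ABV\rangle,\quad [ABV]=\langle BBV\rangle+\langle BVA\rangle,\quad [VBA]=\langle AVB\rangle+\langle VBB\rangle,\quad [AVB]+[VBB]=\langle VBA\rangle,$$ $$[VVA]=\langle AVV\rangle,\quad [AVV]=\langle VVA\rangle,\quad [VBV]=\langle VBV\rangle,\quad [VVV]=\langle VVV\rangle.$$ A state $S$ of $K$ replaces each classical crossing by its orientation-respecting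 smoothing, by its other smoothing, or by a virtual crossing. If a crossing has the pair of labels $(x,y)$, these contribute $A_{x,y},B_{x,y},V_{x,y}$ respectively at a positive crossing and $C_{x,y},D_{x,y},U_{x,y}$ at a negative one. For an $X$-colored diagram $K_f$ let $$\beta(K_f)=\sum_S\Big(\prod\text{contributions of the crossings in }S\Big)\,\delta^{m(S)}\,\omega^{-wr(K)},$$ where $m(S)$ is the number of components of $S$ (the open one included) and $wr(K)$ is the writhe. **Statement.** Let $X$ be a finite biquandle and $\beta$ an $X$-virtual bracket over a commutative unitary ring $R$. Then the multiset $$\Phi_X^{\beta,M}(K)=\{\beta(K_f)\mid f\in \mathrm{Hom}(\mathcal B(K),X)\}$$ is the multiset of the values $\beta(K_f)$ over all $X$-colorings $f$ of $K$. It is an invariant of virtual knotoids and of classical knotoids: equivalent diagrams have equal multisets. Its cardinality is the biquandle counting invariant $\Phi_X^{\mathbb Z}(K)$, the number of $X$-colorings of $K$. -/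

import Mathlib

/-! ### Biquandles -/

/-- A biquandle: `un x y` is `x` acted on by passing under `y` (underlined triangle),
`ov x y` is `x` acted on by passing over `y` (overlined triangle). -/
class Biquandle (X : Type*) where
  un : X → X → X
  ov : X → X → X
  under_self : ∀ x, un x x = ov x x
  over_bijective : ∀ y, Function.Bijective (fun x => ov x y)
  under_bijective : ∀ y, Function.Bijective (fun x => un x y)
  switch_bijective : Function.Bijective (fun p : X × X => (ov p.2 p.1, un p.1 p.2))
  exchange_under : ∀ x y z,
    un (un x y) (un z y) = un (un x z) (ov y z)
  exchange_mixed : ∀ x y z,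
    ov (un x y) (un z y) = un (ov x z) (ov y z)
  exchange_over : ∀ x y z,
    ov (ov x y) (ov z y) = ov (ov x z) (un y z)

infixl:75 " ▷ᵤ " => Biquandle.un
infixl:75 " ▷ₒ " => Biquandle.ov

/-- Biquandle homomorphisms. -/
@[ext]
structure BiquandleHom (X Y : Type*) [Biquandle X] [Biquandle Y] where
  toFun : X → Y
  map_under : ∀ x y, toFun (x ▷ᵤ y) = toFun x ▷ᵤ toFun y
  map_over : ∀ x y, toFun (x ▷ₒ y) = toFun x ▷ₒ toFun y

/-- A biquandle `X`-virtual bracket over `R`. -/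
structure VirtualBracket (X R : Type*) [Biquandle X] [CommRing R] where
  A : X → X → R
  B : X → X → R
  V : X → X → R
  C : X → X → R
  D : X → X → R
  U : X → X → R
  δ : R
  ω : Rˣ
  kink_pos : ∀ x, (ω : R) = δ * A x x + B x x + V x x
  kink_neg : ∀ x, ((ω⁻¹ : Rˣ) : R) = δ * C x x + D x x + U x x
  bigon_1 : ∀ x y, 1 = A x y * C x y + V x y * U x y
  bigon_2 : ∀ x y, 1 = B x y * D x y + V x y * U x y
  bigon_3 : ∀ x y, 0 = A x y * U x y + V x y * C x y
  bigon_4 : ∀ x y, 0 = B x y * U x y + V x y * D x y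
  bigon_5 : ∀ x y, 0 = δ * (B x y * D x y) + A x y * D x y + B x y * C x y
  bigon_6 : ∀ x y, 0 = δ * (A x y * C x y) + A x y * D x y + B x y * C x y
  triangle_1 : ∀ x y z,
    A x y * A (x ▷ᵤ y) (z ▷ₒ y) * A y z + V x y * A (x ▷ᵤ y) (z ▷ₒ y) * V y z
      = A (y ▷ₒ x) (z ▷ₒ x) * A x z * A (x ▷ᵤ z) (y ▷ᵤ z)
        + V (y ▷ₒ x) (z ▷ₒ x) * A x z * V (x ▷ᵤ z) (y ▷ᵤ z)
  triangle_2 : ∀ x y z,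
    A x y * A (x ▷ᵤ y) (z ▷ₒ y) * B y z + B x y * A (x ▷ᵤ y) (z ▷ₒ y) * A y z
      + δ * (B x y * A (x ▷ᵤ y) (z ▷ₒ y) * B y z) + B x y * A (x ▷ᵤ y) (z ▷ₒ y) * V y z
      + B x y * B (x ▷ᵤ y) (z ▷ₒ y) * B y z + B x y * V (x ▷ᵤ y) (z ▷ₒ y) * B y z
      + V x y * A (x ▷ᵤ y) (z ▷ₒ y) * B y z
      = A (y ▷ₒ x) (z ▷ₒ x) * B x z * A (x ▷ᵤ z) (y ▷ᵤ z)
  triangle_3 : ∀ x y z,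
    A x y * B (x ▷ᵤ y) (z ▷ₒ y) * A y z
      = A (y ▷ₒ x) (z ▷ₒ x) * A x z * B (x ▷ᵤ z) (y ▷ᵤ z)
        + B (y ▷ₒ x) (z ▷ₒ x) * A x z * A (x ▷ᵤ z) (y ▷ᵤ z)
        + δ * (B (y ▷ₒ x) (z ▷ₒ x) * A x z * B (x ▷ᵤ z) (y ▷ᵤ z))
        + B (y ▷ₒ x) (z ▷ₒ x) * A x z * V (x ▷ᵤ z) (y ▷ᵤ z)
        + B (y ▷ₒ x) (z ▷ₒ x) * B x z * B (x ▷ᵤ z) (y ▷ᵤ z)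
        + B (y ▷ₒ x) (z ▷ₒ x) * V x z * B (x ▷ᵤ z) (y ▷ᵤ z)
        + V (y ▷ₒ x) (z ▷ₒ x) * A x z * B (x ▷ᵤ z) (y ▷ᵤ z)
  triangle_4 : ∀ x y z,
    A x y * V (x ▷ᵤ y) (z ▷ₒ y) * A y z
      = A (y ▷ₒ x) (z ▷ₒ x) * A x z * V (x ▷ᵤ z) (y ▷ᵤ z)
        + V (y ▷ₒ x) (z ▷ₒ x) * A x z * A (x ▷ᵤ z) (y ▷ᵤ z)
  triangle_5 : ∀ x y z,
    A x y * A (x ▷ᵤ y) (z ▷ₒ y) * V y z + V x y * A (x ▷ᵤ y) (z ▷ₒ y) * A y z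
      = A (y ▷ₒ x) (z ▷ₒ x) * V x z * A (x ▷ᵤ z) (y ▷ᵤ z)
  triangle_6 : ∀ x y z,
    B x y * B (x ▷ᵤ y) (z ▷ₒ y) * A y z + B x y * V (x ▷ᵤ y) (z ▷ₒ y) * V y z
      = A (y ▷ₒ x) (z ▷ₒ x) * B x z * B (x ▷ᵤ z) (y ▷ᵤ z)
        + V (y ▷ₒ x) (z ▷ₒ x) * V x z * B (x ▷ᵤ z) (y ▷ᵤ z)
  triangle_7 : ∀ x y z,
    A x y * B (x ▷ᵤ y) (z ▷ₒ y) * B y z + V x y * V (x ▷ᵤ y) (z ▷ₒ y) * B y z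
      = B (y ▷ₒ x) (z ▷ₒ x) * B x z * A (x ▷ᵤ z) (y ▷ᵤ z)
        + B (y ▷ₒ x) (z ▷ₒ x) * V x z * V (x ▷ᵤ z) (y ▷ᵤ z)
  triangle_8 : ∀ x y z,
    B x y * B (x ▷ᵤ y) (z ▷ₒ y) * V y z + B x y * V (x ▷ᵤ y) (z ▷ₒ y) * A y z
      = A (y ▷ₒ x) (z ▷ₒ x) * B x z * V (x ▷ᵤ z) (y ▷ᵤ z)
  triangle_9 : ∀ x y z,
    A x y * B (x ▷ᵤ y) (z ▷ₒ y) * V y z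
      = B (y ▷ₒ x) (z ▷ₒ x) * B x z * V (x ▷ᵤ z) (y ▷ᵤ z)
        + B (y ▷ₒ x) (z ▷ₒ x) * V x z * A (x ▷ᵤ z) (y ▷ᵤ z)
  triangle_10 : ∀ x y z,
    V x y * B (x ▷ᵤ y) (z ▷ₒ y) * A y z
      = A (y ▷ₒ x) (z ▷ₒ x) * V x z * B (x ▷ᵤ z) (y ▷ᵤ z)
        + V (y ▷ₒ x) (z ▷ₒ x) * B x z * B (x ▷ᵤ z) (y ▷ᵤ z)
  triangle_11 : ∀ x y z,
    A x y * V (x ▷ᵤ y) (z ▷ₒ y) * B y z + V x y * B (x ▷ᵤ y) (z ▷ₒ y) * B y z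
      = V (y ▷ₒ x) (z ▷ₒ x) * B x z * A (x ▷ᵤ z) (y ▷ᵤ z)
  triangle_12 : ∀ x y z,
    V x y * V (x ▷ᵤ y) (z ▷ₒ y) * A y z
      = A (y ▷ₒ x) (z ▷ₒ x) * V x z * V (x ▷ᵤ z) (y ▷ᵤ z)
  triangle_13 : ∀ x y z,
    A x y * V (x ▷ᵤ y) (z ▷ₒ y) * V y z
      = V (y ▷ₒ x) (z ▷ₒ x) * V x z * A (x ▷ᵤ z) (y ▷ᵤ z)
  triangle_14 : ∀ x y z,
    V x y * B (x ▷ᵤ y) (z ▷ₒ y) * V y z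
      = V (y ▷ₒ x) (z ▷ₒ x) * B x z * V (x ▷ᵤ z) (y ▷ᵤ z)
  triangle_15 : ∀ x y z,
    V x y * V (x ▷ᵤ y) (z ▷ₒ y) * V y z
      = V (y ▷ₒ x) (z ▷ₒ x) * V x z * V (x ▷ᵤ z) (y ▷ᵤ z)

/-! ### Virtual knotoid diagrams

A diagram in the oriented sphere is recorded, up to isotopy of the sphere, by the sequence of
crossings met when the curve is traversed from tail to head, together with the local picture at
each crossing.  At a crossing one of the two passages is labelled `true` and the other one
`false`, in such a way that the pair of directions of travel (passage `true`, passage `false`) is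
a positively oriented frame.  A positive classical crossing is one where (over, under) is a
positive frame. So `true` is the over-passage at a positive crossing and the under-passage at a
negative one. -/

inductive CrossingKind where
  | pos
  | neg
  | virt
  deriving DecidableEq

/-- A crossing: its kind and a name. -/
structure Crossing where
  kind : CrossingKind
  name : ℕ
  deriving DecidableEq

abbrev Passage := Crossing × Bool

/-- The combinatorial data of a generic oriented open curve with classical and virtual crossings:
every crossing that is met is met exactly twice, once as `true` and once as `false`. -/
structure KnotoidCode where
  word : List Passage
  nodup : word.Nodup
  paired : ∀ c b, (c, b) ∈ word → (c, !b) ∈ word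

namespace KnotoidCode

variable (D : KnotoidCode)

/-- The semi-arcs: arc `i` lies just before the passage at position `i`, and arc `i + 1` just
after it. Arc `0` starts at the tail and the last arc ends at the head. -/
abbrev Arc := Fin (D.word.length + 1)

/-- The crossings of the diagram. -/
def Cr := {c : Crossing // (c, true) ∈ D.word}

variable {D}

theorem Cr.mem (c : D.Cr) : ∀ b, (c.1, b) ∈ D.word
  | true => c.2
  | false => D.paired _ _ c.2

def Cr.kind (c : D.Cr) : CrossingKind := c.1.kind

/-- The arc on which the passage `b` of the crossing `c` arrives. -/
def Cr.inArc (c : D.Cr) (b : Bool) : D.Arc :=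
  ⟨D.word.idxOf (c.1, b), Nat.lt_succ_of_lt (List.idxOf_lt_length_of_mem (c.mem b))⟩

/-- The arc on which the passage `b` of the crossing `c` leaves. -/
def Cr.outArc (c : D.Cr) (b : Bool) : D.Arc :=
  ⟨D.word.idxOf (c.1, b) + 1, Nat.succ_lt_succ (List.idxOf_lt_length_of_mem (c.mem b))⟩

variable (D)

instance : Finite D.Cr :=
  Finite.of_injective (β := {p // p ∈ D.word}) (fun c => ⟨(c.1, true), c.2⟩) (by
    intro c d h
    exact Subtype.ext (congrArg (fun p : {p // p ∈ D.word} => p.1.1) h))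

noncomputable instance : Fintype D.Cr := Fintype.ofFinite _

/-! ### Planarity -/

/-- Walking along the boundary of a face with the face on the left. A dart is an arc with a
direction (`true` is the direction of the curve); at a crossing one turns left, at an endpoint one
turns back. -/
inductive FaceStep : D.Arc × Bool → D.Arc × Bool → Prop
  | first_forward (c : D.Cr) : FaceStep (c.inArc true, true) (c.outArc false, true)
  | second_forward (c : D.Cr) : FaceStep (c.inArc false, true) (c.inArc true, false)
  | first_backward (c : D.Cr) : FaceStep (c.outArc true, false) (c.inArc false, false)
  | second_backward (c : D.Cr) : FaceStep (c.outArc false, false) (c.outArc true, true)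
  | head : FaceStep (Fin.last _, true) (Fin.last _, false)
  | tail : FaceStep (0, false) (0, true)

/-- The number of faces of the surface on which the code is cellularly drawn. -/
noncomputable def faceCount : ℕ := Nat.card (Quot D.FaceStep)

/-- The code is drawn on the sphere: with `n` crossings there are `n + 2` vertices (the crossings
and the two endpoints) and `2 n + 1` edges, so that Euler characteristic `2` means `n + 1`
faces; the word has length `2 n`. -/
def IsPlanar : Prop := 2 * D.faceCount = D.word.length + 2

/-- No virtual crossings. -/
def IsClassical : Prop := ∀ c : D.Cr, c.kind ≠ .virt

end KnotoidCode

/-- Virtual knotoid diagrams in the sphere, up to isotopy of the sphere and names of crossings. -/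
abbrev VirtualKnotoidDiagram := {D : KnotoidCode // D.IsPlanar}

/-- Classical knotoid diagrams in the sphere. -/
abbrev ClassicalKnotoidDiagram := {D : VirtualKnotoidDiagram // D.1.IsClassical}

/-! ### Extended Reidemeister moves -/

/-- The passage goes over a classical crossing. -/
def Passage.IsOver (p : Passage) : Prop :=
  (p.1.kind = .pos ∧ p.2 = true) ∨ (p.1.kind = .neg ∧ p.2 = false)

def Crossing.IsClassical (c : Crossing) : Prop := c.kind ≠ .virt

/-- `inOrder s p q` is `p, q` or `q, p`. -/
def inOrder (s : Bool) (p q : Passage) : List Passage := if s then [p, q] else [q, p]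

/-- The kinds of the two crossings of a bigon that a second Reidemeister move removes: both
virtual, or both classical with the same strand on top (hence of opposite signs). -/
def bigonKinds (c d : Crossing) : Prop :=
  (c.kind = .pos ∧ d.kind = .neg) ∨ (c.kind = .neg ∧ d.kind = .pos) ∨
    (c.kind = .virt ∧ d.kind = .virt)

/-- The elementary moves on words. All moves are local moves of diagrams, with every orientation
of the strands allowed, away from the endpoints.

* `rename`: change of the names of crossings.
* `r1`: classical and virtual first moves, removing a monogon.
* `r2`: classical and virtual second moves, removing a bigon, whose corners `c` and `d` have
  opposite handedness; the other strand may run in either direction.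
* `r3`: classical, virtual and mixed third moves. Strand 1 meets strands 2 and 3 in `a` and `b`,
  and strands 2 and 3 meet in `c`. The Booleans `s₁ s₂ s₃` tell in which order each strand meets
  its two crossings, and the condition on `α β γ` says that the three crossings are the corners of
  a triangular face (`x == y` is the product of signs, and the common value is the orientation of
  the triangle `a b c`). Either all crossings are classical and one strand is over the other two,
  or one strand crosses the other two virtually. Both orders on every strand are reversed. -/
inductive ReidemeisterStep : List Passage → List Passage → Prop
  | rename (ρ : Crossing → Crossing) (hρ : Function.Injective ρ) (hk : ∀ c, (ρ c).kind = c.kind)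
      (w : List Passage) :
      ReidemeisterStep w (w.map (fun p => (ρ p.1, p.2)))
  | r1 (u v : List Passage) (c : Crossing) (b : Bool) :
      ReidemeisterStep (u ++ [(c, b), (c, !b)] ++ v) (u ++ v)
  | r2 (u v w : List Passage) (c d : Crossing) (b s : Bool) (h : bigonKinds c d) :
      ReidemeisterStep (u ++ [(c, b), (d, !b)] ++ v ++ inOrder s (c, !b) (d, b) ++ w)
        (u ++ v ++ w)
  | r3 (t u v w : List Passage) (a b c : Crossing) (α β γ s₁ s₂ s₃ : Bool)
      (face₁ : (α == (s₁ == s₂)) = (β == (s₁ == s₃)))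
      (face₂ : (β == (s₁ == s₃)) = (γ == (s₂ == s₃)))
      (h : (a.IsClassical ∧ b.IsClassical ∧ c.IsClassical ∧
            ((Passage.IsOver (a, α) ∧ Passage.IsOver (b, β)) ∨
             (Passage.IsOver (a, !α) ∧ Passage.IsOver (c, γ)) ∨
             (Passage.IsOver (b, !β) ∧ Passage.IsOver (c, !γ)))) ∨
          (a.kind = .virt ∧ b.kind = .virt) ∨ (a.kind = .virt ∧ c.kind = .virt) ∨
          (b.kind = .virt ∧ c.kind = .virt)) :
      ReidemeisterStep
        (t ++ inOrder s₁ (a, α) (b, β) ++ u ++ inOrder s₂ (a, !α) (c, γ) ++ v ++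
          inOrder s₃ (b, !β) (c, !γ) ++ w)
        (t ++ inOrder (!s₁) (a, α) (b, β) ++ u ++ inOrder (!s₂) (a, !α) (c, γ) ++ v ++
          inOrder (!s₃) (b, !β) (c, !γ) ++ w)

/-- Two virtual knotoid diagrams represent the same virtual knotoid. -/
def VirtualKnotoidDiagram.Equivalent (K L : VirtualKnotoidDiagram) : Prop :=
  Relation.EqvGen
    (fun K L : VirtualKnotoidDiagram => ReidemeisterStep K.1.word L.1.word) K L

/-- Two classical knotoid diagrams represent the same classical knotoid: they are related by moves
through classical diagrams. -/
def ClassicalKnotoidDiagram.Equivalent (K L : ClassicalKnotoidDiagram) : Prop :=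
  Relation.EqvGen
    (fun K L : ClassicalKnotoidDiagram => ReidemeisterStep K.1.1.word L.1.1.word) K L

/-! ### Colorings -/

namespace KnotoidCode

section Coloring

variable {X : Type*} [Biquandle X]

/-- `f` labels the semi-arcs by `X` so that the labels at every crossing fit. At a positive
crossing (over-passage `true`), with `x` on the incoming under-arc and `y` on the outgoing
over-arc, the outgoing under-arc has `x ▷ᵤ y` and the incoming over-arc has `y ▷ₒ x`. At a negative
crossing (over-passage `false`), with `x` on the outgoing under-arc and `y` on the incoming
over-arc, the incoming under-arc has `x ▷ᵤ y` and the outgoing over-arc has `y ▷ₒ x`. Labels do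
not change at virtual crossings. -/
def IsColoring (D : KnotoidCode) (f : D.Arc → X) : Prop :=
  ∀ c : D.Cr,
    match c.kind with
    | .pos =>
        f (c.outArc false) = f (c.inArc false) ▷ᵤ f (c.outArc true) ∧
        f (c.inArc true) = f (c.outArc true) ▷ₒ f (c.inArc false)
    | .neg =>
        f (c.inArc true) = f (c.outArc true) ▷ᵤ f (c.inArc false) ∧
        f (c.outArc false) = f (c.inArc false) ▷ₒ f (c.outArc true)
    | .virt => ∀ b, f (c.outArc b) = f (c.inArc b)

variable (X) in
/-- The set of `X`-colorings. -/
abbrev Coloring (D : KnotoidCode) := {f : D.Arc → X // D.IsColoring f}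

variable (X) in
/-- The biquandle counting invariant: the number of `X`-colorings. -/
noncomputable def coloringCount (D : KnotoidCode) : ℕ := Nat.card (D.Coloring X)

end Coloring

/-! ### The fundamental biquandle -/

/-- Words in generators `α`, the two operations, the inverses of the right translations, and the
two components of the inverse of the map `S (x, y) = (y ▷ₒ x, x ▷ᵤ y)`. -/
inductive BTerm (α : Type) : Type
  | gen (a : α)
  | un (s t : BTerm α)
  | ov (s t : BTerm α)
  | underInv (s t : BTerm α)
  | overInv (s t : BTerm α)
  | switchInv₁ (s t : BTerm α)
  | switchInv₂ (s t : BTerm α)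

open BTerm in
/-- The congruence generated by the biquandle axioms and by the crossing relations of `D`. -/
inductive BRel (D : KnotoidCode) : BTerm D.Arc → BTerm D.Arc → Prop
  | refl (s) : BRel D s s
  | symm {s t} : BRel D s t → BRel D t s
  | trans {s t u} : BRel D s t → BRel D t u → BRel D s u
  | congr_under {s s' t t'} : BRel D s s' → BRel D t t' → BRel D (un s t) (un s' t')
  | congr_over {s s' t t'} : BRel D s s' → BRel D t t' → BRel D (ov s t) (ov s' t')
  | congr_underInv {s s' t t'} :
      BRel D s s' → BRel D t t' → BRel D (underInv s t) (underInv s' t')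
  | congr_overInv {s s' t t'} :
      BRel D s s' → BRel D t t' → BRel D (overInv s t) (overInv s' t')
  | congr_switchInv₁ {s s' t t'} :
      BRel D s s' → BRel D t t' → BRel D (switchInv₁ s t) (switchInv₁ s' t')
  | congr_switchInv₂ {s s' t t'} :
      BRel D s s' → BRel D t t' → BRel D (switchInv₂ s t) (switchInv₂ s' t')
  | under_self (s) : BRel D (un s s) (ov s s)
  | under_underInv (s t) : BRel D (un (underInv s t) t) s
  | underInv_under (s t) : BRel D (underInv (un s t) t) s
  | over_overInv (s t) : BRel D (ov (overInv s t) t) s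
  | overInv_over (s t) : BRel D (overInv (ov s t) t) s
  | switch_inv₁ (s t) : BRel D (ov (switchInv₂ s t) (switchInv₁ s t)) s
  | switch_inv₂ (s t) : BRel D (un (switchInv₁ s t) (switchInv₂ s t)) t
  | inv_switch₁ (s t) : BRel D (switchInv₁ (ov t s) (un s t)) s
  | inv_switch₂ (s t) : BRel D (switchInv₂ (ov t s) (un s t)) t
  | exchange_under (x y z) :
      BRel D (un (un x y) (un z y)) (un (un x z) (ov y z))
  | exchange_mixed (x y z) :
      BRel D (ov (un x y) (un z y)) (un (ov x z) (ov y z))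
  | exchange_over (x y z) :
      BRel D (ov (ov x y) (ov z y)) (ov (ov x z) (un y z))
  | pos_under (c : D.Cr) : c.kind = .pos →
      BRel D (gen (c.outArc false)) (un (gen (c.inArc false)) (gen (c.outArc true)))
  | pos_over (c : D.Cr) : c.kind = .pos →
      BRel D (gen (c.inArc true)) (ov (gen (c.outArc true)) (gen (c.inArc false)))
  | neg_under (c : D.Cr) : c.kind = .neg →
      BRel D (gen (c.inArc true)) (un (gen (c.outArc true)) (gen (c.inArc false)))
  | neg_over (c : D.Cr) : c.kind = .neg →
      BRel D (gen (c.outArc false)) (ov (gen (c.inArc false)) (gen (c.outArc true)))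
  | virt (c : D.Cr) (b) : c.kind = .virt →
      BRel D (gen (c.outArc b)) (gen (c.inArc b))

def bSetoid (D : KnotoidCode) : Setoid (BTerm D.Arc) where
  r := BRel D
  iseqv := ⟨BRel.refl, BRel.symm, BRel.trans⟩

/-- The fundamental biquandle of a diagram. -/
def FundamentalBiquandle (D : KnotoidCode) : Type := Quotient D.bSetoid

namespace FundamentalBiquandle

variable {D : KnotoidCode}

def mk (s : BTerm D.Arc) : D.FundamentalBiquandle := Quotient.mk D.bSetoid s

/-- The generator of a semi-arc. -/
def gen (a : D.Arc) : D.FundamentalBiquandle := mk (.gen a)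

theorem sound {s t : BTerm D.Arc} (h : BRel D s t) : mk s = mk t := Quotient.sound h

theorem ind {p : D.FundamentalBiquandle → Prop} (h : ∀ s, p (mk s)) (q) : p q :=
  Quotient.ind h q

def un : D.FundamentalBiquandle → D.FundamentalBiquandle → D.FundamentalBiquandle :=
  Quotient.map₂ BTerm.un (fun _ _ h _ _ k => BRel.congr_under h k)

def ov : D.FundamentalBiquandle → D.FundamentalBiquandle → D.FundamentalBiquandle :=
  Quotient.map₂ BTerm.ov (fun _ _ h _ _ k => BRel.congr_over h k)

def underInv : D.FundamentalBiquandle → D.FundamentalBiquandle → D.FundamentalBiquandle :=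
  Quotient.map₂ BTerm.underInv (fun _ _ h _ _ k => BRel.congr_underInv h k)

def overInv : D.FundamentalBiquandle → D.FundamentalBiquandle → D.FundamentalBiquandle :=
  Quotient.map₂ BTerm.overInv (fun _ _ h _ _ k => BRel.congr_overInv h k)

def switchInv₁ : D.FundamentalBiquandle → D.FundamentalBiquandle → D.FundamentalBiquandle :=
  Quotient.map₂ BTerm.switchInv₁ (fun _ _ h _ _ k => BRel.congr_switchInv₁ h k)

def switchInv₂ : D.FundamentalBiquandle → D.FundamentalBiquandle → D.FundamentalBiquandle :=
  Quotient.map₂ BTerm.switchInv₂ (fun _ _ h _ _ k => BRel.congr_switchInv₂ h k)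

instance : Biquandle D.FundamentalBiquandle where
  un := un
  ov := ov
  under_self := ind fun s => sound (.under_self s)
  over_bijective := fun y => Function.bijective_iff_has_inverse.2
    ⟨fun x => overInv x y,
      fun x => by
        induction x using ind with | _ s => ?_
        induction y using ind with | _ t => ?_
        exact sound (.overInv_over s t),
      fun x => by
        induction x using ind with | _ s => ?_
        induction y using ind with | _ t => ?_
        exact sound (.over_overInv s t)⟩
  under_bijective := fun y => Function.bijective_iff_has_inverse.2
    ⟨fun x => underInv x y,
      fun x => by
        induction x using ind with | _ s => ?_
        induction y using ind with | _ t => ?_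
        exact sound (.underInv_under s t),
      fun x => by
        induction x using ind with | _ s => ?_
        induction y using ind with | _ t => ?_
        exact sound (.under_underInv s t)⟩
  switch_bijective := Function.bijective_iff_has_inverse.2
    ⟨fun p => (switchInv₁ p.1 p.2, switchInv₂ p.1 p.2),
      fun ⟨x, y⟩ => by
        induction x using ind with | _ s => ?_
        induction y using ind with | _ t => ?_
        exact Prod.ext (sound (.inv_switch₁ s t)) (sound (.inv_switch₂ s t)),
      fun ⟨x, y⟩ => by
        induction x using ind with | _ s => ?_
        induction y using ind with | _ t => ?_
        exact Prod.ext (sound (.switch_inv₁ s t)) (sound (.switch_inv₂ s t))⟩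
  exchange_under := ind fun s => ind fun t => ind fun u => sound (.exchange_under s t u)
  exchange_mixed := ind fun s => ind fun t => ind fun u => sound (.exchange_mixed s t u)
  exchange_over := ind fun s => ind fun t => ind fun u => sound (.exchange_over s t u)

/-- A homomorphism is determined by the images of the generators. -/
theorem hom_ext {X : Type*} [Biquandle X] {f g : BiquandleHom D.FundamentalBiquandle X}
    (h : ∀ a, f.toFun (gen a) = g.toFun (gen a)) : f = g := by
  apply BiquandleHom.ext
  funext q
  induction q using ind with | _ s => ?_
  induction s with
  | gen a => exact h a
  | un s t hs ht =>
    have hf := f.map_under (mk s) (mk t)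
    have hg := g.map_under (mk s) (mk t)
    rw [hs, ht] at hf
    exact hf.trans hg.symm
  | ov s t hs ht =>
    have hf := f.map_over (mk s) (mk t)
    have hg := g.map_over (mk s) (mk t)
    rw [hs, ht] at hf
    exact hf.trans hg.symm
  | underInv s t hs ht =>
    apply (Biquandle.under_bijective (g.toFun (mk t))).1
    have hf := f.map_under (mk (.underInv s t)) (mk t)
    have hg := g.map_under (mk (.underInv s t)) (mk t)
    have e : mk (.underInv s t) ▷ᵤ mk t = mk s := sound (.under_underInv s t)
    rw [e, hs, ht] at hf
    rw [e] at hg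
    exact hf.symm.trans hg
  | overInv s t hs ht =>
    apply (Biquandle.over_bijective (g.toFun (mk t))).1
    have hf := f.map_over (mk (.overInv s t)) (mk t)
    have hg := g.map_over (mk (.overInv s t)) (mk t)
    have e : mk (.overInv s t) ▷ₒ mk t = mk s := sound (.over_overInv s t)
    rw [e, hs, ht] at hf
    rw [e] at hg
    exact hf.symm.trans hg
  | switchInv₁ s t hs ht => exact congrArg Prod.fst (switch_aux f g s t hs ht)
  | switchInv₂ s t hs ht => exact congrArg Prod.snd (switch_aux f g s t hs ht)
where
  switch_aux {X : Type _} [Biquandle X] (f g : BiquandleHom D.FundamentalBiquandle X)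
      (s t : BTerm D.Arc) (hs : f.toFun (mk s) = g.toFun (mk s))
      (ht : f.toFun (mk t) = g.toFun (mk t)) :
      (f.toFun (mk (.switchInv₁ s t)), f.toFun (mk (.switchInv₂ s t))) =
        (g.toFun (mk (.switchInv₁ s t)), g.toFun (mk (.switchInv₂ s t))) := by
    apply Biquandle.switch_bijective.1
    have e₁ : mk (.switchInv₂ s t) ▷ₒ mk (.switchInv₁ s t) = mk s := sound (.switch_inv₁ s t)
    have e₂ : mk (.switchInv₁ s t) ▷ᵤ mk (.switchInv₂ s t) = mk t := sound (.switch_inv₂ s t)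
    apply Prod.ext
    · change f.toFun _ ▷ₒ f.toFun _ = g.toFun _ ▷ₒ g.toFun _
      rw [← f.map_over, ← g.map_over, e₁, hs]
    · change f.toFun _ ▷ᵤ f.toFun _ = g.toFun _ ▷ᵤ g.toFun _
      rw [← f.map_under, ← g.map_under, e₂, ht]

instance {X : Type*} [Biquandle X] [Finite X] :
    Finite (BiquandleHom D.FundamentalBiquandle X) :=
  Finite.of_injective (fun f a => f.toFun (gen a)) fun _ _ h => hom_ext (congrFun h)

end FundamentalBiquandle

/-! ### States and the virtual bracket -/

/-- The smoothings of a classical crossing: the one that respects the orientation, the one that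
does not, and the replacement by a virtual crossing. -/
inductive Smoothing where
  | oriented
  | unoriented
  | virt
  deriving DecidableEq

instance : Fintype Smoothing where
  elems := {.oriented, .unoriented, .virt}
  complete := by intro s; cases s <;> simp

/-- The classical crossings. -/
abbrev ClassicalCr (D : KnotoidCode) := {c : D.Cr // c.kind ≠ .virt}

/-- A state: a smoothing of each classical crossing. -/
abbrev State (D : KnotoidCode) := D.ClassicalCr → Smoothing

noncomputable instance (D : KnotoidCode) : Fintype D.ClassicalCr := Fintype.ofFinite _

noncomputable instance (D : KnotoidCode) : Fintype D.State := Fintype.ofFinite _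

/-- Arcs that are joined to each other at some crossing of the diagram once it is smoothed. -/
inductive Joined (D : KnotoidCode) (S : D.State) : D.Arc → D.Arc → Prop
  | virt_crossing (c : D.Cr) (b : Bool) (h : c.kind = .virt) : Joined D S (c.inArc b) (c.outArc b)
  | virt (c : D.ClassicalCr) (b : Bool) (h : S c = .virt) : Joined D S (c.1.inArc b) (c.1.outArc b)
  | oriented (c : D.ClassicalCr) (b : Bool) (h : S c = .oriented) :
      Joined D S (c.1.inArc b) (c.1.outArc !b)
  | unoriented_in (c : D.ClassicalCr) (h : S c = .unoriented) :
      Joined D S (c.1.inArc true) (c.1.inArc false)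
  | unoriented_out (c : D.ClassicalCr) (h : S c = .unoriented) :
      Joined D S (c.1.outArc true) (c.1.outArc false)

/-- The number of components of a state, the open one included. -/
noncomputable def componentCount (D : KnotoidCode) (S : D.State) : ℕ := Nat.card (Quot (D.Joined S))

/-- The writhe. -/
noncomputable def writhe (D : KnotoidCode) : ℤ :=
  ∑ c : D.Cr, match c.kind with
    | .pos => 1
    | .neg => -1
    | .virt => 0

section Bracket

variable {X R : Type*} [Biquandle X] [CommRing R]

/-- The coefficient of a smoothed classical crossing of a labelled diagram. The indices `x, y` are
the labels of the incoming under-arc and outgoing over-arc at a positive crossing, and of the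
outgoing under-arc and incoming over-arc at a negative crossing. -/
def coefficient (β : VirtualBracket X R) {D : KnotoidCode} (f : D.Arc → X) (c : D.Cr)
    (σ : Smoothing) : R :=
  match c.kind, σ with
  | .pos, .oriented => β.A (f (c.inArc false)) (f (c.outArc true))
  | .pos, .unoriented => β.B (f (c.inArc false)) (f (c.outArc true))
  | .pos, .virt => β.V (f (c.inArc false)) (f (c.outArc true))
  | .neg, .oriented => β.C (f (c.outArc true)) (f (c.inArc false))
  | .neg, .unoriented => β.D (f (c.outArc true)) (f (c.inArc false))
  | .neg, .virt => β.U (f (c.outArc true)) (f (c.inArc false))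
  | .virt, _ => 1

/-- The value of a state. -/
noncomputable def stateValue (β : VirtualBracket X R) (D : KnotoidCode) (f : D.Arc → X)
    (S : D.State) : R :=
  (∏ c : D.ClassicalCr, coefficient β f c.1 (S c)) * β.δ ^ D.componentCount S *
    ((β.ω ^ (-D.writhe) : Rˣ) : R)

/-- The `X`-virtual bracket of a labelled diagram. -/
noncomputable def bracket (β : VirtualBracket X R) (D : KnotoidCode) (f : D.Arc → X) : R :=
  ∑ S : D.State, stateValue β D f S

open Classical in
/-- The `X`-virtual bracket multiset: the values of the bracket at the labellings of the semi-arcs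
given by the homomorphisms from the fundamental biquandle to `X`. -/
noncomputable def bracketMultiset [Finite X] (β : VirtualBracket X R) (D : KnotoidCode) :
    Multiset R :=
  letI := Fintype.ofFinite (BiquandleHom D.FundamentalBiquandle X)
  (Finset.univ : Finset (BiquandleHom D.FundamentalBiquandle X)).val.map
    fun f => bracket β D fun a => f.toFun (FundamentalBiquandle.gen a)

open Classical in
/-- The multiset of the values of the bracket at the `X`-colorings. -/
noncomputable def coloringBracketMultiset [Finite X] (β : VirtualBracket X R) (D : KnotoidCode) :
    Multiset R :=
  letI := Fintype.ofFinite (D.Coloring X)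
  (Finset.univ : Finset (D.Coloring X)).val.map fun f => bracket β D f.1

end Bracket

end KnotoidCode

/-! The fundamental biquandle is presented by the semi-arcs and the crossing relations, so its
homomorphisms to `X` are the colorings (`homEquivColoring`). Invariance then asks, for each move,
for a bijection between the colorings of the two diagrams that preserves brackets. The bijection
keeps all labels outside the move: the biquandle axioms say that the labels on the inner arcs of the
changed part exist and are unique once the outer ones are given (`SameBracket.local`).

For the brackets, a state is an equivalence relation on arcs and contributes `δ` to the number of
its classes. By `stateSum_local` it suffices to compare the two sides of a move locally, with an
arbitrary relation `r` standing for what the rest of the diagram joins. Each state of the local part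
matches the outer ends in pairs and may close off loops, so it contributes `δ ^ k` times a power
that depends only on the matching (`pow_classCount`). There is one matching for a kink, three for a
bigon and fifteen for a triangle; comparing the coefficients of each matching gives linear
combinations of the bracket axioms. Arcs are coded by numbers, so that the matching of each state is
found by a decidable elimination of vertices of degree two. The factor `ω` left by a kink is
cancelled by the change of the writhe.

First and second moves are done in two stages. The crossings are first replaced by virtual kinks on
the same arcs (`SameBracket.kink`, `SameBracket.bigon`); a virtual kink merely concatenates three
arcs, and these are then merged and the arcs renumbered (`SameBracket.collapse`).

For third moves only one shape is computed (`wordEquiv_triangle`): the relation "passes as `true`"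
orders the three strands linearly, with fixed orders along them, and the crossings are all positive
or two of them are virtual. Renaming strands and reading the move backwards gives all linearly
ordered shapes (`wordEquiv_of_swapInOrder`). A crossing is exchanged for one of opposite sign by
creating one bigon and cancelling another (`WordContext.flip`); this makes every classical third
move positive, and a strand on top of the other two then gives a linear order. At virtual crossings
the same exchange reverses the order between two strands, which breaks a cyclic order. -/

/-! ### Gluing classes of an equivalence relation -/

/-- The equivalence relation obtained by joining the classes of `x` and `y`. -/
def glue {E : Type*} (r : Setoid E) (x y : E) : Setoid E where
  r u v := r u v ∨ (r u x ∧ r y v) ∨ (r u y ∧ r x v)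
  iseqv := by
    have hs : ∀ {a b}, r a b → r b a := fun h => r.symm' h
    have ht : ∀ {a b c}, r a b → r b c → r a c := fun h h' => r.trans' h h'
    refine ⟨fun u => Or.inl (r.refl' u), ?_, ?_⟩
    · rintro u v (h | ⟨h, h'⟩ | ⟨h, h'⟩)
      · exact Or.inl (hs h)
      · exact Or.inr (Or.inr ⟨hs h', hs h⟩)
      · exact Or.inr (Or.inl ⟨hs h', hs h⟩)
    · rintro u v w (h | ⟨h, h'⟩ | ⟨h, h'⟩) (k | ⟨k, k'⟩ | ⟨k, k'⟩)
      · exact Or.inl (ht h k)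
      · exact Or.inr (Or.inl ⟨ht h k, k'⟩)
      · exact Or.inr (Or.inr ⟨ht h k, k'⟩)
      · exact Or.inr (Or.inl ⟨h, ht h' k⟩)
      · exact Or.inr (Or.inl ⟨h, k'⟩)
      · exact Or.inl (ht h k')
      · exact Or.inr (Or.inr ⟨h, ht h' k⟩)
      · exact Or.inl (ht h k')
      · exact Or.inr (Or.inr ⟨h, k'⟩)

section Glue

variable {E : Type*}

theorem le_glue (r : Setoid E) (x y : E) : r ≤ glue r x y := fun _ _ h => Or.inl h

theorem glue_pair (r : Setoid E) (x y : E) : glue r x y x y :=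
  Or.inr (Or.inl ⟨r.refl' x, r.refl' y⟩)

theorem glue_le {r s : Setoid E} {x y : E} (h : r ≤ s) (hxy : s x y) : glue r x y ≤ s := by
  rintro u v (k | ⟨k, k'⟩ | ⟨k, k'⟩)
  · exact h k
  · exact s.trans' (h k) (s.trans' hxy (h k'))
  · exact s.trans' (h k) (s.trans' (s.symm' hxy) (h k'))

/-- The universal property. A setoid is determined by the setoids above it, so identities between
iterated gluings become propositional statements about an arbitrary upper bound `s`. -/
theorem glue_le_iff {r s : Setoid E} {x y : E} : glue r x y ≤ s ↔ r ≤ s ∧ s x y :=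
  ⟨fun h => ⟨(le_glue r x y).trans h, h (glue_pair r x y)⟩, fun h => glue_le h.1 h.2⟩

theorem glue_comm (r : Setoid E) (x y u v : E) :
    glue (glue r x y) u v = glue (glue r u v) x y :=
  eq_of_forall_ge_iff fun s => by simp only [glue_le_iff]; tauto

theorem glue_swap (r : Setoid E) (x y : E) : glue r x y = glue r y x :=
  eq_of_forall_ge_iff fun s => by rw [glue_le_iff, glue_le_iff, s.comm' (x := x)]

theorem glue_self (r : Setoid E) (x : E) : glue r x x = r :=
  eq_of_forall_ge_iff fun s => by simp only [glue_le_iff, s.refl' x, and_true]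

/-- A path `x`, `n`, `y` through `n` is replaced by the edge from `x` to `y` with `n` left dangling
at `x`. This prepares the removal of `n` by `classCount_glue`. -/
theorem glue_path (r : Setoid E) (n x y : E) :
    glue (glue r n y) n x = glue (glue r x y) n x :=
  eq_of_forall_ge_iff fun s => by
    simp only [glue_le_iff]
    exact ⟨fun h => ⟨⟨h.1.1, s.trans' (s.symm' h.2) h.1.2⟩, h.2⟩,
      fun h => ⟨⟨h.1.1, s.trans' h.2 h.1.2⟩, h.2⟩⟩

/-- Definitional because `glue` is given by explicit clauses rather than as a generated relation. -/
theorem comap_glue {F : Type*} (φ : F → E) (r : Setoid E) (x y : F) :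
    Setoid.comap φ (glue r (φ x) (φ y)) = glue (Setoid.comap φ r) x y := rfl

/-- The class of `n` is a singleton. -/
def IsolatedIn (r : Setoid E) (n : E) : Prop := ∀ m, r n m → m = n

theorem IsolatedIn.glue {r : Setoid E} {n x y : E} (h : IsolatedIn r n) (hx : x ≠ n)
    (hy : y ≠ n) : IsolatedIn (glue r x y) n := by
  rintro m (k | ⟨k, _⟩ | ⟨k, _⟩)
  · exact h m k
  · exact absurd (h x k) hx
  · exact absurd (h y k) hy

/-- The number of classes. -/
noncomputable def classCount (r : Setoid E) : ℕ := Nat.card (Quotient r)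

instance (r : Setoid E) (x y : E) [Finite (Quotient r)] : Finite (Quotient (glue r x y)) :=
  Finite.of_surjective (Quotient.map' (s₁ := r) (s₂ := glue r x y) id (fun _ _ h => Or.inl h))
    (fun q => Quotient.inductionOn' q fun u => ⟨Quotient.mk'' u, rfl⟩)

/-- The classes of `r` other than that of `n` are in bijection with the classes after gluing: a
dangling vertex costs exactly one class. -/
theorem classCount_glue {r : Setoid E} [Finite (Quotient r)] {n x : E} (h : IsolatedIn r n)
    (hx : x ≠ n) : classCount (glue r n x) + 1 = classCount r := by
  classical
  have hb : Function.Bijective (fun q : {q : Quotient r // q ≠ Quotient.mk r n} =>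
      Quotient.map' (s₁ := r) (s₂ := glue r n x) id (fun _ _ h => Or.inl h) q.1) := by
    constructor
    · rintro ⟨p, hp⟩ ⟨q, hq⟩ e
      induction p using Quotient.inductionOn with | _ u => ?_
      induction q using Quotient.inductionOn with | _ v => ?_
      have e' : glue r n x u v := Quotient.exact e
      have hu : ¬ r u n := fun k => hp (Quotient.sound k)
      have hv : ¬ r n v := fun k => hq (Quotient.sound (r.symm' k))
      exact Subtype.ext (Quotient.sound (by
        rcases e' with k | ⟨k, _⟩ | ⟨_, k⟩
        · exact k
        · exact absurd k hu
        · exact absurd k hv))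
    · intro q
      induction q using Quotient.inductionOn with | _ u => ?_
      -- The only class not represented by itself is that of `n`; after gluing it is represented by
      -- `x`.
      by_cases hu : r u n
      · refine ⟨⟨Quotient.mk r x, fun k => hx (h x (r.symm' (Quotient.exact k)))⟩, ?_⟩
        exact Quotient.sound (s := glue r n x) (Or.inr (Or.inr ⟨r.refl' x, r.symm' hu⟩))
      · exact ⟨⟨Quotient.mk r u, fun k => hu (Quotient.exact k)⟩, rfl⟩
  have := Fintype.ofFinite (Quotient r)
  unfold classCount
  rw [← Nat.card_congr (Equiv.ofBijective _ hb), Nat.card_eq_fintype_card,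
    Nat.card_eq_fintype_card, Fintype.card_subtype_compl, Fintype.card_subtype_eq]
  exact Nat.sub_add_cancel (Fintype.card_pos_iff.2 ⟨Quotient.mk r n⟩)

theorem classCount_comap {F : Type*} (φ : F → E) (hφ : Function.Surjective φ) (r : Setoid E) :
    classCount (Setoid.comap φ r) = classCount r :=
  Nat.card_congr (Equiv.ofBijective
    (Quotient.map' (s₁ := Setoid.comap φ r) (s₂ := r) φ (fun _ _ h => h))
    ⟨fun p q => Quotient.inductionOn₂' p q fun _ _ h => 
        Quotient.sound' (Quotient.exact' h : r (φ _) (φ _)),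
      fun q => Quotient.inductionOn' q fun u =>
        let ⟨v, hv⟩ := hφ u
        ⟨Quotient.mk'' v, congrArg Quotient.mk'' hv⟩⟩)

end Glue

/-! ### Elimination of interior vertices from a finite graph glued to a relation -/

section Elimination

variable {E : Type*}

/-- Join the ends of all edges of a list; `κ` names the vertices. -/
def glueAll (κ : ℕ → E) (L : List (ℕ × ℕ)) (r : Setoid E) : Setoid E :=
  L.foldr (fun e s => glue s (κ e.1) (κ e.2)) r

theorem glueAll_perm (κ : ℕ → E) {L M : List (ℕ × ℕ)} (h : L.Perm M) (r : Setoid E) :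
    glueAll κ L r = glueAll κ M r := by
  induction h with
  | nil => rfl
  | cons e _ ih => exact congrArg (fun s => glue s (κ e.1) (κ e.2)) ih
  | swap e e' L => exact glue_comm _ _ _ _ _
  | trans _ _ ih ih' => exact ih.trans ih'

instance (κ : ℕ → E) (L : List (ℕ × ℕ)) (r : Setoid E) [Finite (Quotient r)] :
    Finite (Quotient (glueAll κ L r)) := by
  induction L with
  | nil => assumption
  | cons e L ih => exact inferInstanceAs (Finite (Quotient (glue (glueAll κ L r) _ _)))

/-- The edge `e` has `n` as an end. -/
def touches (n : ℕ) (e : ℕ × ℕ) : Bool := e.1 == n || e.2 == n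

/-- The end of `e` that is not `n`. -/
def otherEnd (n : ℕ) (e : ℕ × ℕ) : ℕ := if e.1 = n then e.2 else e.1

theorem glueAll_isolated {κ : ℕ → E} {n : ℕ} (hκ : ∀ m, m ≠ n → κ m ≠ κ n) {r : Setoid E}
    (h : IsolatedIn r (κ n)) {L : List (ℕ × ℕ)} (hL : ∀ e ∈ L, touches n e = false) :
    IsolatedIn (glueAll κ L r) (κ n) := by
  induction L with
  | nil => exact h
  | cons e L ih =>
    have he := hL e (by simp)
    simp only [touches, Bool.or_eq_false_iff, beq_eq_false_iff_ne] at he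
    exact (ih fun e he => hL e (by simp [he])).glue (hκ _ he.1) (hκ _ he.2)

/-- Remove a vertex of degree two; the number says how many closed components disappear. -/
def elimVertex (n : ℕ) (L : List (ℕ × ℕ)) : Option (List (ℕ × ℕ) × ℕ) :=
  match L.filter (touches n) with
  | [e] => if e = (n, n) then some (L.filter (fun e => !touches n e), 1) else none
  | [e, e'] =>
    if otherEnd n e ≠ n ∧ otherEnd n e' ≠ n then
      some ((otherEnd n e, otherEnd n e') :: L.filter (fun e => !touches n e), 0)
    else none
  | _ => none

theorem glueAll_cons_otherEnd {κ : ℕ → E} {n : ℕ} {e : ℕ × ℕ} (he : touches n e = true)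
    (s : Setoid E) : glue s (κ e.1) (κ e.2) = glue s (κ n) (κ (otherEnd n e)) := by
  obtain ⟨a, b⟩ := e
  simp only [touches, Bool.or_eq_true, beq_iff_eq] at he
  unfold otherEnd
  split_ifs with h
  · simp only at h; rw [h]
  · simp only at h; rw [glue_swap]; simp [he.resolve_left h]

/-- Two edges at `n` are turned by `glue_path` into a shortcut and a dangling edge, whose removal
sets `n` free as a class of its own: hence the `+ 1`. A loop at `n` joins nothing; there `n` is
already a class by itself and is recorded as a closed component, `k = 1`. -/
theorem elimVertex_sound {κ : ℕ → E} {n k : ℕ} (hκ : ∀ m, m ≠ n → κ m ≠ κ n) {r : Setoid E}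
    [Finite (Quotient r)] (h : IsolatedIn r (κ n)) {L L' : List (ℕ × ℕ)}
    (hL : elimVertex n L = some (L', k)) :
    classCount (glueAll κ L r) + 1 = classCount (glueAll κ L' r) + k ∧
      ∀ e ∈ L', touches n e = false := by
  have hp := glueAll_perm κ (List.filter_append_perm (touches n) L).symm r
  have hout : ∀ e ∈ L.filter (fun e => !touches n e), touches n e = false := by
    intro e he; simpa using (List.mem_filter.1 he).2
  have hin : ∀ e ∈ L.filter (touches n), touches n e = true := fun e he =>
    (List.mem_filter.1 he).2
  unfold elimVertex at hL
  split at hL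
  · rename_i e he
    split_ifs at hL with hc
    rw [hp, he]
    cases hL
    refine ⟨?_, hout⟩
    subst hc
    exact congrArg (fun s => classCount s + 1) (glue_self _ _)
  · rename_i e e' he
    split_ifs at hL with hc
    rw [he] at hin
    rw [hp, he]
    cases hL
    have hiso : IsolatedIn (glueAll κ ((otherEnd n e, otherEnd n e') ::
        L.filter (fun e => !touches n e)) r) (κ n) :=
      (glueAll_isolated hκ h hout).glue (hκ _ hc.1) (hκ _ hc.2)
    refine ⟨?_, ?_⟩
    · rw [add_zero, ← classCount_glue hiso (hκ _ hc.1)]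
      change classCount (glue (glue (glueAll κ _ r) _ _) _ _) + 1 = _
      rw [glueAll_cons_otherEnd (hin e (by simp)), glueAll_cons_otherEnd (hin e' (by simp)),
        glue_path]
      rfl
    · intro e'' h''
      rcases List.mem_cons.1 h'' with rfl | h''
      · simp [touches, hc.1, hc.2]
      · exact hout _ h''
  · exact absurd hL (by simp)

/-- Remove the vertices of a list. -/
def elimAll : List ℕ → List (ℕ × ℕ) → Option (List (ℕ × ℕ) × ℕ)
  | [], L => some (L, 0)
  | n :: N, L =>
    match elimVertex n L with
    | none => none
    | some (L', k) =>
      match elimAll N L' with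
      | none => none
      | some (L'', k') => some (L'', k + k')

theorem elimAll_sound {κ : ℕ → E} {N : List ℕ} (hκ : ∀ n ∈ N, ∀ m, m ≠ n → κ m ≠ κ n)
    {r : Setoid E} [Finite (Quotient r)] (h : ∀ n ∈ N, IsolatedIn r (κ n)) {k : ℕ}
    {L L' : List (ℕ × ℕ)} (hL : elimAll N L = some (L', k)) :
    classCount (glueAll κ L r) + N.length = classCount (glueAll κ L' r) + k := by
  induction N generalizing L k with
  | nil => cases hL; rfl
  | cons n N ih =>
    simp only [elimAll] at hL
    split at hL
    · exact absurd hL (by simp)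
    rename_i M j hM
    split at hL
    · exact absurd hL (by simp)
    rename_i M' j' hM'
    cases hL
    have h₁ := (elimVertex_sound (hκ n (by simp)) (h n (by simp)) hM).1
    have h₂ := ih (fun n hn => hκ n (by simp [hn])) (fun n hn => h n (by simp [hn])) hM'
    simp only [List.length_cons]
    omega

/-- Orient every edge upwards and sort the edges. -/
def sortEdges (L : List (ℕ × ℕ)) : List (ℕ × ℕ) :=
  (L.map fun e => if e.1 ≤ e.2 then e else (e.2, e.1)).insertionSort (fun e e' => e.1 ≤ e'.1)

/-- Sorting gives a normal form, so that a matching of the outer ends can be recognised by equality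
of lists in `ReducesTo`. -/
theorem glueAll_sortEdges (κ : ℕ → E) (L : List (ℕ × ℕ)) (r : Setoid E) :
    glueAll κ (sortEdges L) r = glueAll κ L r := by
  rw [sortEdges, glueAll_perm κ (List.perm_insertionSort _ _)]
  induction L with
  | nil => rfl
  | cons e L ih =>
    simp only [glueAll, List.map_cons, List.foldr_cons] at ih ⊢
    rw [ih]
    split_ifs
    · rfl
    · exact glue_swap _ _ _

/-- After elimination of the vertices `N` the edges `L` become `M`, and `k` closed components
disappear. -/
def ReducesTo (N : List ℕ) (M : List (ℕ × ℕ)) (k : ℕ) (L : List (ℕ × ℕ)) : Prop :=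
  (elimAll N L).map (fun p => (sortEdges p.1, p.2)) = some (M, k)

instance (N M k L) : Decidable (ReducesTo N M k L) := by unfold ReducesTo; infer_instance

/-- Isolated vertices with distinct names are distinct classes. This makes the natural subtraction
in `pow_classCount` a genuine one. -/
theorem length_le_classCount {κ : ℕ → E} {N : List ℕ} (hN : N.Nodup)
    (hκ : ∀ n ∈ N, ∀ m, m ≠ n → κ m ≠ κ n) {r : Setoid E} [Finite (Quotient r)]
    (h : ∀ n ∈ N, IsolatedIn r (κ n)) : N.length ≤ classCount r := by
  classical
  have := Fintype.ofFinite (Quotient r)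
  have hn : (N.map fun n => Quotient.mk r (κ n)).Nodup := by
    refine hN.map_on fun m hm n hn e => ?_
    by_contra hne
    exact hκ n hn m hne (h n hn _ (r.symm' (Quotient.exact e)))
  have := hn.length_le_card
  rwa [List.length_map, ← Nat.card_eq_fintype_card] at this

/-- The eliminated vertices `N` survive in the relation as isolated classes and are subtracted. What
remains depends only on the matching `M`, so states with the same matching become comparable, with a
factor `δ` for each closed component. -/
theorem pow_classCount {R : Type*} [CommRing R] (δ : R) {κ : ℕ → E} {N : List ℕ} (hN : N.Nodup)
    (hκ : ∀ n ∈ N, ∀ m, m ≠ n → κ m ≠ κ n) {r : Setoid E} [Finite (Quotient r)]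
    (h : ∀ n ∈ N, IsolatedIn r (κ n)) (M : List (ℕ × ℕ)) (k : ℕ)
    (hM : ∀ n ∈ N, ∀ e ∈ M, touches n e = false) {L : List (ℕ × ℕ)} (hL : ReducesTo N M k L) :
    δ ^ classCount (glueAll κ L r) = δ ^ k * δ ^ (classCount (glueAll κ M r) - N.length) := by
  simp only [ReducesTo, Option.map_eq_some_iff, Prod.exists, Prod.mk.injEq] at hL
  obtain ⟨L', k', hL', hs, rfl⟩ := hL
  have h₁ := elimAll_sound hκ h hL'
  have h₂ : N.length ≤ classCount (glueAll κ M r) :=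
    length_le_classCount hN hκ fun n hn => glueAll_isolated (hκ n hn) (h n hn) (hM n hn)
  rw [← hs, glueAll_sortEdges] at h₂ ⊢
  rw [← pow_add]
  congr 1
  omega

end Elimination

/-! ### State sums -/

/-- The coefficients of the three smoothings of a crossing: oriented, unoriented, virtual. -/
structure Weights (R : Type*) where
  a : R
  b : R
  v : R

/-- A crossing with weights, given by the arcs on which its two passages arrive and leave. -/
structure Chord (R : Type*) where
  wt : Weights R
  tI : ℕ
  tO : ℕ
  fI : ℕ
  fO : ℕ

/-- The weights of a virtual crossing. -/
def Weights.virtual (R : Type*) [CommRing R] : Weights R := ⟨0, 0, 1⟩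

section StateSum

variable {R : Type*} [CommRing R] (δ : R)

/-- The sum over all smoothings of the chords, where `r` says which arcs are joined already. -/
noncomputable def stateSum : List (Chord R) → Setoid ℕ → R
  | [], r => δ ^ classCount r
  | c :: l, r =>
    c.wt.a * stateSum l (glue (glue r c.tI c.fO) c.fI c.tO) +
    c.wt.b * stateSum l (glue (glue r c.tI c.fI) c.tO c.fO) +
    c.wt.v * stateSum l (glue (glue r c.tI c.tO) c.fI c.fO)

theorem stateSum_swap (c d : Chord R) (l : List (Chord R)) (r : Setoid ℕ) :
    stateSum δ (c :: d :: l) r = stateSum δ (d :: c :: l) r := by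
  have h : ∀ x y z w x' y' z' w' : ℕ, glue (glue (glue (glue r x y) z w) x' y') z' w' =
      glue (glue (glue (glue r x' y') z' w') x y) z w := fun x y z w x' y' z' w' => by
    rw [glue_comm (glue r x y) z w x' y', glue_comm r x y x' y',
      glue_comm _ z w z' w', glue_comm _ x y z' w']
  simp only [stateSum]
  rw [h d.tI d.fO d.fI d.tO, h d.tI d.fI d.tO d.fO, h d.tI d.tO d.fI d.fO,
    h d.tI d.fO d.fI d.tO, h d.tI d.fI d.tO d.fO, h d.tI d.tO d.fI d.fO,
    h d.tI d.fO d.fI d.tO, h d.tI d.fI d.tO d.fO, h d.tI d.tO d.fI d.fO]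
  ring

theorem stateSum_perm {l l' : List (Chord R)} (h : l.Perm l') (r : Setoid ℕ) :
    stateSum δ l r = stateSum δ l' r := by
  induction h generalizing r with
  | nil => rfl
  | cons c _ ih => simp only [stateSum, ih]
  | swap c d l => exact stateSum_swap δ d c l r
  | trans _ _ ih ih' => exact (ih r).trans (ih' r)

/-- The chord ends on no arc of `N`. -/
def Chord.Avoids (c : Chord R) (N : List ℕ) : Prop :=
  ∀ n ∈ N, c.tI ≠ n ∧ c.tO ≠ n ∧ c.fI ≠ n ∧ c.fO ≠ n

/-- The strand on which a passage is made does not matter. -/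
theorem stateSum_transpose (wt : Weights R) (tI tO fI fO : ℕ) (l : List (Chord R))
    (r : Setoid ℕ) :
    stateSum δ (⟨wt, tI, tO, fI, fO⟩ :: l) r = stateSum δ (⟨wt, fI, fO, tI, tO⟩ :: l) r := by
  simp only [stateSum]
  rw [glue_comm r tI fO, glue_swap r tI fI, glue_swap _ tO fO, glue_comm r tI tO]

variable {δ} in
/-- A local identity of state sums holds in every surrounding diagram. -/
theorem stateSum_local {N : List ℕ} {l l' : List (Chord R)} {w : R}
    (h : ∀ r : Setoid ℕ, Finite (Quotient r) → (∀ n ∈ N, IsolatedIn r n) →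
      stateSum δ l r = w * stateSum δ l' r) (o : List (Chord R)) (ho : ∀ c ∈ o, c.Avoids N)
    (r : Setoid ℕ) (hf : Finite (Quotient r)) (hr : ∀ n ∈ N, IsolatedIn r n) :
    stateSum δ (l ++ o) r = w * stateSum δ (l' ++ o) r := by
  -- The surrounding chords are expanded first. As they avoid `N`, each of their smoothings only
  -- replaces `r` by a coarser relation in which the inner arcs are still isolated.
  rw [stateSum_perm δ List.perm_append_comm, stateSum_perm δ (l := l' ++ o) List.perm_append_comm]
  induction o generalizing r with
  | nil => exact h r hf hr
  | cons c o ih =>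
    have hc := ho c (by simp)
    have ih' := fun r => ih (fun c hc => ho c (by simp [hc])) r
    simp only [List.cons_append, stateSum]
    rw [ih' _ inferInstance fun n hn =>
          ((hr n hn).glue (hc n hn).1 (hc n hn).2.2.2).glue (hc n hn).2.2.1 (hc n hn).2.1,
      ih' _ inferInstance fun n hn =>
          ((hr n hn).glue (hc n hn).1 (hc n hn).2.2.1).glue (hc n hn).2.1 (hc n hn).2.2.2,
      ih' _ inferInstance fun n hn =>
          ((hr n hn).glue (hc n hn).1 (hc n hn).2.1).glue (hc n hn).2.2.1 (hc n hn).2.2.2]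
    ring

/-- Change of the names of arcs. -/
def Chord.map (φ : ℕ → ℕ) (c : Chord R) : Chord R := ⟨c.wt, φ c.tI, φ c.tO, φ c.fI, φ c.fO⟩

/-- A surjective renaming of arcs, even one that identifies some of them, leaves the number of
classes unchanged if the relation is pulled back. -/
theorem stateSum_comap {φ : ℕ → ℕ} (hφ : Function.Surjective φ) (l : List (Chord R))
    (r : Setoid ℕ) : stateSum δ l (Setoid.comap φ r) = stateSum δ (l.map (Chord.map φ)) r := by
  induction l generalizing r with
  | nil => exact congrArg (δ ^ ·) (classCount_comap φ hφ r)
  | cons c l ih => simp only [stateSum, List.map_cons, ← comap_glue, ih, Chord.map]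

theorem stateSum_virtual (tI tO fI fO : ℕ) (l : List (Chord R)) (r : Setoid ℕ) :
    stateSum δ (⟨.virtual R, tI, tO, fI, fO⟩ :: l) r =
      stateSum δ l (glue (glue r tI tO) fI fO) := by
  simp [stateSum, Weights.virtual]

section Coded

variable (κ : ℕ → ℕ)

/-- The smoothing of a chord is recorded by adding two edges to a list of codes, the form on which
the elimination of vertices can compute. -/
theorem stateSum_cons_code (wt : Weights R) (i j k m : ℕ) (l : List (Chord R)) (L : List (ℕ × ℕ))
    (r : Setoid ℕ) :
    stateSum δ (⟨wt, κ i, κ j, κ k, κ m⟩ :: l) (glueAll κ L r) =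
      wt.a * stateSum δ l (glueAll κ ((k, j) :: (i, m) :: L) r) +
      wt.b * stateSum δ l (glueAll κ ((j, m) :: (i, k) :: L) r) +
      wt.v * stateSum δ l (glueAll κ ((k, m) :: (i, j) :: L) r) := rfl

end Coded

/-- The identities that make a positive kink removable up to the factor `w`. -/
def KinkIdentity (w : R) (f : Weights R) : Prop := w = δ * f.a + f.b + f.v

/-- The identities that make a pair of crossings removable. -/
structure BigonIdentity (f g : Weights R) : Prop where
  e₁ : 1 = f.a * g.a + f.v * g.v
  e₂ : 1 = f.b * g.b + f.v * g.v
  e₃ : 0 = f.a * g.v + f.v * g.a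
  e₄ : 0 = f.b * g.v + f.v * g.b
  e₅ : 0 = δ * (f.b * g.b) + f.a * g.b + f.b * g.a
  e₆ : 0 = δ * (f.a * g.a) + f.a * g.b + f.b * g.a

/-- The identities between the weights on the two sides of a third move. -/
structure TriangleIdentity (f g h f' g' h' : Weights R) : Prop where
  e₁ : f.a * g.a * h.a + f.v * g.a * h.v = f'.a * g'.a * h'.a + f'.v * g'.a * h'.v
  e₂ : f.a * g.a * h.b + f.b * g.a * h.a + δ * (f.b * g.a * h.b) + f.b * g.a * h.v
    + f.b * g.b * h.b + f.b * g.v * h.b + f.v * g.a * h.b = f'.a * g'.b * h'.a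
  e₃ : f.a * g.b * h.a = f'.a * g'.a * h'.b + f'.b * g'.a * h'.a + δ * (f'.b * g'.a * h'.b)
    + f'.b * g'.a * h'.v + f'.b * g'.b * h'.b + f'.b * g'.v * h'.b + f'.v * g'.a * h'.b
  e₄ : f.a * g.v * h.a = f'.a * g'.a * h'.v + f'.v * g'.a * h'.a
  e₅ : f.a * g.a * h.v + f.v * g.a * h.a = f'.a * g'.v * h'.a
  e₆ : f.b * g.b * h.a + f.b * g.v * h.v = f'.a * g'.b * h'.b + f'.v * g'.v * h'.b
  e₇ : f.a * g.b * h.b + f.v * g.v * h.b = f'.b * g'.b * h'.a + f'.b * g'.v * h'.v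
  e₈ : f.b * g.b * h.v + f.b * g.v * h.a = f'.a * g'.b * h'.v
  e₉ : f.a * g.b * h.v = f'.b * g'.b * h'.v + f'.b * g'.v * h'.a
  e₁₀ : f.v * g.b * h.a = f'.a * g'.v * h'.b + f'.v * g'.b * h'.b
  e₁₁ : f.a * g.v * h.b + f.v * g.b * h.b = f'.v * g'.b * h'.a
  e₁₂ : f.v * g.v * h.a = f'.a * g'.v * h'.v
  e₁₃ : f.a * g.v * h.v = f'.v * g'.v * h'.a
  e₁₄ : f.v * g.b * h.v = f'.v * g'.b * h'.v
  e₁₅ : f.v * g.v * h.v = f'.v * g'.v * h'.v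

variable {δ}

/-- Every smoothing joins the outer arcs `0` and `2`; the oriented one also closes the loop `1` into
a circle, whence the coefficient `δ * f.a + f.b + f.v`. -/
theorem stateSum_kink {κ : ℕ → ℕ} (hκ : ∀ n ∈ [1], ∀ m, m ≠ n → κ m ≠ κ n)
    (f : Weights R) {w : R} (hf : KinkIdentity δ w f) (r : Setoid ℕ) (_ : Finite (Quotient r))
    (hr : ∀ n ∈ [1].map κ, IsolatedIn r n) :
    stateSum δ [⟨f, κ 0, κ 1, κ 1, κ 2⟩] r =
      w * stateSum δ [⟨.virtual R, κ 0, κ 1, κ 1, κ 2⟩] r := by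
  have hr' : ∀ n ∈ [1], IsolatedIn r (κ n) := fun n hn => hr _ (List.mem_map_of_mem hn)
  have key := fun M k => pow_classCount δ (N := [1]) (by decide) hκ hr' M k
  change stateSum δ _ (glueAll κ [] r) = w * stateSum δ _ (glueAll κ [] r)
  simp only [stateSum_cons_code]
  simp only [stateSum, Weights.virtual]
  -- The side conditions `ReducesTo` are decided by running the elimination; `key` is listed once
  -- for each pair of a matching and a number of circles.
  simp (decide := true) only [key [(0,2)] 1, key [(0,2)] 0]
  unfold KinkIdentity at hf
  linear_combination -hf * δ ^ (classCount (glueAll κ [(0,2)] r) - [1].length)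

/-- The strands are `0, 1, 2` and `3, 4, 5`. The nine states give three matchings of the ends `0, 2,
3, 5`, and only `(0, 2), (3, 5)` may survive. A circle arises when both corners are smoothed against
the orientation, hence `e₅`. -/
theorem stateSum_bigon_parallel {κ : ℕ → ℕ} (hκ : ∀ n ∈ [1, 4], ∀ m, m ≠ n → κ m ≠ κ n)
    {f g : Weights R} (H : BigonIdentity δ f g) (r : Setoid ℕ) (_ : Finite (Quotient r))
    (hr : ∀ n ∈ [1, 4].map κ, IsolatedIn r n) :
    stateSum δ [⟨f, κ 0, κ 1, κ 3, κ 4⟩, ⟨g, κ 4, κ 5, κ 1, κ 2⟩] r =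
      stateSum δ [⟨.virtual R, κ 0, κ 1, κ 1, κ 2⟩, ⟨.virtual R, κ 3, κ 4, κ 4, κ 5⟩] r := by
  have hr' : ∀ n ∈ [1, 4], IsolatedIn r (κ n) := fun n hn => hr _ (List.mem_map_of_mem hn)
  have key := fun M k => pow_classCount δ (N := [1, 4]) (by decide) hκ hr' M k
  change stateSum δ _ (glueAll κ [] r) = stateSum δ _ (glueAll κ [] r)
  simp only [stateSum_cons_code]
  simp only [stateSum, Weights.virtual]
  simp (decide := true) only [key [(0, 2), (3, 5)] 0, key [(0, 3), (2, 5)] 1,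
    key [(0, 3), (2, 5)] 0, key [(0, 5), (2, 3)] 0]
  generalize δ ^ (classCount (glueAll κ [(0, 2), (3, 5)] r) - [1, 4].length) = D₁
  generalize δ ^ (classCount (glueAll κ [(0, 3), (2, 5)] r) - [1, 4].length) = D₂
  generalize δ ^ (classCount (glueAll κ [(0, 5), (2, 3)] r) - [1, 4].length) = D₃
  linear_combination -H.e₁ * D₁ - H.e₅ * D₂ - H.e₄ * D₂ - H.e₃ * D₃

/-- With the second strand reversed, the two oriented smoothings bound the circle, so `e₂` and `e₆`
take over the roles of `e₁` and `e₅`. -/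
theorem stateSum_bigon_antiparallel {κ : ℕ → ℕ} (hκ : ∀ n ∈ [1, 4], ∀ m, m ≠ n → κ m ≠ κ n)
    {f g : Weights R} (H : BigonIdentity δ f g) (r : Setoid ℕ) (_ : Finite (Quotient r))
    (hr : ∀ n ∈ [1, 4].map κ, IsolatedIn r n) :
    stateSum δ [⟨f, κ 0, κ 1, κ 4, κ 5⟩, ⟨g, κ 3, κ 4, κ 1, κ 2⟩] r =
      stateSum δ [⟨.virtual R, κ 0, κ 1, κ 1, κ 2⟩, ⟨.virtual R, κ 3, κ 4, κ 4, κ 5⟩] r := by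
  have hr' : ∀ n ∈ [1, 4], IsolatedIn r (κ n) := fun n hn => hr _ (List.mem_map_of_mem hn)
  have key := fun M k => pow_classCount δ (N := [1, 4]) (by decide) hκ hr' M k
  change stateSum δ _ (glueAll κ [] r) = stateSum δ _ (glueAll κ [] r)
  simp only [stateSum_cons_code]
  simp only [stateSum, Weights.virtual]
  simp (decide := true) only [key [(0, 2), (3, 5)] 0, key [(0, 5), (2, 3)] 1,
    key [(0, 3), (2, 5)] 0, key [(0, 5), (2, 3)] 0]
  generalize δ ^ (classCount (glueAll κ [(0, 2), (3, 5)] r) - [1, 4].length) = D₁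
  generalize δ ^ (classCount (glueAll κ [(0, 3), (2, 5)] r) - [1, 4].length) = D₂
  generalize δ ^ (classCount (glueAll κ [(0, 5), (2, 3)] r) - [1, 4].length) = D₃
  linear_combination -H.e₂ * D₁ - H.e₆ * D₃ - H.e₃ * D₃ - H.e₄ * D₂

/-- The strands `0, 1, 2`, `3, 4, 5` and `6, 7, 8` have six outer ends with fifteen matchings, and
each matching is accounted for by one of the fifteen identities. A circle occurs in one state on
each side, giving the `δ` terms in `e₂` and `e₃`. -/
theorem stateSum_triangle {κ : ℕ → ℕ} (hκ : ∀ n ∈ [1, 4, 7], ∀ m, m ≠ n → κ m ≠ κ n)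
    {f g h f' g' h' : Weights R} (H : TriangleIdentity δ f g h f' g' h') (r : Setoid ℕ)
    (_ : Finite (Quotient r)) (hr : ∀ n ∈ [1, 4, 7].map κ, IsolatedIn r n) :
    stateSum δ [⟨f, κ 3, κ 4, κ 6, κ 7⟩, ⟨g, κ 0, κ 1, κ 7, κ 8⟩, ⟨h, κ 1, κ 2, κ 4, κ 5⟩] r =
      stateSum δ [⟨f', κ 0, κ 1, κ 3, κ 4⟩, ⟨g', κ 1, κ 2, κ 6, κ 7⟩, ⟨h', κ 4, κ 5, κ 7, κ 8⟩]
        r := by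
  have hr' : ∀ n ∈ [1, 4, 7], IsolatedIn r (κ n) := fun n hn => hr _ (List.mem_map_of_mem hn)
  have key := fun M k => pow_classCount δ (N := [1, 4, 7]) (by decide) hκ hr' M k
  change stateSum δ _ (glueAll κ [] r) = stateSum δ _ (glueAll κ [] r)
  simp only [stateSum_cons_code]
  simp only [stateSum]
  simp (decide := true) only [key [(0, 2), (3, 5), (6, 8)] 0,
    key [(0, 2), (3, 6), (5, 8)] 0,
    key [(0, 2), (3, 8), (5, 6)] 0,
    key [(0, 3), (2, 5), (6, 8)] 0,
    key [(0, 3), (2, 6), (5, 8)] 0,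
    key [(0, 3), (2, 8), (5, 6)] 0,
    key [(0, 5), (2, 3), (6, 8)] 0,
    key [(0, 5), (2, 6), (3, 8)] 0,
    key [(0, 5), (2, 8), (3, 6)] 0,
    key [(0, 6), (2, 3), (5, 8)] 0,
    key [(0, 6), (2, 5), (3, 8)] 0,
    key [(0, 6), (2, 8), (3, 5)] 0,
    key [(0, 8), (2, 3), (5, 6)] 0,
    key [(0, 8), (2, 5), (3, 6)] 0,
    key [(0, 8), (2, 6), (3, 5)] 0,
    key [(0, 8), (2, 5), (3, 6)] 1, key [(0, 3), (2, 6), (5, 8)] 1]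
  generalize δ ^ (classCount (glueAll κ [(0, 2), (3, 5), (6, 8)] r) - [1, 4, 7].length) = D1
  generalize δ ^ (classCount (glueAll κ [(0, 2), (3, 6), (5, 8)] r) - [1, 4, 7].length) = D2
  generalize δ ^ (classCount (glueAll κ [(0, 2), (3, 8), (5, 6)] r) - [1, 4, 7].length) = D3
  generalize δ ^ (classCount (glueAll κ [(0, 3), (2, 5), (6, 8)] r) - [1, 4, 7].length) = D4
  generalize δ ^ (classCount (glueAll κ [(0, 3), (2, 6), (5, 8)] r) - [1, 4, 7].length) = D5
  generalize δ ^ (classCount (glueAll κ [(0, 3), (2, 8), (5, 6)] r) - [1, 4, 7].length) = D6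
  generalize δ ^ (classCount (glueAll κ [(0, 5), (2, 3), (6, 8)] r) - [1, 4, 7].length) = D7
  generalize δ ^ (classCount (glueAll κ [(0, 5), (2, 6), (3, 8)] r) - [1, 4, 7].length) = D8
  generalize δ ^ (classCount (glueAll κ [(0, 5), (2, 8), (3, 6)] r) - [1, 4, 7].length) = D9
  generalize δ ^ (classCount (glueAll κ [(0, 6), (2, 3), (5, 8)] r) - [1, 4, 7].length) = D10
  generalize δ ^ (classCount (glueAll κ [(0, 6), (2, 5), (3, 8)] r) - [1, 4, 7].length) = D11
  generalize δ ^ (classCount (glueAll κ [(0, 6), (2, 8), (3, 5)] r) - [1, 4, 7].length) = D12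
  generalize δ ^ (classCount (glueAll κ [(0, 8), (2, 3), (5, 6)] r) - [1, 4, 7].length) = D13
  generalize δ ^ (classCount (glueAll κ [(0, 8), (2, 5), (3, 6)] r) - [1, 4, 7].length) = D14
  generalize δ ^ (classCount (glueAll κ [(0, 8), (2, 6), (3, 5)] r) - [1, 4, 7].length) = D15
  linear_combination H.e₁ * D15 + H.e₂ * D14 + H.e₃ * D5 + H.e₄ * D8 + H.e₅ * D13 + H.e₆ * D2
    + H.e₇ * D4 + H.e₈ * D9 + H.e₉ * D6 + H.e₁₀ * D10 + H.e₁₁ * D11 + H.e₁₂ * D7 + H.e₁₃ * D3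
    + H.e₁₄ * D12 + H.e₁₅ * D1

end StateSum

/-! ### Labels around a crossing -/

section Fit

variable {X : Type*} [Biquandle X]

/-- The labels on the four arcs at a crossing fit. -/
def Fit : CrossingKind → X → X → X → X → Prop
  | .pos, tI, tO, fI, fO => fO = fI ▷ᵤ tO ∧ tI = tO ▷ₒ fI
  | .neg, tI, tO, fI, fO => tI = tO ▷ᵤ fI ∧ fO = fI ▷ₒ tO
  | .virt, tI, tO, fI, fO => tO = tI ∧ fO = fI

/-- The kind of the crossing that cancels a crossing. -/
def CrossingKind.inv : CrossingKind → CrossingKind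
  | .pos => .neg
  | .neg => .pos
  | .virt => .virt

theorem CrossingKind.inv_inv (k : CrossingKind) : k.inv.inv = k := by cases k <;> rfl

/-- The coloring rules at a negative crossing are those at a positive one with `tI`, `fO` and `tO`,
`fI` exchanged. Hence both corners of a bigon impose the same relation on their labels. -/
theorem fit_inv {k : CrossingKind} {tI tO fI fO : X} :
    Fit k.inv tI tO fI fO ↔ Fit k fO fI tO tI := by
  cases k <;> simp only [Fit, CrossingKind.inv]
  constructor <;> rintro ⟨rfl, rfl⟩ <;> exact ⟨rfl, rfl⟩

theorem existsUnique_left (y : X) (z : X) : ∃! x : X, x ▷ₒ y = z :=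
  (Biquandle.over_bijective y).existsUnique z

theorem existsUnique_left' (y : X) (z : X) : ∃! x : X, x ▷ᵤ y = z :=
  (Biquandle.under_bijective y).existsUnique z

/-- Bijectivity of the right translations: `▷ₒ` at a positive crossing, `▷ᵤ` at a negative one. The
uniqueness statements that follow cover the other ways in which two strands can enter a crossing. -/
theorem fit_in (k : CrossingKind) (tI fI : X) : ∃! p : X × X, Fit k tI p.1 fI p.2 := by
  cases k with
  | pos =>
    obtain ⟨y, rfl, hu⟩ := existsUnique_left fI tI
    refine ⟨(y, fI ▷ᵤ y), ⟨rfl, rfl⟩, ?_⟩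
    rintro ⟨a, b⟩ ⟨h, h'⟩
    have : a = y := hu a h'.symm
    subst this
    exact Prod.ext rfl h
  | neg =>
    obtain ⟨y, rfl, hu⟩ := existsUnique_left' fI tI
    refine ⟨(y, fI ▷ₒ y), ⟨rfl, rfl⟩, ?_⟩
    rintro ⟨a, b⟩ ⟨h, h'⟩
    have : a = y := hu a h.symm
    subst this
    exact Prod.ext rfl h'
  | virt => exact ⟨(tI, fI), ⟨rfl, rfl⟩, fun p h => Prod.ext h.1 h.2⟩

theorem fit_out (k : CrossingKind) (tO fO : X) : ∃! p : X × X, Fit k p.1 tO p.2 fO := by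
  obtain ⟨p, hp, hu⟩ := fit_in k.inv fO tO
  refine ⟨p.swap, fit_inv.1 hp, fun q hq => ?_⟩
  rw [← hu q.swap (fit_inv.2 hq), Prod.swap_swap]

theorem fit_side (k : CrossingKind) (tO fI : X) : ∃! p : X × X, Fit k p.1 tO fI p.2 := by
  cases k with
  | pos => exact ⟨(tO ▷ₒ fI, fI ▷ᵤ tO), ⟨rfl, rfl⟩, fun p h => Prod.ext h.2 h.1⟩
  | neg => exact ⟨(tO ▷ᵤ fI, fI ▷ₒ tO), ⟨rfl, rfl⟩, fun p h => Prod.ext h.1 h.2⟩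
  | virt => exact ⟨(tO, fI), ⟨rfl, rfl⟩, fun p h => Prod.ext h.1.symm h.2⟩

/-- This is where bijectivity of the switch map is needed; it serves second moves with antiparallel
strands. -/
theorem fit_opposite_side (k : CrossingKind) (tI fO : X) :
    ∃! p : X × X, Fit k tI p.1 p.2 fO := by
  cases k with
  | pos =>
    obtain ⟨p, hp, hu⟩ := (Biquandle.switch_bijective (X := X)).existsUnique (tI, fO)
    refine ⟨p.swap, ⟨(congrArg Prod.snd hp).symm, (congrArg Prod.fst hp).symm⟩, fun q hq => ?_⟩
    rw [← hu q.swap (Prod.ext hq.2.symm hq.1.symm), Prod.swap_swap]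
  | neg =>
    obtain ⟨p, hp, hu⟩ := (Biquandle.switch_bijective (X := X)).existsUnique (fO, tI)
    exact ⟨p, ⟨(congrArg Prod.snd hp).symm, (congrArg Prod.fst hp).symm⟩, fun q hq =>
      hu q (Prod.ext hq.2.symm hq.1.symm)⟩
  | virt => exact ⟨(tI, fO), ⟨rfl, rfl⟩, fun p h => Prod.ext h.1 h.2.symm⟩

/-- The labels of a kink agree on the two outer arcs. -/
theorem kink_labels [Finite X] {x y z : X} (h : y = x ▷ᵤ z) (h' : y = z ▷ₒ x) : x = z := by
  have hinj : Function.Injective fun w : X => w ▷ᵤ w := fun u v e => by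
    have : ((u, u) : X × X) = (v, v) := Biquandle.switch_bijective.1 (Prod.ext
      (by simpa only [← Biquandle.under_self] using e) e)
    exact congrArg Prod.fst this
  -- The switch map is injective and sends the diagonal to itself; finiteness of `X` makes it onto
  -- the diagonal. So `(y, y)` has a diagonal preimage, which must be `(x, z)`.
  obtain ⟨w, hw⟩ := (Finite.injective_iff_surjective.1 hinj) y
  have : ((x, z) : X × X) = (w, w) := Biquandle.switch_bijective.1 (Prod.ext
    (h'.symm.trans (hw.symm.trans (Biquandle.under_self w))) (h.symm.trans hw.symm))
  rw [Prod.mk.injEq] at this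
  rw [this.1, this.2]

end Fit

/-! ### Labels around a third move -/

section TriangleLabels

variable {X : Type*} [Biquandle X] {ka kb kc : CrossingKind}
  {p₀ p₁ p₂ q₀ q₁ q₂ r₀ r₁ r₂ p₁' q₁' r₁' : X}

/-- Either all three crossings are positive, or one strand crosses the other two virtually. -/
def TriangleKinds (ka kb kc : CrossingKind) : Prop :=
  (ka = .pos ∧ kb = .pos ∧ kc = .pos) ∨ (ka = .virt ∧ kb = .virt) ∨ (ka = .virt ∧ kc = .virt) ∨
    (kb = .virt ∧ kc = .virt)

/-- Strand `p` is above `q` and `q` above `r` when all crossings are positive; the three exchange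
laws are then the compatibility of the labels. If two crossings are virtual, the labels slide along
the virtual strand unchanged. -/
theorem fit_triangle_forward (hk : TriangleKinds ka kb kc) (ha : Fit ka p₀ p₁ q₀ q₁)
    (hb : Fit kb p₁ p₂ r₀ r₁) (hc : Fit kc q₁ q₂ r₁ r₂) :
    ∃ p₁' q₁' r₁' : X, Fit kc q₀ q₁' r₀ r₁' ∧ Fit kb p₀ p₁' r₁' r₂ ∧ Fit ka p₁' p₂ q₁' q₂ := by
  rcases hk with ⟨rfl, rfl, rfl⟩ | ⟨rfl, rfl⟩ | ⟨rfl, rfl⟩ | ⟨rfl, rfl⟩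
  · obtain ⟨rfl, rfl⟩ := ha
    obtain ⟨rfl, rfl⟩ := hb
    obtain ⟨rfl, h⟩ := hc
    -- `y` is the label of the inner arc of `q` after the move, where `q` meets `r` first.
    obtain ⟨y, rfl⟩ := (Biquandle.over_bijective r₀).2 q₀
    dsimp only at h ⊢
    -- The mixed exchange law shows that both elements have the same image under a right translation
    -- by `▷ₒ`.
    have h₂ : q₂ = y ▷ᵤ p₂ := (Biquandle.over_bijective (r₀ ▷ᵤ p₂)).1
      (h.symm.trans (Biquandle.exchange_mixed y p₂ r₀).symm)
    subst h₂
    exact ⟨p₂ ▷ₒ y, y, r₀ ▷ᵤ y, ⟨rfl, rfl⟩,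
      ⟨Biquandle.exchange_under r₀ p₂ y, Biquandle.exchange_over p₂ r₀ y⟩, rfl, rfl⟩
  · obtain ⟨rfl, rfl⟩ := ha
    obtain ⟨rfl, rfl⟩ := hb
    exact ⟨_, _, _, hc, ⟨rfl, rfl⟩, rfl, rfl⟩
  · obtain ⟨rfl, rfl⟩ := ha
    obtain ⟨rfl, rfl⟩ := hc
    exact ⟨_, _, _, ⟨rfl, rfl⟩, hb, rfl, rfl⟩
  · obtain ⟨rfl, rfl⟩ := hb
    obtain ⟨rfl, rfl⟩ := hc
    exact ⟨_, _, _, ⟨rfl, rfl⟩, ⟨rfl, rfl⟩, ha⟩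

theorem fit_triangle_backward (hk : TriangleKinds ka kb kc) (hc : Fit kc q₀ q₁' r₀ r₁')
    (hb : Fit kb p₀ p₁' r₁' r₂) (ha : Fit ka p₁' p₂ q₁' q₂) :
    ∃ p₁ q₁ r₁ : X, Fit ka p₀ p₁ q₀ q₁ ∧ Fit kb p₁ p₂ r₀ r₁ ∧ Fit kc q₁ q₂ r₁ r₂ := by
  rcases hk with ⟨rfl, rfl, rfl⟩ | ⟨rfl, rfl⟩ | ⟨rfl, rfl⟩ | ⟨rfl, rfl⟩
  · obtain ⟨rfl, rfl⟩ := ha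
    obtain ⟨rfl, rfl⟩ := hb
    obtain ⟨rfl, rfl⟩ := hc
    exact ⟨p₂ ▷ₒ r₀, (q₁' ▷ₒ r₀) ▷ᵤ (p₂ ▷ₒ r₀), r₀ ▷ᵤ p₂,
      ⟨rfl, (Biquandle.exchange_over p₂ r₀ q₁').symm⟩, ⟨rfl, rfl⟩,
      (Biquandle.exchange_under r₀ p₂ q₁').symm, (Biquandle.exchange_mixed q₁' p₂ r₀).symm⟩
  · obtain ⟨rfl, rfl⟩ := ha
    obtain ⟨rfl, rfl⟩ := hb
    exact ⟨_, _, _, ⟨rfl, rfl⟩, ⟨rfl, rfl⟩, hc⟩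
  · obtain ⟨rfl, rfl⟩ := ha
    obtain ⟨rfl, rfl⟩ := hc
    exact ⟨_, _, _, ⟨rfl, rfl⟩, hb, rfl, rfl⟩
  · obtain ⟨rfl, rfl⟩ := hb
    obtain ⟨rfl, rfl⟩ := hc
    exact ⟨_, _, _, ha, ⟨rfl, rfl⟩, rfl, rfl⟩

end TriangleLabels

/-! ### Weights of labelled crossings -/

section Weights

variable {X R : Type*} [Biquandle X] [CommRing R] (β : VirtualBracket X R)

/-- The weights of a crossing with label `tO` on the arc on which the passage `true` leaves and
`fI` on the arc on which the passage `false` arrives. -/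
def VirtualBracket.weights : CrossingKind → X → X → Weights R
  | .pos, tO, fI => ⟨β.A fI tO, β.B fI tO, β.V fI tO⟩
  | .neg, tO, fI => ⟨β.C tO fI, β.D tO fI, β.U tO fI⟩
  | .virt, _, _ => .virtual R

def CrossingKind.sign : CrossingKind → ℤ
  | .pos => 1
  | .neg => -1
  | .virt => 0

theorem kinkIdentity_weights (k : CrossingKind) (x : X) :
    KinkIdentity β.δ ((β.ω ^ k.sign : Rˣ) : R) (β.weights k x x) := by
  cases k <;> simp [KinkIdentity, VirtualBracket.weights, CrossingKind.sign, Weights.virtual,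
    β.kink_pos x]
  exact β.kink_neg x

/-- With the arguments exchanged at the inverse kind, both corners carry the same pair of labels, so
the axioms apply with all indices equal. -/
theorem bigonIdentity_weights (k : CrossingKind) (x y : X) :
    BigonIdentity β.δ (β.weights k x y) (β.weights k.inv y x) := by
  cases k with
  | pos => exact ⟨β.bigon_1 _ _, β.bigon_2 _ _, β.bigon_3 _ _, β.bigon_4 _ _, β.bigon_5 _ _,
      β.bigon_6 _ _⟩
  | neg =>
    constructor <;> simp only [VirtualBracket.weights, CrossingKind.inv]
    · linear_combination β.bigon_1 x y
    · linear_combination β.bigon_2 x y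
    · linear_combination β.bigon_3 x y
    · linear_combination β.bigon_4 x y
    · linear_combination β.bigon_5 x y
    · linear_combination β.bigon_6 x y
  | virt =>
    constructor <;> simp [VirtualBracket.weights, CrossingKind.inv, Weights.virtual]

/-- In the positive case these are the fifteen axioms at `x = r₀`, `y = q₁'`, `z = p₂`. With two
virtual crossings the remaining crossing has the same labels, hence the same weights, before and
after the move. -/
theorem triangleIdentity_weights {ka kb kc : CrossingKind}
    {p₀ p₁ p₂ q₀ q₁ q₂ r₀ r₁ r₂ p₁' q₁' r₁' : X} (hk : TriangleKinds ka kb kc)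
    (ha : Fit ka p₀ p₁ q₀ q₁) (hb : Fit kb p₁ p₂ r₀ r₁) (hc : Fit kc q₁ q₂ r₁ r₂)
    (hc' : Fit kc q₀ q₁' r₀ r₁') (hb' : Fit kb p₀ p₁' r₁' r₂) (ha' : Fit ka p₁' p₂ q₁' q₂) :
    TriangleIdentity β.δ (β.weights kc q₁' r₀) (β.weights kb p₁' r₁') (β.weights ka p₂ q₁')
      (β.weights ka p₁ q₀) (β.weights kb p₂ r₀) (β.weights kc q₂ r₁) := by
  rcases hk with ⟨rfl, rfl, rfl⟩ | ⟨rfl, rfl⟩ | ⟨rfl, rfl⟩ | ⟨rfl, rfl⟩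
  · obtain ⟨rfl, rfl⟩ := hc'
    obtain ⟨rfl, -⟩ := hb'
    obtain ⟨rfl, rfl⟩ := ha'
    obtain ⟨rfl, -⟩ := ha
    obtain ⟨rfl, rfl⟩ := hb
    exact ⟨β.triangle_1 _ _ _, β.triangle_2 _ _ _, β.triangle_3 _ _ _, β.triangle_4 _ _ _,
      β.triangle_5 _ _ _, β.triangle_6 _ _ _, β.triangle_7 _ _ _, β.triangle_8 _ _ _,
      β.triangle_9 _ _ _, β.triangle_10 _ _ _, β.triangle_11 _ _ _, β.triangle_12 _ _ _,
      β.triangle_13 _ _ _, β.triangle_14 _ _ _, β.triangle_15 _ _ _⟩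
  · simp only [Fit] at ha hb hb' ha'
    constructor <;> simp [VirtualBracket.weights, Weights.virtual, *]
  · simp only [Fit] at ha hc hc' ha'
    constructor <;> simp [VirtualBracket.weights, Weights.virtual, *]
  · simp only [Fit] at hb hc hb' hc'
    constructor <;> simp [VirtualBracket.weights, Weights.virtual, *]

end Weights

/-! ### Diagrams as lists of crossings -/

/-- A crossing, given by its kind and the arcs on which its two passages arrive and leave. -/
structure Site where
  kind : CrossingKind
  tI : ℕ
  tO : ℕ
  fI : ℕ
  fO : ℕ

/-- Arcs with numbers at least `n` are the same arc. -/
def capRel (n : ℕ) : Setoid ℕ := Setoid.ker (fun i => min i n)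

theorem capRel_iff {n i j : ℕ} : capRel n i j ↔ min i n = min j n := Iff.rfl

instance (n : ℕ) : Finite (Quotient (capRel n)) :=
  Finite.of_surjective (fun i : Fin (n + 1) => (Quotient.mk (capRel n) i.1)) fun q =>
    Quotient.inductionOn q fun i => ⟨⟨min i n, by omega⟩, Quotient.sound (by
      change min (min i n) n = min i n
      omega)⟩

theorem isolatedIn_capRel {n m : ℕ} (h : m < n) : IsolatedIn (capRel n) m := fun j hj => by
  rw [capRel_iff] at hj; omega

section Sites

variable {X R : Type*} [Biquandle X] [CommRing R] (β : VirtualBracket X R)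

namespace Site

def Fits (s : Site) (f : ℕ → X) : Prop := Fit s.kind (f s.tI) (f s.tO) (f s.fI) (f s.fO)

def chord (f : ℕ → X) (s : Site) : Chord R :=
  ⟨β.weights s.kind (f s.tO) (f s.fI), s.tI, s.tO, s.fI, s.fO⟩

def map (φ : ℕ → ℕ) (s : Site) : Site := ⟨s.kind, φ s.tI, φ s.tO, φ s.fI, φ s.fO⟩

def Avoids (s : Site) (N : List ℕ) : Prop :=
  ∀ n ∈ N, s.tI ≠ n ∧ s.tO ≠ n ∧ s.fI ≠ n ∧ s.fO ≠ n

theorem Avoids.agree {Y : Type*} {s : Site} {N : List ℕ} (h : s.Avoids N) {f f' : ℕ → Y}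
    (hf : ∀ j ∉ N, f j = f' j) :
    f s.tI = f' s.tI ∧ f s.tO = f' s.tO ∧ f s.fI = f' s.fI ∧ f s.fO = f' s.fO :=
  ⟨hf _ fun hn => (h _ hn).1 rfl, hf _ fun hn => (h _ hn).2.1 rfl,
    hf _ fun hn => (h _ hn).2.2.1 rfl, hf _ fun hn => (h _ hn).2.2.2 rfl⟩

theorem Avoids.fits_iff {s : Site} {N : List ℕ} (h : s.Avoids N) {f f' : ℕ → X}
    (hf : ∀ j ∉ N, f j = f' j) : s.Fits f ↔ s.Fits f' := by
  obtain ⟨h₁, h₂, h₃, h₄⟩ := h.agree hf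
  rw [Fits, Fits, h₁, h₂, h₃, h₄]

theorem Avoids.chord_eq {s : Site} {N : List ℕ} (h : s.Avoids N) {f f' : ℕ → X}
    (hf : ∀ j ∉ N, f j = f' j) : s.chord β f = s.chord β f' := by
  obtain ⟨-, h₂, h₃, -⟩ := h.agree hf
  rw [chord, chord, h₂, h₃]

end Site

/-- The sum of the signs. -/
def signSum (l : List Site) : ℤ := (l.map fun s => s.kind.sign).sum

variable (X) in
/-- The colorings of a diagram with last arc `n`. -/
def Labelling (n : ℕ) (l : List Site) : Type _ :=
  {f : ℕ → X // (∀ i, f i = f (min i n)) ∧ ∀ s ∈ l, s.Fits f}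

/-- The bracket of a labelled diagram. -/
noncomputable def siteBracket (n : ℕ) (l : List Site) (f : ℕ → X) : R :=
  stateSum β.δ (l.map (Site.chord β f)) (capRel n) * ((β.ω ^ (-signSum l) : Rˣ) : R)

/-- Two diagrams have the same brackets at corresponding colorings. -/
def SameBracket (n : ℕ) (l : List Site) (n' : ℕ) (l' : List Site) : Prop :=
  ∃ e : Labelling X n l ≃ Labelling X n' l',
    ∀ f, siteBracket β n l f.1 = siteBracket β n' l' (e f).1

variable {β}

namespace SameBracket

theorem refl (n : ℕ) (l : List Site) : SameBracket β n l n l := ⟨Equiv.refl _, fun _ => rfl⟩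

theorem symm {n n' : ℕ} {l l' : List Site} (h : SameBracket β n l n' l') :
    SameBracket β n' l' n l :=
  let ⟨e, he⟩ := h
  ⟨e.symm, fun f => by rw [he, e.apply_symm_apply]⟩

theorem trans {n n' n'' : ℕ} {l l' l'' : List Site} (h : SameBracket β n l n' l')
    (h' : SameBracket β n' l' n'' l'') : SameBracket β n l n'' l'' :=
  let ⟨e, he⟩ := h
  let ⟨e', he'⟩ := h'
  ⟨e.trans e', fun f => (he f).trans (he' _)⟩

theorem of_perm (n : ℕ) {l l' : List Site} (h : l.Perm l') : SameBracket β n l n l' :=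
  ⟨Equiv.subtypeEquivRight fun f => by simp only [h.mem_iff], fun f => by
    change siteBracket β n l f.1 = siteBracket β n l' f.1
    rw [siteBracket, siteBracket, stateSum_perm _ (h.map _), signSum, signSum, (h.map _).sum_eq]⟩

end SameBracket

/-- A relation that is functional in both directions is an equivalence. -/
theorem exists_equiv_of_existsUnique {α γ : Type*} (r : α → γ → Prop) (h : ∀ a, ∃! b, r a b)
    (h' : ∀ b, ∃! a, r a b) : ∃ e : α ≃ γ, ∀ a, r a (e a) := by
  choose f hf hu using h
  choose g hg hv using h'
  exact ⟨⟨f, g, fun a => (hv _ a (hf a)).symm, fun b => (hu _ b (hg b)).symm⟩, hf⟩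

/-- Replacement of a part of a diagram with inner arcs `N`. -/
theorem SameBracket.local {n : ℕ} {N : List ℕ} (hN : ∀ m ∈ N, m < n) {l l' : List Site}
    (h : ∀ f : ℕ → X, (∀ s ∈ l, s.Fits f) →
      ∃ f' : ℕ → X, (∀ j ∉ N, f j = f' j) ∧ ∀ s ∈ l', s.Fits f')
    (h' : ∀ f' : ℕ → X, (∀ s ∈ l', s.Fits f') →
      ∃ f : ℕ → X, (∀ j ∉ N, f' j = f j) ∧ ∀ s ∈ l, s.Fits f)
    (hu : ∀ f g : ℕ → X, (∀ s ∈ l, s.Fits f) → (∀ s ∈ l, s.Fits g) → (∀ j ∉ N, f j = g j) →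
      ∀ j ∈ N, f j = g j)
    (hu' : ∀ f g : ℕ → X, (∀ s ∈ l', s.Fits f) → (∀ s ∈ l', s.Fits g) → (∀ j ∉ N, f j = g j) →
      ∀ j ∈ N, f j = g j)
    (hβ : ∀ f f' : ℕ → X, (∀ s ∈ l, s.Fits f) → (∀ s ∈ l', s.Fits f') →
      (∀ j ∉ N, f j = f' j) → ∀ r : Setoid ℕ, Finite (Quotient r) → (∀ n ∈ N, IsolatedIn r n) →
        stateSum β.δ (l.map (Site.chord β f)) r =
          ((β.ω ^ (signSum l - signSum l') : Rˣ) : R) * stateSum β.δ (l'.map (Site.chord β f')) r)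
    {o : List Site} (ho : ∀ s ∈ o, s.Avoids N) : SameBracket β n (l ++ o) n (l' ++ o) := by
  -- Changing labels on `N` keeps a labelling constant from `n` on, because all inner arcs are
  -- strictly below `n`.
  have hcap : ∀ (f g : ℕ → X), (∀ i, f i = f (min i n)) → (∀ j ∉ N, f j = g j) →
      ∀ i, g i = g (min i n) := fun f g hf hfg i => by
    by_cases hi : i < n
    · rw [min_eq_left hi.le]
    · have h₁ : i ∉ N := fun hm => hi (hN i hm)
      have h₂ : n ∉ N := fun hm => lt_irrefl _ (hN n hm)
      rw [← hfg i h₁, hf, min_eq_right (not_lt.1 hi), hfg n h₂]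
  have hext : ∀ {k : List Site}, (∀ f g : ℕ → X, (∀ s ∈ k, s.Fits f) → (∀ s ∈ k, s.Fits g) →
      (∀ j ∉ N, f j = g j) → ∀ j ∈ N, f j = g j) → ∀ f g : Labelling X n (k ++ o),
      (∀ j ∉ N, f.1 j = g.1 j) → f = g := fun hk f g hfg => Subtype.ext (funext fun j => by
    by_cases hj : j ∈ N
    · exact hk f.1 g.1 (fun s hs => f.2.2 s (List.mem_append_left _ hs))
        (fun s hs => g.2.2 s (List.mem_append_left _ hs)) hfg j hj
    · exact hfg j hj)
  have hex : ∀ {k k' : List Site}, (∀ f : ℕ → X, (∀ s ∈ k, s.Fits f) →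
      ∃ f' : ℕ → X, (∀ j ∉ N, f j = f' j) ∧ ∀ s ∈ k', s.Fits f') →
      ∀ f : Labelling X n (k ++ o), ∃ g : Labelling X n (k' ++ o), ∀ j ∉ N, f.1 j = g.1 j :=
    fun hk f => by
      obtain ⟨g, hg, hfit⟩ := hk f.1 fun s hs => f.2.2 s (List.mem_append_left _ hs)
      refine ⟨⟨g, hcap _ _ f.2.1 hg, fun s hs => ?_⟩, hg⟩
      rcases List.mem_append.1 hs with hs | hs
      · exact hfit s hs
      · exact ((ho s hs).fits_iff hg).1 (f.2.2 s (List.mem_append_right _ hs))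
  -- Corresponding colorings are those that agree off the inner arcs.
  obtain ⟨e, he⟩ := exists_equiv_of_existsUnique
    (fun (f : Labelling X n (l ++ o)) (g : Labelling X n (l' ++ o)) => ∀ j ∉ N, f.1 j = g.1 j)
    (fun f => by
      obtain ⟨g, hg⟩ := hex h f
      exact ⟨g, hg, fun g' hg' => hext hu' _ _ fun j hj => (hg' j hj).symm.trans (hg j hj)⟩)
    (fun g => by
      obtain ⟨f, hf⟩ := hex h' g
      exact ⟨f, fun j hj => (hf j hj).symm, fun f' hf' =>
        hext hu _ _ fun j hj => (hf' j hj).trans (hf j hj)⟩)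
  refine ⟨e, fun f => ?_⟩
  have hloc := stateSum_local (hβ f.1 (e f).1
    (fun s hs => f.2.2 s (List.mem_append_left _ hs))
    (fun s hs => (e f).2.2 s (List.mem_append_left _ hs)) (he f))
    (o.map (Site.chord β f.1)) (by
      intro c hc
      obtain ⟨s, hs, rfl⟩ := List.mem_map.1 hc
      exact ho s hs) (capRel n) inferInstance (fun m hm => isolatedIn_capRel (hN m hm))
  have ho' : o.map (Site.chord β f.1) = o.map (Site.chord β (e f).1) :=
    List.map_congr_left fun s hs => (ho s hs).chord_eq β (he f)
  have hs : signSum (l ++ o) = signSum l + signSum o := by simp [signSum]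
  have hs' : signSum (l' ++ o) = signSum l' + signSum o := by simp [signSum]
  -- The local factor, `ω` to the difference of the sign sums, is what the two writhe normalisations
  -- differ by.
  rw [siteBracket, siteBracket, List.map_append, List.map_append, hloc, ← ho', mul_right_comm,
    ← Units.val_mul, ← zpow_add, mul_comm, hs, hs']
  congr 4
  ring

/-! ### Removal of an arc -/

/-- The arcs `i`, `i + 1` and `i + 2` become one. -/
def collapse (i j : ℕ) : ℕ := if j ≤ i then j else if j ≤ i + 2 then i else j - 2

/-- A section of `collapse i`. -/
def expand (i j : ℕ) : ℕ := if j < i then j else j + 2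

theorem collapse_spec (i j : ℕ) : (j ≤ i ∧ collapse i j = j) ∨
    (i < j ∧ j ≤ i + 2 ∧ collapse i j = i) ∨ (i + 2 < j ∧ collapse i j = j - 2) := by
  unfold collapse
  split_ifs <;> omega

theorem expand_spec (i j : ℕ) : (j < i ∧ expand i j = j) ∨ (i ≤ j ∧ expand i j = j + 2) := by
  unfold expand
  split_ifs <;> omega

theorem collapse_expand (i j : ℕ) : collapse i (expand i j) = j := by
  have := collapse_spec i (expand i j)
  have := expand_spec i j
  omega

/-- Of the three merged arcs the section selects the last, `i + 2`. -/
theorem expand_collapse (i j : ℕ) :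
    expand i (collapse i j) = if j = i ∨ j = i + 1 then i + 2 else j := by
  have := collapse_spec i j
  have := expand_spec i (collapse i j)
  split_ifs <;> omega

theorem collapse_surjective (i : ℕ) : Function.Surjective (collapse i) := fun j =>
  ⟨_, collapse_expand i j⟩

/-- Joining three consecutive arcs of a diagram with last arc `n + 2` is the same as renumbering
them by `collapse i` into a diagram with last arc `n`: every arc is joined to its image under
`expand i ∘ collapse i`. -/
theorem capRel_collapse {n i : ℕ} (h : i ≤ n) :
    glue (glue (capRel (n + 2)) i (i + 1)) (i + 1) (i + 2) =
      Setoid.comap (collapse i) (capRel n) := by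
  apply le_antisymm
  · refine glue_le (glue_le ?_ ?_) ?_
    · intro a b hab
      change min (collapse i a) n = min (collapse i b) n
      rw [capRel_iff] at hab
      have := collapse_spec i a
      have := collapse_spec i b
      omega
    all_goals
      change min (collapse i _) n = min (collapse i _) n
      simp [collapse]
  · have key : ∀ a, glue (glue (capRel (n + 2)) i (i + 1)) (i + 1) (i + 2) a
        (expand i (collapse i a)) := fun a => by
      have h₂ := glue_pair (glue (capRel (n + 2)) i (i + 1)) (i + 1) (i + 2)
      have h₁ := le_glue (glue (capRel (n + 2)) i (i + 1)) (i + 1) (i + 2)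
        (glue_pair (capRel (n + 2)) i (i + 1))
      rw [expand_collapse]
      split_ifs with ha
      · rcases ha with rfl | rfl
        · exact Setoid.trans' _ h₁ h₂
        · exact h₂
      · exact Setoid.refl' _ a
    intro a b hab
    change min (collapse i a) n = min (collapse i b) n at hab
    refine Setoid.trans' _ (key a) (Setoid.trans' _ ?_ (Setoid.symm' _ (key b)))
    refine Or.inl (Or.inl ?_)
    have := expand_spec i (collapse i a)
    have := expand_spec i (collapse i b)
    change min _ _ = min _ _
    omega

/-- The site `⟨.virt, i, i + 1, i + 1, i + 2⟩` is a virtual kink: it forces equal labels on three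
arcs and joins them in every state. Deleting it is the only operation that changes the number of
arcs. -/
theorem SameBracket.collapse {n i : ℕ} (h : i ≤ n) (o : List Site) :
    SameBracket β (n + 2) (⟨.virt, i, i + 1, i + 1, i + 2⟩ :: o) n
      (o.map (Site.map (collapse i))) := by
  have hback : ∀ f : Labelling X (n + 2) (⟨.virt, i, i + 1, i + 1, i + 2⟩ :: o), ∀ j,
      f.1 (expand i (_root_.collapse i j)) = f.1 j := fun f j => by
    have hf := f.2.2 _ List.mem_cons_self
    simp only [Site.Fits, Fit] at hf
    rw [expand_collapse]
    split_ifs with hj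
    · rcases hj with rfl | rfl
      · exact hf.2.trans hf.1
      · exact hf.2
    · rfl
  refine ⟨⟨fun f => ⟨fun j => f.1 (expand i j), ?_, ?_⟩,
    fun g => ⟨fun j => g.1 (_root_.collapse i j), ?_, ?_⟩, ?_, ?_⟩, ?_⟩
  · intro j
    dsimp only
    rw [f.2.1, f.2.1 (expand i (min j n))]
    have := expand_spec i j
    have := expand_spec i (min j n)
    exact congrArg f.1 (by omega)
  · intro s hs
    obtain ⟨t, ht, rfl⟩ := List.mem_map.1 hs
    have := f.2.2 t (List.mem_cons_of_mem _ ht)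
    simpa only [Site.Fits, Site.map, hback f] using this
  · intro j
    dsimp only
    rw [g.2.1, g.2.1 (_root_.collapse i (min j (n + 2)))]
    have := collapse_spec i j
    have := collapse_spec i (min j (n + 2))
    exact congrArg g.1 (by omega)
  · intro s hs
    rcases List.mem_cons.1 hs with rfl | hs
    · simp [Site.Fits, Fit, _root_.collapse]
    · exact g.2.2 _ (List.mem_map_of_mem hs)
  · exact fun f => Subtype.ext (funext (hback f))
  · exact fun g => Subtype.ext (funext fun j => congrArg g.1 (collapse_expand i j))
  · intro f
    simp only [siteBracket, List.map_cons, List.map_map]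
    have hs : signSum (o.map (Site.map (_root_.collapse i))) =
        signSum (⟨.virt, i, i + 1, i + 1, i + 2⟩ :: o) := by
      simp [signSum, CrossingKind.sign, Function.comp_def, Site.map]
    rw [hs, Site.chord, VirtualBracket.weights, stateSum_virtual, capRel_collapse h,
      stateSum_comap _ (collapse_surjective i), List.map_map]
    congr 2
    refine List.map_congr_left fun s _ => ?_
    change Chord.map (_root_.collapse i) (Site.chord β f.1 s) = Site.chord β
      (fun j => f.1 (expand i j)) (Site.map (_root_.collapse i) s)
    simp only [Site.chord, Chord.map, Site.map, hback f]

end Sites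

/-! ### Local moves of lists of crossings -/

section Moves

variable {X R : Type*} [Biquandle X] [CommRing R] {β : VirtualBracket X R}

theorem inner_notMem {κ : ℕ → ℕ} {N : List ℕ} (hκ : ∀ n ∈ N, ∀ m, m ≠ n → κ m ≠ κ n) {m : ℕ}
    (hm : m ∉ N) : κ m ∉ N.map κ := fun h => by
  obtain ⟨n, hn, e⟩ := List.mem_map.1 h
  exact hκ n hn m (fun h => hm (h ▸ hn)) e.symm

theorem exists_override {Y : Type*} {κ : ℕ → ℕ} {N : List ℕ}
    (hκ : ∀ n ∈ N, ∀ m, m ≠ n → κ m ≠ κ n) (f : ℕ → Y) (v : ℕ → Y) :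
    ∃ f' : ℕ → Y, (∀ j ∉ N.map κ, f j = f' j) ∧ ∀ m ∈ N, f' (κ m) = v m := by
  classical
  refine ⟨fun j => if h : ∃ m ∈ N, κ m = j then v h.choose else f j, fun j hj => ?_,
    fun m hm => ?_⟩
  · dsimp only
    rw [dif_neg fun h => hj (List.mem_map.2 h)]
  · have h : ∃ m' ∈ N, κ m' = κ m := ⟨m, hm, rfl⟩
    dsimp only
    rw [dif_pos h]
    by_contra hne
    exact hκ m hm h.choose (fun e => hne (by rw [e])) h.choose_spec.2

/-- `κ` is required to separate only the inner arcs `1`, `4`, `7` from the others: outer arcs may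
coincide, as happens when two of the strands follow each other directly. -/
theorem SameBracket.triangle {n : ℕ} {κ : ℕ → ℕ}
    (hκ : ∀ n ∈ [1, 4, 7], ∀ m, m ≠ n → κ m ≠ κ n) (hn : ∀ m ∈ [1, 4, 7].map κ, m < n)
    {ka kb kc : CrossingKind} (hk : TriangleKinds ka kb kc) {o : List Site}
    (ho : ∀ s ∈ o, s.Avoids ([1, 4, 7].map κ)) :
    SameBracket β n
      ([⟨ka, κ 0, κ 1, κ 3, κ 4⟩, ⟨kb, κ 1, κ 2, κ 6, κ 7⟩, ⟨kc, κ 4, κ 5, κ 7, κ 8⟩] ++ o) n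
      ([⟨kc, κ 3, κ 4, κ 6, κ 7⟩, ⟨kb, κ 0, κ 1, κ 7, κ 8⟩, ⟨ka, κ 1, κ 2, κ 4, κ 5⟩] ++ o) := by
  have hout : ∀ {m}, m ∉ [1, 4, 7] → κ m ∉ [1, 4, 7].map κ := fun hm => inner_notMem hκ hm
  refine SameBracket.local hn ?_ ?_ ?_ ?_ ?_ ho
  · intro f hf
    simp only [List.forall_mem_cons, List.not_mem_nil, false_implies, implies_true, and_true,
      Site.Fits] at hf ⊢
    obtain ⟨p, q, r, h₁, h₂, h₃⟩ := fit_triangle_forward hk hf.1 hf.2.1 hf.2.2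
    obtain ⟨f', hf', hv⟩ := exists_override hκ f
      (fun m => if m = 1 then p else if m = 4 then q else r)
    have e₁ := hv 1 (by simp)
    have e₄ := hv 4 (by simp)
    have e₇ := hv 7 (by simp)
    simp only [reduceIte, Nat.reduceEqDiff, OfNat.ofNat_ne_one] at e₁ e₄ e₇
    refine ⟨f', hf', ?_⟩
    rw [e₁, e₄, e₇, ← hf' _ (hout (m := 0) (by simp)), ← hf' _ (hout (m := 2) (by simp)),
      ← hf' _ (hout (m := 3) (by simp)), ← hf' _ (hout (m := 5) (by simp)),
      ← hf' _ (hout (m := 6) (by simp)), ← hf' _ (hout (m := 8) (by simp))]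
    exact ⟨h₁, h₂, h₃⟩
  · intro f hf
    simp only [List.forall_mem_cons, List.not_mem_nil, false_implies, implies_true, and_true,
      Site.Fits] at hf ⊢
    obtain ⟨p, q, r, h₁, h₂, h₃⟩ := fit_triangle_backward hk hf.1 hf.2.1 hf.2.2
    obtain ⟨f', hf', hv⟩ := exists_override hκ f
      (fun m => if m = 1 then p else if m = 4 then q else r)
    have e₁ := hv 1 (by simp)
    have e₄ := hv 4 (by simp)
    have e₇ := hv 7 (by simp)
    simp only [reduceIte, Nat.reduceEqDiff, OfNat.ofNat_ne_one] at e₁ e₄ e₇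
    refine ⟨f', hf', ?_⟩
    rw [e₁, e₄, e₇, ← hf' _ (hout (m := 0) (by simp)), ← hf' _ (hout (m := 2) (by simp)),
      ← hf' _ (hout (m := 3) (by simp)), ← hf' _ (hout (m := 5) (by simp)),
      ← hf' _ (hout (m := 6) (by simp)), ← hf' _ (hout (m := 8) (by simp))]
    exact ⟨h₁, h₂, h₃⟩
  · intro f g hf hg hfg
    simp only [List.forall_mem_cons, List.not_mem_nil, false_implies, implies_true, and_true,
      Site.Fits, List.map_cons, List.map_nil] at hf hg ⊢
    rw [← hfg _ (hout (m := 0) (by simp)), ← hfg _ (hout (m := 2) (by simp)),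
      ← hfg _ (hout (m := 3) (by simp)), ← hfg _ (hout (m := 5) (by simp)),
      ← hfg _ (hout (m := 6) (by simp)), ← hfg _ (hout (m := 8) (by simp))] at hg
    -- The first crossing determines the inner labels of two strands from incoming outer arcs, the
    -- last one that of the third strand from outgoing arcs.
    have h := (fit_in _ _ _).unique (y₁ := (_, _)) (y₂ := (_, _)) hf.1 hg.1
    have h' := (fit_out _ _ _).unique (y₁ := (_, _)) (y₂ := (_, _)) hf.2.2 hg.2.2
    exact ⟨congrArg Prod.fst h, congrArg Prod.snd h, congrArg Prod.snd h'⟩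
  · intro f g hf hg hfg
    simp only [List.forall_mem_cons, List.not_mem_nil, false_implies, implies_true, and_true,
      Site.Fits, List.map_cons, List.map_nil] at hf hg ⊢
    rw [← hfg _ (hout (m := 0) (by simp)), ← hfg _ (hout (m := 2) (by simp)),
      ← hfg _ (hout (m := 3) (by simp)), ← hfg _ (hout (m := 5) (by simp)),
      ← hfg _ (hout (m := 6) (by simp)), ← hfg _ (hout (m := 8) (by simp))] at hg
    have h := (fit_in _ _ _).unique (y₁ := (_, _)) (y₂ := (_, _)) hf.1 hg.1
    have h' := (fit_out _ _ _).unique (y₁ := (_, _)) (y₂ := (_, _)) hf.2.2 hg.2.2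
    exact ⟨congrArg Prod.fst h', congrArg Prod.fst h, congrArg Prod.snd h⟩
  · intro f g hf hg hfg r hr hiso
    simp only [List.forall_mem_cons, List.not_mem_nil, false_implies, implies_true, and_true,
      Site.Fits] at hf hg
    rw [← hfg _ (hout (m := 0) (by simp)), ← hfg _ (hout (m := 2) (by simp)),
      ← hfg _ (hout (m := 3) (by simp)), ← hfg _ (hout (m := 5) (by simp)),
      ← hfg _ (hout (m := 6) (by simp)), ← hfg _ (hout (m := 8) (by simp))] at hg
    have key := stateSum_triangle hκ (triangleIdentity_weights β hk hf.1 hf.2.1 hf.2.2 hg.1 hg.2.1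
      hg.2.2) r hr hiso
    simp only [List.map_cons, List.map_nil, Site.chord]
    rw [← hfg _ (hout (m := 2) (by simp)), ← hfg _ (hout (m := 6) (by simp)), key, signSum, signSum]
    simp [add_comm, add_left_comm]

theorem under_self_bijective [Finite X] : Function.Bijective fun w : X => w ▷ᵤ w :=
  Finite.injective_iff_bijective.1 fun u v e => by
    have : ((u, u) : X × X) = (v, v) := Biquandle.switch_bijective.1 (Prod.ext
      (by simpa only [← Biquandle.under_self] using e) e)
    exact congrArg Prod.fst this

/-- With passage `true` first, the label `m` of the loop satisfies `m ▷ᵤ m = a` at a classical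
crossing. It exists and is unique because the diagonal operation is bijective on a finite biquandle.
-/
theorem fit_kink [Finite X] (k : CrossingKind) :
    (∀ a m b : X, Fit k a m m b → a = b) ∧ ∀ a : X, ∃! m, Fit k a m m a := by
  refine ⟨fun a m b h => ?_, fun a => ?_⟩
  · cases k
    · rw [h.1, h.2, Biquandle.under_self]
    · rw [h.1, h.2, Biquandle.under_self]
    · rw [h.2, h.1]
  · obtain ⟨m, rfl, hu⟩ := (under_self_bijective (X := X)).existsUnique a
    cases k
    · exact ⟨m, ⟨rfl, Biquandle.under_self m⟩, fun m' h => hu m' h.1.symm⟩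
    · exact ⟨m, ⟨rfl, Biquandle.under_self m⟩, fun m' h => hu m' h.1.symm⟩
    · exact ⟨_, ⟨rfl, rfl⟩, fun m' h => h.1⟩

/-- With passage `false` first, the label of the loop is given outright by the outer ones, and the
equality of the outer labels is the nontrivial part, `kink_labels`. -/
theorem fit_kink' [Finite X] (k : CrossingKind) :
    (∀ a m b : X, Fit k m b a m → a = b) ∧ ∀ a : X, ∃! m, Fit k m a a m := by
  refine ⟨fun a m b h => ?_, fun a => ?_⟩
  · cases k
    · exact kink_labels h.1 h.2
    · exact (kink_labels h.1 h.2).symm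
    · exact h.2.symm.trans h.1.symm
  · cases k
    · exact ⟨_, ⟨rfl, Biquandle.under_self a⟩, fun m h => h.1⟩
    · exact ⟨_, ⟨rfl, Biquandle.under_self a⟩, fun m h => h.1⟩
    · exact ⟨_, ⟨rfl, rfl⟩, fun m h => h.2⟩

/-- Removal of a crossing at which the curve crosses itself after a loop. -/
theorem SameBracket.of_kink {n : ℕ} {κ : ℕ → ℕ} (hκ : ∀ n ∈ [1], ∀ m, m ≠ n → κ m ≠ κ n)
    (hn : ∀ m ∈ [1].map κ, m < n) {s : Site} {Q : X → X → X → Prop}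
    (hQ : (∀ a m b : X, Q a m b → a = b) ∧ ∀ a : X, ∃! m, Q a m a)
    (hs : ∀ f : ℕ → X, s.Fits f ↔ Q (f (κ 0)) (f (κ 1)) (f (κ 2)))
    (hβ : ∀ f : ℕ → X, f (κ 0) = f (κ 2) → ∀ r : Setoid ℕ,
      Finite (Quotient r) → (∀ n ∈ [1].map κ, IsolatedIn r n) →
      stateSum β.δ [s.chord β f] r = ((β.ω ^ s.kind.sign : Rˣ) : R) *
        stateSum β.δ [⟨.virtual R, κ 0, κ 1, κ 1, κ 2⟩] r)
    {o : List Site} (ho : ∀ s ∈ o, s.Avoids ([1].map κ)) :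
    SameBracket β n ([s] ++ o) n ([⟨.virt, κ 0, κ 1, κ 1, κ 2⟩] ++ o) := by
  have h0 : κ 0 ∉ [1].map κ := inner_notMem hκ (by simp)
  have h2 : κ 2 ∉ [1].map κ := inner_notMem hκ (by simp)
  have hfit : ∀ f : ℕ → X, (∀ t ∈ [s], t.Fits f) ↔ Q (f (κ 0)) (f (κ 1)) (f (κ 2)) := fun f => by
    rw [← hs]; simp
  have hfit' : ∀ f : ℕ → X, (∀ s ∈ ([⟨.virt, κ 0, κ 1, κ 1, κ 2⟩] : List Site), s.Fits f) ↔
      f (κ 1) = f (κ 0) ∧ f (κ 2) = f (κ 1) := fun f => by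
    simp [Site.Fits, Fit]
  refine SameBracket.local hn ?_ ?_ ?_ ?_ ?_ ho
  · intro f hf
    obtain ⟨f', hf', hv⟩ := exists_override hκ f (fun _ => f (κ 0))
    refine ⟨f', hf', (hfit' f').2 ?_⟩
    rw [hv 1 (by simp), ← hf' _ h0, ← hf' _ h2, hQ.1 _ _ _ ((hfit f).1 hf)]
    exact ⟨rfl, rfl⟩
  · intro f hf
    have hf := (hfit' f).1 hf
    obtain ⟨m, hm, -⟩ := hQ.2 (f (κ 0))
    obtain ⟨f', hf', hv⟩ := exists_override hκ f (fun _ => m)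
    refine ⟨f', hf', (hfit f').2 ?_⟩
    rw [hv 1 (by simp), ← hf' _ h0, ← hf' _ h2, hf.2, hf.1]
    exact hm
  · intro f g hf hg hfg
    have h₁ := (hfit f).1 hf
    have h₂ := (hfit g).1 hg
    rw [← hfg _ h0, ← hfg _ h2, ← hQ.1 _ _ _ h₁] at h₂
    rw [← hQ.1 _ _ _ h₁] at h₁
    simpa using (hQ.2 _).unique h₁ h₂
  · intro f g hf hg hfg
    have h₁ := (hfit' f).1 hf
    have h₂ := (hfit' g).1 hg
    rw [← hfg _ h0] at h₂
    simpa using h₁.1.trans h₂.1.symm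
  · intro f g hf _ _ r hr hiso
    simp only [List.map_cons, List.map_nil]
    rw [hβ f (hQ.1 _ _ _ ((hfit f).1 hf)) r hr hiso]
    simp [signSum, Site.chord, VirtualBracket.weights, CrossingKind.sign]

theorem SameBracket.kink [Finite X] {n : ℕ} {κ : ℕ → ℕ}
    (hκ : ∀ n ∈ [1], ∀ m, m ≠ n → κ m ≠ κ n) (hn : ∀ m ∈ [1].map κ, m < n) (k : CrossingKind)
    {o : List Site} (ho : ∀ s ∈ o, s.Avoids ([1].map κ)) :
    SameBracket β n ([⟨k, κ 0, κ 1, κ 1, κ 2⟩] ++ o) n ([⟨.virt, κ 0, κ 1, κ 1, κ 2⟩] ++ o) :=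
  SameBracket.of_kink hκ hn (fit_kink k) (fun _ => by exact Iff.rfl) (fun f _ r hr hiso =>
    stateSum_kink hκ _ (kinkIdentity_weights β k _) r hr hiso) ho

theorem SameBracket.kink' [Finite X] {n : ℕ} {κ : ℕ → ℕ}
    (hκ : ∀ n ∈ [1], ∀ m, m ≠ n → κ m ≠ κ n) (hn : ∀ m ∈ [1].map κ, m < n) (k : CrossingKind)
    {o : List Site} (ho : ∀ s ∈ o, s.Avoids ([1].map κ)) :
    SameBracket β n ([⟨k, κ 1, κ 2, κ 0, κ 1⟩] ++ o) n ([⟨.virt, κ 0, κ 1, κ 1, κ 2⟩] ++ o) :=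
  SameBracket.of_kink hκ hn (fit_kink' k) (fun _ => by exact Iff.rfl) (fun f h r hr hiso => by
    rw [Site.chord, stateSum_transpose, ← h]
    exact stateSum_kink hκ _ (kinkIdentity_weights β k _) r hr hiso) ho

/-- Removal of a pair of crossings whose labels satisfy the same relation `P`, read from either
end of the two strands. -/
theorem SameBracket.bigon {n : ℕ} {κ : ℕ → ℕ} (hκ : ∀ n ∈ [1, 4], ∀ m, m ≠ n → κ m ≠ κ n)
    (hn : ∀ m ∈ [1, 4].map κ, m < n) {c d : Site} {i j : ℕ}
    (hij : (i = 3 ∧ j = 5) ∨ (i = 5 ∧ j = 3)) {P : X → X → X → X → Prop}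
    (hin : ∀ p q, ∃! m : X × X, P p m.1 q m.2) (hout : ∀ p q, ∃! m : X × X, P m.1 p m.2 q)
    (hc : ∀ f : ℕ → X, c.Fits f ↔ P (f (κ 0)) (f (κ 1)) (f (κ i)) (f (κ 4)))
    (hd : ∀ f : ℕ → X, d.Fits f ↔ P (f (κ 2)) (f (κ 1)) (f (κ j)) (f (κ 4)))
    (hs : c.kind.sign + d.kind.sign = 0)
    (hβ : ∀ f : ℕ → X, f (κ 0) = f (κ 2) → f (κ 3) = f (κ 5) → ∀ r : Setoid ℕ,
      Finite (Quotient r) → (∀ n ∈ [1, 4].map κ, IsolatedIn r n) →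
      stateSum β.δ [c.chord β f, d.chord β f] r =
      stateSum β.δ [⟨.virtual R, κ 0, κ 1, κ 1, κ 2⟩, ⟨.virtual R, κ 3, κ 4, κ 4, κ 5⟩] r)
    {o : List Site} (ho : ∀ s ∈ o, s.Avoids ([1, 4].map κ)) :
    SameBracket β n ([c, d] ++ o) n
      ([⟨.virt, κ 0, κ 1, κ 1, κ 2⟩, ⟨.virt, κ 3, κ 4, κ 4, κ 5⟩] ++ o) := by
  have hbd : ∀ {m}, m ∉ [1, 4] → κ m ∉ [1, 4].map κ := fun hm => inner_notMem hκ hm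
  have hfit : ∀ f : ℕ → X, (∀ s ∈ [c, d], s.Fits f) ↔ P (f (κ 0)) (f (κ 1)) (f (κ i)) (f (κ 4)) ∧
      P (f (κ 2)) (f (κ 1)) (f (κ j)) (f (κ 4)) := fun f => by
    rw [← hc, ← hd]; simp
  have hfit' : ∀ f : ℕ → X, (∀ s ∈ ([⟨.virt, κ 0, κ 1, κ 1, κ 2⟩, ⟨.virt, κ 3, κ 4, κ 4, κ 5⟩] :
      List Site), s.Fits f) ↔ (f (κ 1) = f (κ 0) ∧ f (κ 2) = f (κ 1)) ∧
        f (κ 4) = f (κ 3) ∧ f (κ 5) = f (κ 4) := fun f => by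
    simp [Site.Fits, Fit]
  have hends : ∀ f : ℕ → X, (∀ s ∈ [c, d], s.Fits f) → f (κ 0) = f (κ 2) ∧ f (κ 3) = f (κ 5) :=
    fun f hf => by
      -- Both corners satisfy `P` with the same inner labels, so their outer labels coincide.
      have := (hout _ _).unique (y₁ := (_, _)) (y₂ := (_, _)) ((hfit f).1 hf).1 ((hfit f).1 hf).2
      refine ⟨congrArg Prod.fst this, ?_⟩
      rcases hij with ⟨rfl, rfl⟩ | ⟨rfl, rfl⟩
      · exact congrArg Prod.snd this
      · exact (congrArg Prod.snd this).symm
  refine SameBracket.local hn ?_ ?_ ?_ ?_ ?_ ho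
  · intro f hf
    obtain ⟨f', hf', hv⟩ := exists_override hκ f (fun m => if m = 1 then f (κ 0) else f (κ 3))
    have e₁ := hv 1 (by simp)
    have e₄ := hv 4 (by simp)
    simp only [reduceIte, OfNat.ofNat_ne_one] at e₁ e₄
    refine ⟨f', hf', (hfit' f').2 ?_⟩
    rw [e₁, e₄, ← hf' _ (hbd (m := 0) (by simp)), ← hf' _ (hbd (m := 2) (by simp)),
      ← hf' _ (hbd (m := 3) (by simp)), ← hf' _ (hbd (m := 5) (by simp)), (hends f hf).1,
      (hends f hf).2]
    exact ⟨⟨rfl, rfl⟩, rfl, rfl⟩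
  · intro f hf
    have hf := (hfit' f).1 hf
    obtain ⟨⟨p, q⟩, hpq, -⟩ := hin (f (κ 0)) (f (κ 3))
    obtain ⟨f', hf', hv⟩ := exists_override hκ f (fun m => if m = 1 then p else q)
    have e₁ := hv 1 (by simp)
    have e₄ := hv 4 (by simp)
    simp only [reduceIte, OfNat.ofNat_ne_one] at e₁ e₄
    refine ⟨f', hf', (hfit f').2 ?_⟩
    have hi : f' (κ i) = f (κ 3) ∧ f' (κ j) = f (κ 3) := by
      have h₃ := hf' _ (hbd (m := 3) (by simp))
      have h₅ := hf' _ (hbd (m := 5) (by simp))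
      rw [hf.2.2, hf.2.1] at h₅
      rcases hij with ⟨rfl, rfl⟩ | ⟨rfl, rfl⟩
      · exact ⟨h₃.symm, h₅.symm⟩
      · exact ⟨h₅.symm, h₃.symm⟩
    rw [e₁, e₄, ← hf' _ (hbd (m := 0) (by simp)), ← hf' _ (hbd (m := 2) (by simp)), hf.1.2,
      hf.1.1, hi.1, hi.2]
    exact ⟨hpq, hpq⟩
  · intro f g hf hg hfg
    have h₁ := ((hfit f).1 hf).1
    have h₂ := ((hfit g).1 hg).1
    have hi : i ∉ [1, 4] := by rcases hij with ⟨rfl, rfl⟩ | ⟨rfl, rfl⟩ <;> simp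
    rw [← hfg _ (hbd (m := 0) (by simp)), ← hfg _ (hbd hi)] at h₂
    have := (hin _ _).unique (y₁ := (_, _)) (y₂ := (_, _)) h₁ h₂
    simpa using Prod.ext_iff.1 this
  · intro f g hf hg hfg
    have h₁ := (hfit' f).1 hf
    have h₂ := (hfit' g).1 hg
    rw [← hfg _ (hbd (m := 0) (by simp)), ← hfg _ (hbd (m := 3) (by simp))] at h₂
    simpa using ⟨h₁.1.1.trans h₂.1.1.symm, h₁.2.1.trans h₂.2.1.symm⟩
  · intro f g hf _ _ r hr hiso
    simp only [List.map_cons, List.map_nil]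
    rw [hβ f (hends f hf).1 (hends f hf).2 r hr hiso]
    have hs' : signSum [c, d] = 0 := by simpa [signSum] using hs
    rw [hs']
    simp [signSum, Site.chord, VirtualBracket.weights, CrossingKind.sign]

theorem CrossingKind.sign_add_sign_inv (k : CrossingKind) : k.sign + k.inv.sign = 0 := by
  cases k <;> rfl

theorem existsUnique_swap {Y : Type*} {Q : Y → Y → Prop} (h : ∃! m : Y × Y, Q m.1 m.2) :
    ∃! m : Y × Y, Q m.2 m.1 := by
  obtain ⟨m, hm, hu⟩ := h
  exact ⟨m.swap, hm, fun p hp => by rw [← hu p.swap hp, Prod.swap_swap]⟩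

theorem SameBracket.bigon_parallel {n : ℕ} {κ : ℕ → ℕ}
    (hκ : ∀ n ∈ [1, 4], ∀ m, m ≠ n → κ m ≠ κ n) (hn : ∀ m ∈ [1, 4].map κ, m < n)
    (k : CrossingKind) {o : List Site} (ho : ∀ s ∈ o, s.Avoids ([1, 4].map κ)) :
    SameBracket β n ([⟨k, κ 0, κ 1, κ 3, κ 4⟩, ⟨k.inv, κ 4, κ 5, κ 1, κ 2⟩] ++ o) n
      ([⟨.virt, κ 0, κ 1, κ 1, κ 2⟩, ⟨.virt, κ 3, κ 4, κ 4, κ 5⟩] ++ o) :=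
  SameBracket.bigon hκ hn (.inl ⟨rfl, rfl⟩) (P := fun p p' q q' => Fit k p p' q q') (fit_in k)
    (fit_out k)
    (fun _ => by exact Iff.rfl) (fun _ => by exact fit_inv) k.sign_add_sign_inv
    (fun f _ h r hr hiso => by
      rw [Site.chord, Site.chord, ← h]
      exact stateSum_bigon_parallel hκ (bigonIdentity_weights β k _ _) r hr hiso) ho

/-- Here the first strand passes the first corner as `false`; transposing both chords reduces the
state sum to the other case. -/
theorem SameBracket.bigon_parallel' {n : ℕ} {κ : ℕ → ℕ}
    (hκ : ∀ n ∈ [1, 4], ∀ m, m ≠ n → κ m ≠ κ n) (hn : ∀ m ∈ [1, 4].map κ, m < n)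
    (k : CrossingKind) {o : List Site} (ho : ∀ s ∈ o, s.Avoids ([1, 4].map κ)) :
    SameBracket β n ([⟨k, κ 3, κ 4, κ 0, κ 1⟩, ⟨k.inv, κ 1, κ 2, κ 4, κ 5⟩] ++ o) n
      ([⟨.virt, κ 0, κ 1, κ 1, κ 2⟩, ⟨.virt, κ 3, κ 4, κ 4, κ 5⟩] ++ o) :=
  SameBracket.bigon hκ hn (.inl ⟨rfl, rfl⟩) (P := fun p p' q q' => Fit k q q' p p')
    (fun p q => existsUnique_swap (Q := fun x y => Fit k q x p y) (fit_in k q p))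
    (fun p q => existsUnique_swap (Q := fun x y => Fit k x q y p) (fit_out k q p))
    (fun _ => by exact Iff.rfl) (fun _ => by exact fit_inv) k.sign_add_sign_inv
    (fun f h _ r hr hiso => by
      rw [Site.chord, Site.chord, stateSum_transpose, stateSum_swap, stateSum_transpose,
        stateSum_swap, ← h]
      exact stateSum_bigon_parallel hκ (bigonIdentity_weights β k _ _) r hr hiso) ho

theorem SameBracket.bigon_antiparallel {n : ℕ} {κ : ℕ → ℕ}
    (hκ : ∀ n ∈ [1, 4], ∀ m, m ≠ n → κ m ≠ κ n) (hn : ∀ m ∈ [1, 4].map κ, m < n)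
    (k : CrossingKind) {o : List Site} (ho : ∀ s ∈ o, s.Avoids ([1, 4].map κ)) :
    SameBracket β n ([⟨k, κ 0, κ 1, κ 4, κ 5⟩, ⟨k.inv, κ 3, κ 4, κ 1, κ 2⟩] ++ o) n
      ([⟨.virt, κ 0, κ 1, κ 1, κ 2⟩, ⟨.virt, κ 3, κ 4, κ 4, κ 5⟩] ++ o) :=
  SameBracket.bigon hκ hn (.inr ⟨rfl, rfl⟩) (P := fun p p' q q' => Fit k p p' q' q)
    (fit_opposite_side k) (fit_side k) (fun _ => by exact Iff.rfl) (fun _ => by exact fit_inv)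
    k.sign_add_sign_inv
    (fun f _ h r hr hiso => by
      exact stateSum_bigon_antiparallel hκ (bigonIdentity_weights β k _ _) r hr hiso) ho

theorem SameBracket.bigon_antiparallel' {n : ℕ} {κ : ℕ → ℕ}
    (hκ : ∀ n ∈ [1, 4], ∀ m, m ≠ n → κ m ≠ κ n) (hn : ∀ m ∈ [1, 4].map κ, m < n)
    (k : CrossingKind) {o : List Site} (ho : ∀ s ∈ o, s.Avoids ([1, 4].map κ)) :
    SameBracket β n ([⟨k, κ 4, κ 5, κ 0, κ 1⟩, ⟨k.inv, κ 1, κ 2, κ 3, κ 4⟩] ++ o) n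
      ([⟨.virt, κ 0, κ 1, κ 1, κ 2⟩, ⟨.virt, κ 3, κ 4, κ 4, κ 5⟩] ++ o) :=
  SameBracket.bigon hκ hn (.inr ⟨rfl, rfl⟩) (P := fun p p' q q' => Fit k q' q p p')
    (fun p q => existsUnique_swap (Q := fun x y => Fit k x q p y) (fit_side k q p))
    (fun p q => existsUnique_swap (Q := fun x y => Fit k q x y p) (fit_opposite_side k q p))
    (fun _ => by exact Iff.rfl) (fun _ => by exact fit_inv)
    k.sign_add_sign_inv (fun f h h' r hr hiso => by
      rw [Site.chord, Site.chord, stateSum_transpose, stateSum_swap, stateSum_transpose,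
        stateSum_swap, ← h, h']
      exact stateSum_bigon_antiparallel hκ (bigonIdentity_weights β k _ _) r hr hiso) ho

end Moves

/-! ### Words of passages -/

/-- The crossings of a word. -/
def crossings (w : List Passage) : List Crossing := (w.filter (·.2)).map (·.1)

def siteOf (w : List Passage) (c : Crossing) : Site :=
  ⟨c.kind, w.idxOf (c, true), w.idxOf (c, true) + 1, w.idxOf (c, false), w.idxOf (c, false) + 1⟩

def sites (w : List Passage) : List Site := (crossings w).map (siteOf w)

/-- Every crossing that is met is met exactly twice. -/
def IsCode (w : List Passage) : Prop := w.Nodup ∧ ∀ c b, (c, b) ∈ w → (c, !b) ∈ w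

theorem crossings_perm {w w' : List Passage} (h : w.Perm w') :
    (crossings w).Perm (crossings w') := (h.filter _).map _

theorem crossings_pair (c : Crossing) (b : Bool) (l : List Passage) :
    crossings ((c, b) :: (c, !b) :: l) = c :: crossings l := by
  cases b <;> simp [crossings]

theorem mem_crossings {w : List Passage} {c : Crossing} : c ∈ crossings w ↔ (c, true) ∈ w := by
  simp [crossings]

theorem crossings_nodup {w : List Passage} (h : w.Nodup) : (crossings w).Nodup :=
  (h.filter _).map_on fun p hp q hq e => Prod.ext e (by
    have hp := (List.mem_filter.1 hp).2
    have hq := (List.mem_filter.1 hq).2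
    exact hp.trans hq.symm)

namespace IsCode

theorem mem {w : List Passage} (h : IsCode w) {c : Crossing} (hc : c ∈ crossings w) :
    ∀ b, (c, b) ∈ w
  | true => mem_crossings.1 hc
  | false => h.2 _ _ (mem_crossings.1 hc)

theorem perm {w w' : List Passage} (h : IsCode w) (hp : w.Perm w') : IsCode w' :=
  ⟨hp.nodup_iff.1 h.1, fun c b hb => hp.subset (h.2 c b (hp.symm.subset hb))⟩

theorem ne_of_mem {c : Crossing} {b : Bool} {l : List Passage}
    (h : IsCode ((c, b) :: (c, !b) :: l)) : ∀ p ∈ l, p.1 ≠ c := by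
  rintro ⟨d, b'⟩ hp rfl
  have h₁ := List.nodup_cons.1 h.1
  have h₂ := List.nodup_cons.1 h₁.2
  by_cases hb : b' = b
  · subst hb
    exact h₁.1 (List.mem_cons_of_mem _ hp)
  · obtain rfl : b' = !b := by cases b <;> cases b' <;> simp_all
    exact h₂.1 hp

theorem tail {c : Crossing} {b : Bool} {l : List Passage}
    (h : IsCode ((c, b) :: (c, !b) :: l)) : IsCode l := by
  refine ⟨(List.nodup_cons.1 (List.nodup_cons.1 h.1).2).2, fun d b' hd => ?_⟩
  have hne : d ≠ c := h.ne_of_mem _ hd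
  have := h.2 d b' (List.mem_cons_of_mem _ (List.mem_cons_of_mem _ hd))
  simpa [hne] using this

theorem cons {c : Crossing} {b : Bool} {l : List Passage} (h : IsCode l)
    (hc : ∀ p ∈ l, p.1 ≠ c) : IsCode ((c, b) :: (c, !b) :: l) := by
  have h₀ : ∀ b, (c, b) ∉ l := fun b hb => hc _ hb rfl
  refine ⟨List.nodup_cons.2 ⟨?_, List.nodup_cons.2 ⟨h₀ _, h.1⟩⟩, fun d b' hd => ?_⟩
  · simp [h₀]
  · by_cases hdc : d = c
    · subst hdc
      cases b <;> cases b' <;> simp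
    · have : (d, b') ∈ l := by simpa [hdc] using hd
      exact List.mem_cons_of_mem _ (List.mem_cons_of_mem _ (h.2 d b' this))

end IsCode

theorem idxOf_append_cons {u v : List Passage} {x : Passage} (h : x ∉ u) :
    (u ++ x :: v).idxOf x = u.length := by
  rw [List.idxOf_append_of_notMem h, List.idxOf_cons_self, add_zero]

theorem idxOf_insert_pair {u v : List Passage} {x y p : Passage} (hx : p ≠ x) (hy : p ≠ y) :
    (u ++ [x, y] ++ v).idxOf p = expand u.length ((u ++ v).idxOf p) := by
  have := expand_spec u.length ((u ++ v).idxOf p)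
  by_cases hp : p ∈ u
  · rw [List.append_assoc, List.idxOf_append_of_mem hp, List.idxOf_append_of_mem hp] at *
    have := List.idxOf_lt_length_of_mem hp
    omega
  · rw [List.append_assoc, List.idxOf_append_of_notMem hp, List.idxOf_append_of_notMem hp] at *
    rw [List.cons_append, List.cons_append, List.nil_append, List.idxOf_cons_ne _ hx.symm,
      List.idxOf_cons_ne _ hy.symm]
    omega

/-- Besides the arriving arcs, the leaving arcs must match: a passage just before the insertion
leaves on arc `i`, one just after it arrives on `i + 2`, and `collapse i` sends both to `i`. -/
theorem site_map_collapse {w w' : List Passage} {i : ℕ} {c : Crossing}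
    (h : ∀ b, w.idxOf (c, b) = expand i (w'.idxOf (c, b))) :
    (siteOf w c).map (collapse i) = siteOf w' c := by
  have hc : ∀ j, collapse i (expand i j + 1) = j + 1 := fun j => by
    have := expand_spec i j
    have := collapse_spec i (expand i j + 1)
    omega
  simp only [siteOf, Site.map, h, collapse_expand, hc]

theorem site_avoids {w : List Passage} {c : Crossing} {N : List ℕ}
    (h : ∀ b, ∀ n ∈ N, w.idxOf (c, b) ≠ n ∧ w.idxOf (c, b) + 1 ≠ n) : (siteOf w c).Avoids N :=
  fun n hn => ⟨(h _ n hn).1, (h _ n hn).2, (h _ n hn).1, (h _ n hn).2⟩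

/-! ### Renaming, first moves and second moves of words -/

section WordMoves

variable {X R : Type*} [Biquandle X] [CommRing R] (β : VirtualBracket X R)

/-- Two words have the same brackets at corresponding colorings. -/
def WordEquiv (w w' : List Passage) : Prop :=
  SameBracket β w.length (sites w) w'.length (sites w')

variable {β}

theorem WordEquiv.symm {w w' : List Passage} (h : WordEquiv β w w') : WordEquiv β w' w :=
  SameBracket.symm h

theorem WordEquiv.trans {w w' w'' : List Passage} (h : WordEquiv β w w')
    (h' : WordEquiv β w' w'') : WordEquiv β w w'' := SameBracket.trans h h'

theorem wordEquiv_rename (w : List Passage) {ρ : Crossing → Crossing}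
    (hρ : Function.Injective ρ) (hk : ∀ c, (ρ c).kind = c.kind) :
    WordEquiv β w (w.map fun p => (ρ p.1, p.2)) := by
  have hidx : ∀ p : Passage, (w.map fun p => (ρ p.1, p.2)).idxOf (ρ p.1, p.2) = w.idxOf p := by
    intro p
    induction w with
    | nil => rfl
    | cons q w ih =>
      by_cases hq : q = p
      · subst hq
        simp
      · have hq' : (ρ q.1, q.2) ≠ (ρ p.1, p.2) := fun e =>
          hq (Prod.ext (hρ (Prod.mk.inj e).1) (Prod.mk.inj e).2)
        rw [List.map_cons, List.idxOf_cons_ne _ hq', List.idxOf_cons_ne _ hq, ih]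
  have hs : sites (w.map fun p => (ρ p.1, p.2)) = sites w := by
    have hc : crossings (w.map fun p => (ρ p.1, p.2)) = (crossings w).map ρ := by
      simp [crossings, List.filter_map, Function.comp_def]
    rw [sites, sites, hc, List.map_map]
    refine List.map_congr_left fun c _ => ?_
    simp only [Function.comp_apply, siteOf, hk, hidx (c, true), hidx (c, false)]
  rw [WordEquiv, hs, List.length_map]
  exact SameBracket.refl _ _

theorem wordEquiv_kink [Finite X] {u v : List Passage} {c : Crossing} {b : Bool}
    (h : IsCode (u ++ [(c, b), (c, !b)] ++ v)) :
    WordEquiv β (u ++ [(c, b), (c, !b)] ++ v) (u ++ v) := by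
  set w := u ++ [(c, b), (c, !b)] ++ v with hw
  have hp : w.Perm ((c, b) :: (c, !b) :: (u ++ v)) := by
    simpa [hw] using List.perm_append_comm_assoc u [(c, b), (c, !b)] v
  have hne := (h.perm hp).ne_of_mem
  have hidx : ∀ d ∈ crossings (u ++ v), ∀ b',
      w.idxOf (d, b') = expand u.length ((u ++ v).idxOf (d, b')) := fun d hd b' => by
    have : d ≠ c := hne _ ((h.perm hp).tail.mem hd true)
    exact idxOf_insert_pair (fun e => this (congrArg Prod.fst e))
      (fun e => this (congrArg Prod.fst e))
  have h₁ : w.idxOf (c, b) = u.length := by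
    rw [hw, List.append_assoc]
    exact idxOf_append_cons fun hm => hne _ (List.mem_append_left _ hm) rfl
  have h₂ : w.idxOf (c, !b) = u.length + 1 := by
    have : w = (u ++ [(c, b)]) ++ (c, !b) :: v := by simp [hw]
    rw [this, idxOf_append_cons, List.length_append, List.length_singleton]
    rw [List.mem_append, not_or]
    exact ⟨fun hm => hne _ (List.mem_append_left _ hm) rfl, by simp⟩
  have hs : (sites w).Perm ([siteOf w c] ++ (crossings (u ++ v)).map (siteOf w)) := by
    have := (crossings_perm hp).map (siteOf w)
    rwa [crossings_pair] at this
  set i := u.length with hiu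
  set κ : ℕ → ℕ := fun m => if m = 0 then i else if m = 1 then i + 1 else i + 2 with hκ'
  have hκ : ∀ n ∈ [1], ∀ m, m ≠ n → κ m ≠ κ n := by
    intro n hn m hm
    rw [List.mem_singleton] at hn
    subst hn
    simp only [hκ', one_ne_zero, reduceIte]
    split_ifs <;> omega
  have hlen : w.length = (u ++ v).length + 2 := by simp [hw]; omega
  have hi : i ≤ (u ++ v).length := by simp [hiu]
  clear_value i w
  have hn : ∀ m ∈ [1].map κ, m < w.length := by
    intro m hm
    obtain rfl : m = i + 1 := by simpa [hκ'] using hm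
    omega
  have ho : ∀ s ∈ (crossings (u ++ v)).map (siteOf w), s.Avoids ([1].map κ) := by
    intro s hs
    obtain ⟨d, hd, rfl⟩ := List.mem_map.1 hs
    refine site_avoids fun b' n hn => ?_
    obtain rfl : n = i + 1 := by simpa [hκ'] using hn
    rw [hidx d hd b']
    have := expand_spec i ((u ++ v).idxOf (d, b'))
    omega
  have hkink : SameBracket β w.length (sites w) w.length
      ([⟨.virt, κ 0, κ 1, κ 1, κ 2⟩] ++ (crossings (u ++ v)).map (siteOf w)) := by
    refine (SameBracket.of_perm _ hs).trans ?_
    -- The two cases are the two possible passages with which the kink begins.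
    cases b
    · have : siteOf w c = ⟨c.kind, κ 1, κ 2, κ 0, κ 1⟩ := by
        simp only [siteOf, hκ']; simp only [Bool.not_false] at h₂; rw [h₁, h₂]; rfl
      rw [this]
      exact SameBracket.kink' hκ hn _ ho
    · have : siteOf w c = ⟨c.kind, κ 0, κ 1, κ 1, κ 2⟩ := by
        simp only [siteOf, hκ']; simp only [Bool.not_true] at h₂; rw [h₁, h₂]; rfl
      rw [this]
      exact SameBracket.kink hκ hn _ ho
  refine SameBracket.trans hkink ?_
  rw [hlen]
  have := SameBracket.collapse (β := β) hi ((crossings (u ++ v)).map (siteOf w))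
  rw [List.map_map] at this
  rw [sites, ← List.map_congr_left (f := Site.map (collapse i) ∘ siteOf w)
    fun d hd => site_map_collapse (fun b' => hidx d hd b')]
  exact this

theorem inOrder_perm (s : Bool) (p q : Passage) : (inOrder s p q).Perm [p, q] := by
  cases s
  · exact List.Perm.swap _ _ _
  · exact List.Perm.refl _

theorem bigon_word_perm (u v w : List Passage) (c d : Crossing) (b s : Bool) :
    (u ++ [(c, b), (d, !b)] ++ v ++ inOrder s (c, !b) (d, b) ++ w).Perm
      ((c, b) :: (c, !b) :: (d, b) :: (d, !b) :: (u ++ v ++ w)) := by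
  have h := inOrder_perm s (c, !b) (d, b)
  rw [List.perm_iff_count] at h ⊢
  intro p
  have := h p
  simp only [List.count_append, List.count_cons, List.count_nil] at this ⊢
  omega

theorem wordEquiv_bigon {u v w : List Passage} {c d : Crossing} {b s : Bool}
    (hk : d.kind = c.kind.inv)
    (h : IsCode (u ++ [(c, b), (d, !b)] ++ v ++ inOrder s (c, !b) (d, b) ++ w)) :
    WordEquiv β (u ++ [(c, b), (d, !b)] ++ v ++ inOrder s (c, !b) (d, b) ++ w) (u ++ v ++ w) := by
  set W := u ++ [(c, b), (d, !b)] ++ v ++ inOrder s (c, !b) (d, b) ++ w with hW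
  have hp : W.Perm _ := bigon_word_perm u v w c d b s
  have hcd : c ≠ d := fun e => (h.perm hp).ne_of_mem (d, b) (by simp) e.symm
  have h₁ := (h.perm hp).tail
  have hc : ∀ p ∈ u ++ v ++ w, p.1 ≠ c := fun p hp' => (h.perm hp).ne_of_mem p (by simp_all)
  have hd : ∀ p ∈ u ++ v ++ w, p.1 ≠ d := h₁.ne_of_mem
  have hcode : IsCode (u ++ v ++ w) := h₁.tail
  set i := u.length with hi
  set j := u.length + 2 + v.length with hj
  -- The longer word arises by inserting a pair at `i` and then one at `j`, where `j` is a position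
  -- after the first insertion.
  have hidx : ∀ e ∈ crossings (u ++ v ++ w), ∀ b',
      W.idxOf (e, b') = expand j (expand i ((u ++ v ++ w).idxOf (e, b'))) := fun e he b' => by
    have hec : ∀ b b' : Bool, (e, b) ≠ (c, b') := fun _ _ h' =>
      hc _ (hcode.mem he true) (congrArg Prod.fst h')
    have hed : ∀ b b' : Bool, (e, b) ≠ (d, b') := fun _ _ h' =>
      hd _ (hcode.mem he true) (congrArg Prod.fst h')
    have e₁ : j = (u ++ [(c, b), (d, !b)] ++ v).length := by simp [hj]; omega
    have e₂ : W.idxOf (e, b') = expand j ((u ++ [(c, b), (d, !b)] ++ v ++ w).idxOf (e, b')) := by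
      rw [hW, e₁]
      cases s
      · exact idxOf_insert_pair (hed _ _) (hec _ _)
      · exact idxOf_insert_pair (hec _ _) (hed _ _)
    rw [e₂, List.append_assoc _ v w, idxOf_insert_pair (hec _ _) (hed _ _), List.append_assoc]
  have hu : ∀ b', (c, b') ∉ u ∧ (d, b') ∉ u := fun b' =>
    ⟨fun hm => hc (c, b') (by simp [hm]) rfl, fun hm => hd (d, b') (by simp [hm]) rfl⟩
  have hv : ∀ b', (c, b') ∉ v ∧ (d, b') ∉ v := fun b' =>
    ⟨fun hm => hc (c, b') (by simp [hm]) rfl, fun hm => hd (d, b') (by simp [hm]) rfl⟩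
  have i₁ : W.idxOf (c, b) = i := by
    have : W = u ++ (c, b) :: ((d, !b) :: (v ++ inOrder s (c, !b) (d, b) ++ w)) := by simp [hW]
    rw [this, idxOf_append_cons (hu b).1]
  have i₂ : W.idxOf (d, !b) = i + 1 := by
    have : W = (u ++ [(c, b)]) ++ (d, !b) :: (v ++ inOrder s (c, !b) (d, b) ++ w) := by simp [hW]
    rw [this, idxOf_append_cons (by simp [(hu !b).2]), List.length_append]
    rfl
  have i₃ : W.idxOf (c, !b) = if s then j else j + 1 := by
    cases s
    · have : W = (u ++ [(c, b), (d, !b)] ++ v ++ [(d, b)]) ++ (c, !b) :: w := by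
        simp [hW, inOrder]
      rw [this, idxOf_append_cons (by simp [hu, hv, hcd])]
      simp [hj]
      omega
    · have : W = (u ++ [(c, b), (d, !b)] ++ v) ++ (c, !b) :: (d, b) :: w := by
        simp [hW, inOrder]
      rw [this, idxOf_append_cons (by simp [hu, hv, hcd])]
      simp [hj]
      omega
  have i₄ : W.idxOf (d, b) = if s then j + 1 else j := by
    cases s
    · have : W = (u ++ [(c, b), (d, !b)] ++ v) ++ (d, b) :: (c, !b) :: w := by
        simp [hW, inOrder]
      rw [this, idxOf_append_cons (by simp [hu, hv, hcd.symm])]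
      simp [hj]
      omega
    · have : W = (u ++ [(c, b), (d, !b)] ++ v ++ [(c, !b)]) ++ (d, b) :: w := by
        simp [hW, inOrder]
      rw [this, idxOf_append_cons (by simp [hu, hv, hcd.symm])]
      simp [hj]
      omega
  have hs : (sites W).Perm
      ([siteOf W c, siteOf W d] ++ (crossings (u ++ v ++ w)).map (siteOf W)) := by
    have := (crossings_perm hp).map (siteOf W)
    rwa [crossings_pair, crossings_pair] at this
  set κ : ℕ → ℕ := fun m => if m = 0 then i else if m = 1 then i + 1 else if m = 2 then i + 2 else
    if m = 3 then j else if m = 4 then j + 1 else j + 2 with hκ'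
  have hij : i + 2 ≤ j := by omega
  have hκ : ∀ n ∈ [1, 4], ∀ m, m ≠ n → κ m ≠ κ n := by
    intro n hn m hm
    simp only [List.mem_cons, List.not_mem_nil, or_false] at hn
    simp only [hκ']
    rcases hn with rfl | rfl <;> simp only [OfNat.ofNat_ne_zero, OfNat.ofNat_ne_one, reduceIte,
      Nat.reduceEqDiff, one_ne_zero] <;> split_ifs <;> omega
  have hlen : W.length = (u ++ v ++ w).length + 2 + 2 := by
    rw [hp.length_eq]
    simp
  have hjn : j ≤ (u ++ v ++ w).length + 2 := by simp [hj]; omega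
  have hin : i ≤ (u ++ v ++ w).length := by simp [hi]
  clear_value i j W
  have hmem : ∀ n ∈ [1, 4].map κ, n = i + 1 ∨ n = j + 1 := by simp [hκ']
  have hn : ∀ m ∈ [1, 4].map κ, m < W.length := by
    intro m hm
    rcases hmem m hm with rfl | rfl <;> omega
  have ho : ∀ t ∈ (crossings (u ++ v ++ w)).map (siteOf W), t.Avoids ([1, 4].map κ) := by
    intro t ht
    obtain ⟨e, he, rfl⟩ := List.mem_map.1 ht
    refine site_avoids fun b' n hn => ?_
    rw [hidx e he b']
    have := expand_spec i ((u ++ v ++ w).idxOf (e, b'))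
    have := expand_spec j (expand i ((u ++ v ++ w).idxOf (e, b')))
    rcases hmem n hn with rfl | rfl <;> omega
  have hbigon : SameBracket β W.length (sites W) W.length
      ([⟨.virt, κ 0, κ 1, κ 1, κ 2⟩, ⟨.virt, κ 3, κ 4, κ 4, κ 5⟩] ++
        (crossings (u ++ v ++ w)).map (siteOf W)) := by
    refine (SameBracket.of_perm _ hs).trans ?_
    simp only [siteOf, hk]
    -- `b` tells which passage the first strand makes at `c`, `s` whether the second strand is
    -- parallel to it.
    cases b <;> cases s <;> simp only [Bool.not_true, Bool.not_false, reduceIte,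
      Bool.false_eq_true] at i₁ i₂ i₃ i₄ <;> rw [i₁, i₂, i₃, i₄]
    · exact SameBracket.bigon_antiparallel' hκ hn _ ho
    · exact SameBracket.bigon_parallel' hκ hn _ ho
    · exact SameBracket.bigon_antiparallel hκ hn _ ho
    · exact SameBracket.bigon_parallel hκ hn _ ho
  refine SameBracket.trans hbigon ?_
  rw [hlen]
  -- The later virtual kink is collapsed first: since `i + 2 ≤ j`, this leaves the arcs `i`, `i +
  -- 1`, `i + 2` of the other one in place.
  refine (SameBracket.of_perm _ (List.Perm.swap _ _ _)).trans
    ((SameBracket.collapse hjn _).trans ?_)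
  have hfix : Site.map (collapse j) ⟨.virt, κ 0, κ 1, κ 1, κ 2⟩ =
      ⟨.virt, i, i + 1, i + 1, i + 2⟩ := by
    have h0 : κ 0 = i := rfl
    have h1 : κ 1 = i + 1 := rfl
    have h2 : κ 2 = i + 2 := rfl
    simp only [Site.map, h0, h1, h2]
    rw [show collapse j i = i by unfold collapse; split_ifs <;> omega,
      show collapse j (i + 1) = i + 1 by unfold collapse; split_ifs <;> omega,
      show collapse j (i + 2) = i + 2 by unfold collapse; split_ifs; omega]
  have := SameBracket.collapse (β := β) (n := (u ++ v ++ w).length) hin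
    (((crossings (u ++ v ++ w)).map (siteOf W)).map (Site.map (collapse j)))
  simp only [List.append_eq, List.nil_append, List.map_cons]
  rw [hfix]
  have hfin : (crossings (u ++ v ++ w)).map (Site.map (collapse i) ∘ Site.map (collapse j) ∘
      siteOf W) = sites (u ++ v ++ w) := by
    refine List.map_congr_left fun e he => ?_
    have hc : ∀ x, collapse i (collapse j (expand j (expand i x) + 1)) = x + 1 := fun x => by
      have := expand_spec i x
      have := expand_spec j (expand i x)
      have := collapse_spec j (expand j (expand i x) + 1)
      have := collapse_spec i (collapse j (expand j (expand i x) + 1))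
      omega
    simp only [Function.comp_apply, siteOf, Site.map, hidx e he, collapse_expand, hc]
  rw [List.map_map, List.map_map, hfin] at this
  rw [List.map_map]
  exact this

end WordMoves

/-! ### Third moves of words -/

section Triangle

/-- The passages `x, y` are adjacent in `W` and occur in the opposite order at the same place in
`W'`. -/
def SwapAt (W W' : List Passage) (x y : Passage) : Prop :=
  W.idxOf y = W.idxOf x + 1 ∧ W'.idxOf x = W.idxOf x + 1 ∧ W'.idxOf y = W.idxOf x

theorem swapAt_append {P P' Q Q' : List Passage} {x y : Passage}
    (h : (P ++ [x, y] ++ Q).Nodup) (h' : (P' ++ [y, x] ++ Q').Nodup) (hl : P'.length = P.length) :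
    SwapAt (P ++ [x, y] ++ Q) (P' ++ [y, x] ++ Q') x y := by
  have key : ∀ {P Q : List Passage} {x y : Passage}, (P ++ [x, y] ++ Q).Nodup →
      (P ++ [x, y] ++ Q).idxOf x = P.length ∧ (P ++ [x, y] ++ Q).idxOf y = P.length + 1 := by
    intro P Q x y h
    have h₁ : P ++ [x, y] ++ Q = P ++ x :: (y :: Q) := by simp
    have h₂ : P ++ [x, y] ++ Q = (P ++ [x]) ++ y :: Q := by simp
    constructor
    · rw [h₁] at h ⊢
      exact idxOf_append_cons fun hx => (List.nodup_append.1 h).2.2 _ hx _ List.mem_cons_self rfl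
    · rw [h₂] at h ⊢
      rw [idxOf_append_cons fun hx =>
        (List.nodup_append.1 h).2.2 _ hx _ List.mem_cons_self rfl, List.length_append]
      rfl
  rw [SwapAt, (key h).1, (key h).2, (key h').1, (key h').2, hl]
  exact ⟨rfl, rfl, rfl⟩

theorem idxOf_swap_pair {u v : List Passage} {x y p : Passage} (hx : p ≠ x) (hy : p ≠ y) :
    (u ++ [x, y] ++ v).idxOf p = (u ++ [y, x] ++ v).idxOf p := by
  rw [idxOf_insert_pair hx hy, idxOf_insert_pair hy hx]

/-- The arcs around three crossings between strands whose first arcs are `i`, `j` and `k`. -/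
def triangleArcs (i j k m : ℕ) : ℕ :=
  if m = 0 then i else if m = 1 then i + 1 else if m = 2 then i + 2 else
  if m = 3 then j else if m = 4 then j + 1 else if m = 5 then j + 2 else
  if m = 6 then k else if m = 7 then k + 1 else k + 2

theorem triangleArcs_ne {i j k : ℕ} (h₁ : i ≠ j ∧ i ≠ j + 1 ∧ i + 1 ≠ j)
    (h₂ : i ≠ k ∧ i ≠ k + 1 ∧ i + 1 ≠ k) (h₃ : j ≠ k ∧ j ≠ k + 1 ∧ j + 1 ≠ k) :
    ∀ n ∈ [1, 4, 7], ∀ m, m ≠ n → triangleArcs i j k m ≠ triangleArcs i j k n := by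
  intro n hn m hm
  simp only [List.mem_cons, List.not_mem_nil, or_false] at hn
  rcases hn with rfl | rfl | rfl <;> simp only [triangleArcs, OfNat.ofNat_ne_zero,
    OfNat.ofNat_ne_one, reduceIte, Nat.reduceEqDiff, one_ne_zero] <;> split_ifs <;> omega

variable {X R : Type*} [Biquandle X] [CommRing R] {β : VirtualBracket X R}

/-- The standard third move: strand 1 passes `a`, `b` as `true`, strand 3 passes `b`, `c` as
`false`, and strand 2 is in between. The conditions on positions are exactly what is needed to match
the sites with those of `SameBracket.triangle`. -/
theorem wordEquiv_triangle {W W' : List Passage} (hW : IsCode W) (hp : W.Perm W')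
    {a b c : Crossing} (ha : a ∈ crossings W) (hb : b ∈ crossings W) (hc : c ∈ crossings W)
    (hab : a ≠ b) (hac : a ≠ c) (hbc : b ≠ c) (h₁ : SwapAt W W' (a, true) (b, true))
    (h₂ : SwapAt W W' (a, false) (c, true)) (h₃ : SwapAt W W' (b, false) (c, false))
    (ho : ∀ e, e ≠ a → e ≠ b → e ≠ c → ∀ b', W.idxOf (e, b') = W'.idxOf (e, b'))
    (hk : TriangleKinds a.kind b.kind c.kind) : WordEquiv β W W' := by
  obtain ⟨o, hcr⟩ : ∃ o, (crossings W).Perm (a :: b :: c :: o) := by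
    refine ⟨(((crossings W).erase a).erase b).erase c, ?_⟩
    have hb' : b ∈ (crossings W).erase a := (List.mem_erase_of_ne hab.symm).2 hb
    have hc' : c ∈ ((crossings W).erase a).erase b :=
      (List.mem_erase_of_ne hbc.symm).2 ((List.mem_erase_of_ne hac.symm).2 hc)
    exact (List.perm_cons_erase ha).trans (.cons _ ((List.perm_cons_erase hb').trans
      (.cons _ (List.perm_cons_erase hc'))))
  have hnd := hcr.nodup_iff.1 (crossings_nodup hW.1)
  simp only [List.nodup_cons, List.mem_cons, not_or] at hnd
  have hne : ∀ e ∈ o, e ≠ a ∧ e ≠ b ∧ e ≠ c := fun e he =>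
    ⟨fun h => hnd.1.2.2 (h ▸ he), fun h => hnd.2.1.2 (h ▸ he), fun h => hnd.2.2.1 (h ▸ he)⟩
  have hmem : ∀ e ∈ o, ∀ b', (e, b') ∈ W := fun e he =>
    hW.mem (hcr.symm.subset (by simp [he]))
  have hinj : ∀ {x y : Passage}, x ∈ W → x ≠ y → W.idxOf x ≠ W.idxOf y := fun hx hxy e =>
    hxy ((List.idxOf_inj hx).1 e)
  obtain ⟨i₁, i₂, i₃⟩ := h₁
  obtain ⟨j₁, j₂, j₃⟩ := h₂
  obtain ⟨k₁, k₂, k₃⟩ := h₃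
  -- The six passages occupy different positions, and each strand's two are adjacent; this separates
  -- the inner arcs `i + 1`, `j + 1`, `k + 1` from all others.
  have d₁ := hinj (hW.mem ha true) (y := (a, false)) (by simp)
  have d₂ := hinj (hW.mem ha true) (y := (c, true)) (by simp [hac])
  have d₃ := hinj (hW.mem ha true) (y := (b, false)) (by simp)
  have d₄ := hinj (hW.mem ha true) (y := (c, false)) (by simp)
  have d₅ := hinj (hW.mem hb true) (y := (a, false)) (by simp)
  have d₆ := hinj (hW.mem hb true) (y := (c, true)) (by simp [hbc])
  have d₇ := hinj (hW.mem hb true) (y := (b, false)) (by simp)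
  have d₈ := hinj (hW.mem hb true) (y := (c, false)) (by simp)
  have d₉ := hinj (hW.mem ha false) (y := (b, false)) (by simp [hab])
  have d₁₀ := hinj (hW.mem ha false) (y := (c, false)) (by simp [hac])
  have d₁₁ := hinj (hW.mem hc true) (y := (b, false)) (by simp)
  have d₁₂ := hinj (hW.mem hc true) (y := (c, false)) (by simp)
  have l₁ := List.idxOf_lt_length_of_mem (hW.mem hb true)
  have l₂ := List.idxOf_lt_length_of_mem (hW.mem hc true)
  have l₃ := List.idxOf_lt_length_of_mem (hW.mem hc false)
  have hoi : ∀ e ∈ o, ∀ b', W.idxOf (e, b') ≠ W.idxOf (a, true) ∧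
      W.idxOf (e, b') ≠ W.idxOf (b, true) ∧ W.idxOf (e, b') ≠ W.idxOf (a, false) ∧
      W.idxOf (e, b') ≠ W.idxOf (c, true) ∧ W.idxOf (e, b') ≠ W.idxOf (b, false) ∧
      W.idxOf (e, b') ≠ W.idxOf (c, false) := fun e he b' => by
    obtain ⟨n₁, n₂, n₃⟩ := hne e he
    refine ⟨?_, ?_, ?_, ?_, ?_, ?_⟩ <;> exact hinj (hmem e he b') (by simp [n₁, n₂, n₃])
  have hs : ∀ e, siteOf W e = ⟨e.kind, W.idxOf (e, true), W.idxOf (e, true) + 1,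
      W.idxOf (e, false), W.idxOf (e, false) + 1⟩ := fun _ => rfl
  have hs' : ∀ e, siteOf W' e = ⟨e.kind, W'.idxOf (e, true), W'.idxOf (e, true) + 1,
      W'.idxOf (e, false), W'.idxOf (e, false) + 1⟩ := fun _ => rfl
  have ha₁ := hs a
  have hb₁ := hs b
  have hc₁ := hs c
  have ha₂ := hs' a
  have hb₂ := hs' b
  have hc₂ := hs' c
  rw [i₁] at hb₁
  rw [j₁, k₁] at hc₁
  rw [i₂, j₂] at ha₂
  rw [i₃, k₂] at hb₂
  rw [j₃, k₃] at hc₂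
  rw [i₁] at d₅ d₆ d₇ d₈ l₁
  rw [j₁] at d₂ d₆ d₁₁ d₁₂ l₂
  rw [k₁] at d₄ d₈ d₁₀ d₁₂ l₃
  rw [i₁, j₁, k₁] at hoi
  generalize W.idxOf (a, true) = i at *
  generalize W.idxOf (a, false) = j at *
  generalize W.idxOf (b, false) = k at *
  have hκ := triangleArcs_ne (i := i) (j := j) (k := k) ⟨d₁, d₂, d₅⟩ ⟨d₃, d₄, d₇⟩ ⟨d₉, d₁₀, d₁₁⟩
  have hin : ∀ n ∈ [1, 4, 7].map (triangleArcs i j k), n = i + 1 ∨ n = j + 1 ∨ n = k + 1 := by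
    simp [triangleArcs]
  set κ := triangleArcs i j k
  have hn : ∀ m ∈ [1, 4, 7].map κ, m < W.length := by
    intro m hm
    rcases hin m hm with rfl | rfl | rfl <;> omega
  have hav : ∀ t ∈ o.map (siteOf W), t.Avoids ([1, 4, 7].map κ) := by
    intro t ht
    obtain ⟨e, he, rfl⟩ := List.mem_map.1 ht
    refine site_avoids fun b' n hn => ?_
    have := hoi e he b'
    rcases hin n hn with rfl | rfl | rfl <;> omega
  have hoeq : o.map (siteOf W) = o.map (siteOf W') := by
    refine List.map_congr_left fun e he => ?_
    have := ho e (hne e he).1 (hne e he).2.1 (hne e he).2.2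
    rw [siteOf, siteOf, this, this]
  have key := SameBracket.triangle (β := β) hκ hn hk hav
  have hW₁ : (sites W).Perm ([⟨a.kind, κ 0, κ 1, κ 3, κ 4⟩, ⟨b.kind, κ 1, κ 2, κ 6, κ 7⟩,
      ⟨c.kind, κ 4, κ 5, κ 7, κ 8⟩] ++ o.map (siteOf W)) := by
    have := hcr.map (siteOf W)
    rwa [List.map_cons, List.map_cons, List.map_cons, ha₁, hb₁, hc₁] at this
  have hW₂ : (sites W').Perm ([⟨c.kind, κ 3, κ 4, κ 6, κ 7⟩, ⟨b.kind, κ 0, κ 1, κ 7, κ 8⟩,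
      ⟨a.kind, κ 1, κ 2, κ 4, κ 5⟩] ++ o.map (siteOf W)) := by
    have := (((crossings_perm hp).symm.trans hcr).map (siteOf W')).trans
      (l₃ := (c :: b :: a :: o).map (siteOf W')) (List.Perm.map _ (by
        rw [List.perm_iff_count]
        intro e
        simp only [List.count_cons]
        omega))
    rwa [List.map_cons, List.map_cons, List.map_cons, ha₂, hb₂, hc₂, ← hoeq] at this
  rw [WordEquiv, ← hp.length_eq]
  exact (SameBracket.of_perm _ hW₁).trans (key.trans (SameBracket.of_perm _ hW₂).symm)

/-- The passages `x, y`, in the order given by `s`, are exchanged. -/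
def SwapInOrder (s : Bool) (W W' : List Passage) (x y : Passage) : Prop :=
  (if s then SwapAt W W' x y else SwapAt W W' y x) ∧
    if s then SwapAt W' W y x else SwapAt W' W x y

theorem TriangleKinds.swap {k l m : CrossingKind} (h : TriangleKinds k l m) :
    TriangleKinds l k m := by
  unfold TriangleKinds at *; tauto

theorem TriangleKinds.rotate {k l m : CrossingKind} (h : TriangleKinds k l m) :
    TriangleKinds l m k := by
  unfold TriangleKinds at *; tauto

/-- `hacyclic` says that some strand makes both its passages as `true`. For three strands this means
that they are linearly ordered, and the face conditions then fix the orders along the strands up to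
a simultaneous reversal. -/
theorem wordEquiv_of_swapInOrder {W W' : List Passage} (hW : IsCode W) (hp : W.Perm W')
    {a b c : Crossing} (ha : a ∈ crossings W) (hb : b ∈ crossings W) (hc : c ∈ crossings W)
    (hab : a ≠ b) (hac : a ≠ c) (hbc : b ≠ c) {α β' γ s₁ s₂ s₃ : Bool}
    (h₁ : SwapInOrder s₁ W W' (a, α) (b, β')) (h₂ : SwapInOrder s₂ W W' (a, !α) (c, γ))
    (h₃ : SwapInOrder s₃ W W' (b, !β') (c, !γ))
    (ho : ∀ e, e ≠ a → e ≠ b → e ≠ c → ∀ b', W.idxOf (e, b') = W'.idxOf (e, b'))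
    (hk : TriangleKinds a.kind b.kind c.kind)
    (face₁ : (α == (s₁ == s₂)) = (β' == (s₁ == s₃)))
    (face₂ : (β' == (s₁ == s₃)) = (γ == (s₂ == s₃)))
    (hacyclic : (α = true ∧ β' = true) ∨ (α = false ∧ γ = true) ∨ (β' = false ∧ γ = false)) :
    WordEquiv β W W' := by
  have hcr := (crossings_perm hp).subset
  have fwd := fun {x y z : Crossing} hx hy hz hxy hxz hyz h₁ h₂ h₃ ho hk =>
    wordEquiv_triangle (β := β) (a := x) (b := y) (c := z) hW hp hx hy hz hxy hxz hyz h₁ h₂ h₃ ho hk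
  have bwd := fun {x y z : Crossing} hx hy hz hxy hxz hyz h₁ h₂ h₃ ho hk =>
    (wordEquiv_triangle (β := β) (a := x) (b := y) (c := z) (hW.perm hp) hp.symm (hcr hx) (hcr hy)
      (hcr hz) hxy hxz hyz h₁ h₂ h₃ ho hk).symm
  have ho' := fun e h₁ h₂ h₃ b' => (ho e h₁ h₂ h₃ b').symm
  cases α <;> cases β' <;> cases γ <;> cases s₁ <;> cases s₂ <;> cases s₃ <;>
    first
    | (exfalso; revert face₁ face₂ hacyclic; decide)
    | skip
  all_goals
    simp only [SwapInOrder, Bool.not_true, Bool.not_false, reduceIte, Bool.false_eq_true]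
      at h₁ h₂ h₃
    obtain ⟨h₁, h₁'⟩ := h₁
    obtain ⟨h₂, h₂'⟩ := h₂
    obtain ⟨h₃, h₃'⟩ := h₃
    -- Six orderings of the three strands, each with the move read forwards or backwards.
    first
    | exact fwd ha hb hc hab hac hbc h₁ h₂ h₃ (fun e p q r => ho e p q r) hk
    | exact bwd ha hb hc hab hac hbc h₁' h₂' h₃' (fun e p q r => ho' e p q r) hk
    | exact fwd hb ha hc hab.symm hbc hac h₁ h₃ h₂ (fun e q p r => ho e p q r) hk.swap
    | exact bwd hb ha hc hab.symm hbc hac h₁' h₃' h₂' (fun e q p r => ho' e p q r) hk.swap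
    | exact fwd ha hc hb hac hab hbc.symm h₂ h₁ h₃ (fun e p r q => ho e p q r) hk.swap.rotate
    | exact bwd ha hc hb hac hab hbc.symm h₂' h₁' h₃' (fun e p r q => ho' e p q r) hk.swap.rotate
    | exact fwd hb hc ha hbc hab.symm hac.symm h₃ h₁ h₂ (fun e q r p => ho e p q r) hk.rotate
    | exact bwd hb hc ha hbc hab.symm hac.symm h₃' h₁' h₂' (fun e q r p => ho' e p q r) hk.rotate
    | exact fwd hc hb ha hbc.symm hac.symm hab.symm h₃ h₂ h₁ (fun e r q p => ho e p q r)
        hk.rotate.swap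
    | exact bwd hc hb ha hbc.symm hac.symm hab.symm h₃' h₂' h₁' (fun e r q p => ho' e p q r)
        hk.rotate.swap
    | exact fwd hc ha hb hac.symm hbc.symm hab h₂ h₃ h₁ (fun e r p q => ho e p q r) hk.rotate.rotate
    | exact bwd hc ha hb hac.symm hbc.symm hab h₂' h₃' h₁' (fun e r p q => ho' e p q r)
        hk.rotate.rotate

end Triangle

/-! ### All third moves -/

section Flip

variable {X R : Type*} [Biquandle X] [CommRing R] {β : VirtualBracket X R}

theorem exists_fresh (W : List Passage) (k k' : CrossingKind) :
    ∃ e f : Crossing, e.kind = k ∧ f.kind = k' ∧ e ≠ f ∧ (∀ p ∈ W, p.1 ≠ e) ∧ ∀ p ∈ W, p.1 ≠ f := by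
  obtain ⟨N, hN⟩ : ∃ N, ∀ p ∈ W, p.1.name < N := by
    induction W with
    | nil => exact ⟨0, by simp⟩
    | cons p W ih =>
      obtain ⟨N, hN⟩ := ih
      refine ⟨max N (p.1.name + 1), fun q hq => ?_⟩
      rcases List.mem_cons.1 hq with rfl | hq
      · exact lt_max_of_lt_right (Nat.lt_succ_self _)
      · exact lt_max_of_lt_left (hN q hq)
  refine ⟨⟨k, N⟩, ⟨k', N + 1⟩, rfl, rfl, fun h => ?_, fun p hp h => ?_, fun p hp h => ?_⟩
  · exact absurd (congrArg Crossing.name h) (by simp)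
  · have := hN p hp
    rw [h] at this
    exact lt_irrefl _ this
  · have := hN p hp
    rw [h] at this
    exact absurd this (by simp)

/-- A word with two holes for parts of two strands and one for a part of a third strand. -/
structure WordContext (β : VirtualBracket X R) where
  fill : List Passage → List Passage → List Passage → List Passage
  rest : List Passage
  perm : ∀ x y z, (fill x y z).Perm (x ++ y ++ z ++ rest)
  map : ∀ (g : Passage → Passage) x y z, (∀ p ∈ rest, g p = p) →
    (fill x y z).map g = fill (x.map g) (y.map g) (z.map g)
  bigon : ∀ (p q p' q' z : List Passage) (c d : Crossing) (b b' s : Bool), b' = (!b) →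
    d.kind = c.kind.inv →
    IsCode (fill (p ++ [(c, b), (d, b')] ++ q) (p' ++ inOrder s (c, b') (d, b) ++ q') z) →
    WordEquiv β (fill (p ++ [(c, b), (d, b')] ++ q) (p' ++ inOrder s (c, b') (d, b) ++ q') z)
      (fill (p ++ q) (p' ++ q') z)

/-- A crossing `x` of a third move is replaced by a crossing `e` of the opposite sign, by adding a
bigon with corners `e` and `f` and removing another one with corners `x` and `e`. -/
theorem WordContext.flip (G : WordContext β) {x e f : Crossing} {o o' : Passage} {b s : Bool}
    {z z' : List Passage} (he : e.kind = x.kind.inv) (hf : f.kind = x.kind) (hef : e ≠ f)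
    (hWe : ∀ p ∈ G.fill [(x, b), o] (inOrder s (x, !b) o') z, p.1 ≠ e)
    (hWf : ∀ p ∈ G.fill [(x, b), o] (inOrder s (x, !b) o') z, p.1 ≠ f)
    (hz : z.Perm z') (hW : IsCode (G.fill [(x, b), o] (inOrder s (x, !b) o') z))
    (hR : IsCode (G.fill ([(x, b)] ++ [o, (e, !b)] ++ [(f, b)]) ((if s then [(x, !b)] else
        [(f, !b)]) ++ inOrder s o' (e, b) ++ if s then [(f, !b)] else [(x, !b)]) z) →
      WordEquiv β (G.fill ([(x, b)] ++ [o, (e, !b)] ++ [(f, b)]) ((if s then [(x, !b)] else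
        [(f, !b)]) ++ inOrder s o' (e, b) ++ if s then [(f, !b)] else [(x, !b)]) z)
        (G.fill ([(x, b)] ++ [(e, !b), o] ++ [(f, b)]) ((if s then [(x, !b)] else
        [(f, !b)]) ++ inOrder (!s) o' (e, b) ++ if s then [(f, !b)] else [(x, !b)]) z')) :
    WordEquiv β (G.fill [(x, b), o] (inOrder s (x, !b) o') z)
      (G.fill [o, (x, b)] (inOrder (!s) (x, !b) o') z') := by
  have hperm₀ : (G.fill [(x, b), o] (inOrder s (x, !b) o') z).Perm
      ((x, b) :: (x, !b) :: (o :: o' :: (z ++ G.rest))) := by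
    refine (G.perm _ _ _).trans ?_
    have := inOrder_perm s (x, !b) o'
    rw [List.perm_iff_count] at this ⊢
    intro p
    have := this p
    simp only [List.count_append, List.count_cons, List.count_nil] at this ⊢
    omega
  have hx := (hW.perm hperm₀).ne_of_mem
  have he' := fun p hp => hWe p (hperm₀.symm.subset hp)
  have hf' := fun p hp => hWf p (hperm₀.symm.subset hp)
  have hbig : IsCode ((e, b) :: (e, !b) :: (f, b) :: (f, !b) :: (x, b) :: (x, !b) ::
      (o :: o' :: (z ++ G.rest))) := by
    refine IsCode.cons (IsCode.cons (hW.perm hperm₀) hf') fun p hp => ?_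
    rcases List.mem_cons.1 hp with rfl | hp
    · exact hef.symm
    rcases List.mem_cons.1 hp with rfl | hp
    · exact hef.symm
    exact he' p hp
  -- All intermediate words are rearrangements of one word containing the old passages and the four
  -- passages of `e` and `f`, so one verification suffices.
  have code₁ : ∀ {l l' : List Passage},
      l.Perm [(e, !b), (f, b), (x, b), o] → l'.Perm [(e, b), (f, !b), (x, !b), o'] →
      IsCode (G.fill l l' z) ∧ IsCode (G.fill l l' z') := by
    intro l l' hl hl'
    have h₀ : ∀ {z''}, z.Perm z'' → IsCode (G.fill l l' z'') := fun {z''} hz'' => by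
      refine hbig.perm (List.Perm.symm ((G.perm _ _ _).trans ?_))
      rw [List.perm_iff_count] at hl hl' hz'' ⊢
      intro p
      have h₁ := hl p
      have h₂ := hl' p
      have h₃ := hz'' p
      simp only [List.count_append, List.count_cons, List.count_nil] at h₁ h₂ h₃ ⊢
      omega
    exact ⟨h₀ (List.Perm.refl _), h₀ hz⟩
  -- Once `x` and `e` have cancelled, `f` stands where `x` should, with the same kind. Transposing
  -- the two names repairs this and fixes all other passages.
  have hρ : Function.Injective (Equiv.swap f x) := (Equiv.swap f x).injective
  have hρk : ∀ c, (Equiv.swap f x c).kind = c.kind := fun c => by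
    by_cases h : c = f
    · rw [h, Equiv.swap_apply_left, hf]
    · by_cases h' : c = x
      · rw [h', Equiv.swap_apply_right, hf]
      · rw [Equiv.swap_apply_of_ne_of_ne h h']
  have hfix : ∀ p ∈ o :: o' :: (z ++ G.rest), ((Equiv.swap f x p.1, p.2) : Passage) = p :=
    fun p hp => by
      rw [Equiv.swap_apply_of_ne_of_ne (hf' p (by simp only [List.mem_cons] at hp ⊢; tauto))
        (hx p hp)]
  have hzmap : z'.map (fun p => ((Equiv.swap f x p.1, p.2) : Passage)) = z' := by
    refine (List.map_congr_left fun p hp => ?_).trans (List.map_id z')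
    exact hfix p (by simp [hz.symm.subset hp])
  have hrename : ∀ l l', WordEquiv β (G.fill l l' z') (G.fill
      (l.map fun p => (Equiv.swap f x p.1, p.2)) (l'.map fun p => (Equiv.swap f x p.1, p.2)) z') :=
    fun l l' => by
      have := wordEquiv_rename (β := β) (G.fill l l' z') hρ hρk
      rwa [G.map _ _ _ _ fun p hp => hfix p (by simp [hp]), hzmap] at this
  have ho := hfix o (by simp)
  have ho' := hfix o' (by simp)
  have hfe : f.kind = e.kind.inv := by rw [he, hf, CrossingKind.inv_inv]
  cases s
  · have m₁ := G.bigon [(x, b), o] [] [] [o', (x, !b)] z e f (!b) b false (by simp) hfe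
      (code₁ (by
        rw [List.perm_iff_count]; intro p; simp [List.count_cons]; omega) (by
        rw [List.perm_iff_count]; intro p; simp [List.count_cons, inOrder]; omega)).1
    have m₂ := hR (code₁ (by
        rw [List.perm_iff_count]; intro p; simp [List.count_cons]; omega) (by
        rw [List.perm_iff_count]; intro p; simp [List.count_cons, inOrder]; omega)).1
    have m₃ := G.bigon [] [o, (f, b)] [(f, !b), o'] [] z' x e b (!b) false rfl he
      (code₁ (by
        rw [List.perm_iff_count]; intro p; simp [List.count_cons]; omega) (by
        rw [List.perm_iff_count]; intro p; simp [List.count_cons, inOrder]; omega)).2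
    have m₄ := hrename [o, (f, b)] [(f, !b), o']
    simp only [List.map_cons, List.map_nil, ho, ho', Equiv.swap_apply_left] at m₄
    exact m₁.symm.trans (m₂.trans (m₃.trans m₄))
  · have m₁ := G.bigon [(x, b), o] [] [(x, !b), o'] [] z e f (!b) b true (by simp) hfe
      (code₁ (by
        rw [List.perm_iff_count]; intro p; simp [List.count_cons]; omega) (by
        rw [List.perm_iff_count]; intro p; simp [List.count_cons, inOrder]; omega)).1
    have m₂ := hR (code₁ (by
        rw [List.perm_iff_count]; intro p; simp [List.count_cons]; omega) (by
        rw [List.perm_iff_count]; intro p; simp [List.count_cons, inOrder]; omega)).1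
    have m₃ := G.bigon [] [o, (f, b)] [] [o', (f, !b)] z' x e b (!b) true rfl he
      (code₁ (by
        rw [List.perm_iff_count]; intro p; simp [List.count_cons]; omega) (by
        rw [List.perm_iff_count]; intro p; simp [List.count_cons, inOrder]; omega)).2
    have m₄ := hrename [o, (f, b)] [o', (f, !b)]
    simp only [List.map_cons, List.map_nil, ho, ho', Equiv.swap_apply_left] at m₄
    exact m₁.symm.trans (m₂.trans (m₃.trans m₄))

end Flip

/-! ### Change of the sign of one crossing in a third move -/

section ThirdMove

variable {X R : Type*} [Biquandle X] [CommRing R] {β : VirtualBracket X R}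

theorem inOrder_not (s : Bool) (p q : Passage) : inOrder (!s) p q = inOrder s q p := by
  cases s <;> rfl

/-- A word with three distinguished parts. -/
def threeStrands (t u v w x y z : List Passage) : List Passage :=
  t ++ x ++ u ++ y ++ v ++ z ++ w

/-- Extra passages at the ends of the strands can be counted as part of the surrounding word; this
exhibits the smaller triangle inside a word enlarged by a bigon. -/
theorem threeStrands_append (t u v w x y z p q p' q' p'' q'' : List Passage) :
    threeStrands (t ++ p) (q ++ u ++ p') (q' ++ v ++ p'') (q'' ++ w) x y z =
      threeStrands t u v w (p ++ x ++ q) (p' ++ y ++ q') (p'' ++ z ++ q'') := by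
  simp [threeStrands]

theorem threeStrands_perm (t u v w x y z : List Passage) :
    (threeStrands t u v w x y z).Perm (x ++ y ++ z ++ (t ++ u ++ v ++ w)) := by
  rw [List.perm_iff_count]
  intro p
  simp only [threeStrands, List.count_append]
  omega

theorem threeStrands_map (t u v w x y z : List Passage) (g : Passage → Passage)
    (h : ∀ p ∈ t ++ u ++ v ++ w, g p = p) : (threeStrands t u v w x y z).map g =
      threeStrands t u v w (x.map g) (y.map g) (z.map g) := by
  have h' : ∀ l : List Passage, (∀ p ∈ l, p ∈ t ++ u ++ v ++ w) → l.map g = l := fun l hl =>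
    (List.map_congr_left fun p hp => h p (hl p hp)).trans (List.map_id l)
  have ht := h' t (by simp +contextual)
  have hu := h' u (by simp +contextual)
  have hv := h' v (by simp +contextual)
  have hw := h' w (by simp +contextual)
  simp only [threeStrands, List.map_append, ht, hu, hv, hw]

variable (β) in
/-- Holes on the first two of three strands. -/
def context₁₂ (t u v w : List Passage) : WordContext β where
  fill x y z := threeStrands t u v w x y z
  rest := t ++ u ++ v ++ w
  perm := threeStrands_perm t u v w
  map g x y z h := threeStrands_map t u v w x y z g h
  bigon p q p' q' z c d b b' s hb hk h := by
    subst hb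
    have := wordEquiv_bigon (β := β) (u := t ++ p) (v := q ++ u ++ p') (w := q' ++ v ++ z ++ w)
      (c := c) (d := d) (b := b) (s := s) hk
    simp only [threeStrands, List.append_assoc] at this h ⊢
    exact this h

variable (β) in
/-- Holes on the first and the last of three strands. -/
def context₁₃ (t u v w : List Passage) : WordContext β where
  fill x y z := threeStrands t u v w x z y
  rest := t ++ u ++ v ++ w
  perm x y z := (threeStrands_perm t u v w x z y).trans (by
    rw [List.perm_iff_count]
    intro p
    simp only [List.count_append]
    omega)
  map g x y z h := threeStrands_map t u v w x z y g h
  bigon p q p' q' z c d b b' s hb hk h := by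
    subst hb
    have := wordEquiv_bigon (β := β) (u := t ++ p) (v := q ++ u ++ z ++ v ++ p') (w := q' ++ w)
      (c := c) (d := d) (b := b) (s := s) hk
    simp only [threeStrands, List.append_assoc] at this h ⊢
    exact this h

variable (β) in
/-- Holes on the last two of three strands. -/
def context₂₃ (t u v w : List Passage) : WordContext β where
  fill x y z := threeStrands t u v w z x y
  rest := t ++ u ++ v ++ w
  perm x y z := (threeStrands_perm t u v w z x y).trans (by
    rw [List.perm_iff_count]
    intro p
    simp only [List.count_append]
    omega)
  map g x y z h := threeStrands_map t u v w z x y g h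
  bigon p q p' q' z c d b b' s hb hk h := by
    subst hb
    have := wordEquiv_bigon (β := β) (u := t ++ z ++ u ++ p) (v := q ++ v ++ p') (w := q' ++ w)
      (c := c) (d := d) (b := b) (s := s) hk
    simp only [threeStrands, List.append_assoc] at this h ⊢
    exact this h

/-- The word on one side of a third move. -/
def triangleWord (t u v w : List Passage) (a b c : Crossing) (α β' γ s₁ s₂ s₃ : Bool) :
    List Passage :=
  threeStrands t u v w (inOrder s₁ (a, α) (b, β')) (inOrder s₂ (a, !α) (c, γ))
    (inOrder s₃ (b, !β') (c, !γ))

theorem inOrder_perm_not (s : Bool) (p q : Passage) : (inOrder s p q).Perm (inOrder (!s) p q) :=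
  (inOrder_perm s p q).trans (inOrder_perm (!s) p q).symm

theorem triangleWord_perm (t u v w : List Passage) (a b c : Crossing) (α β' γ s₁ s₂ s₃ : Bool) :
    (triangleWord t u v w a b c α β' γ s₁ s₂ s₃).Perm
      (triangleWord t u v w a b c α β' γ (!s₁) (!s₂) (!s₃)) := by
  have h₁ := inOrder_perm_not s₁ (a, α) (b, β')
  have h₂ := inOrder_perm_not s₂ (a, !α) (c, γ)
  have h₃ := inOrder_perm_not s₃ (b, !β') (c, !γ)
  exact ((((((h₁.append_left t).append_right u).append h₂).append_right v).append h₃).append_right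
    w)

variable (β) in
/-- Third moves of the given shape do not change the brackets. -/
def TriangleInvariance (ka kb kc : CrossingKind) (α β' γ s₁ s₂ s₃ : Bool) : Prop :=
  ∀ t u v w a b c, a.kind = ka → b.kind = kb → c.kind = kc →
    IsCode (triangleWord t u v w a b c α β' γ s₁ s₂ s₃) →
    WordEquiv β (triangleWord t u v w a b c α β' γ s₁ s₂ s₃)
      (triangleWord t u v w a b c α β' γ (!s₁) (!s₂) (!s₃))

namespace TriangleInvariance

variable {ka kb kc : CrossingKind} {α β' γ s₁ s₂ s₃ : Bool}

theorem reverse (h : TriangleInvariance β ka kb kc α β' γ (!s₁) (!s₂) (!s₃)) :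
    TriangleInvariance β ka kb kc α β' γ s₁ s₂ s₃ := by
  intro t u v w a b c ha hb hc hW
  have := h t u v w a b c ha hb hc (hW.perm (triangleWord_perm _ _ _ _ _ _ _ _ _ _ _ _ _))
  simp only [Bool.not_not] at this
  exact this.symm

/-- The strand that was over stays over: both the sign of the crossing and its `true` passage
change. All three terms of the face conditions are negated, so these persist. -/
theorem flip_a (h : TriangleInvariance β ka.inv kb kc (!α) β' γ (!s₁) (!s₂) s₃) :
    TriangleInvariance β ka kb kc α β' γ s₁ s₂ s₃ := by
  -- `WordContext.flip` expects the exchanged crossing to come first on its strand, here `s₁ =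
  -- true`; the other order follows by reading the move backwards.
  have key : ∀ {s₂ s₃}, TriangleInvariance β ka.inv kb kc (!α) β' γ false (!s₂) s₃ →
      TriangleInvariance β ka kb kc α β' γ true s₂ s₃ := by
    intro s₂ s₃ h t u v w a b c ha hb hc hW
    obtain ⟨e, f, he, hf, hef, hWe, hWf⟩ :=
      exists_fresh (triangleWord t u v w a b c α β' γ true s₂ s₃) ka.inv ka
    refine (context₁₂ β t u v w).flip (he.trans (by rw [ha])) (hf.trans ha.symm) hef hWe hWf
      (inOrder_perm_not _ _ _) hW fun hcode => ?_
    -- The passages of `a` and `f` are absorbed into the surroundings, and the triangle that moves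
    -- has corners `e`, `b`, `c`.
    have := h (t ++ [(a, α)]) ([(f, α)] ++ u ++ if s₂ then [(a, !α)] else [(f, !α)])
      ((if s₂ then [(f, !α)] else [(a, !α)]) ++ v ++ []) ([] ++ w) e b c he hb hc
    simp only [triangleWord, threeStrands_append, inOrder_not, Bool.not_not] at this
    simp only [List.nil_append, List.append_nil] at this
    simp only [inOrder_not] at hcode ⊢
    exact this hcode
  cases s₁
  · exact reverse (key (reverse (by simpa using h)))
  · exact key h

theorem flip_b (h : TriangleInvariance β ka kb.inv kc α (!β') γ (!s₁) s₂ (!s₃)) :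
    TriangleInvariance β ka kb kc α β' γ s₁ s₂ s₃ := by
  have key : ∀ {s₂ s₃}, TriangleInvariance β ka kb.inv kc α (!β') γ true s₂ (!s₃) →
      TriangleInvariance β ka kb kc α β' γ false s₂ s₃ := by
    intro s₂ s₃ h t u v w a b c ha hb hc hW
    obtain ⟨e, f, he, hf, hef, hWe, hWf⟩ :=
      exists_fresh (triangleWord t u v w a b c α β' γ false s₂ s₃) kb.inv kb
    refine (context₁₃ β t u v w).flip (he.trans (by rw [hb])) (hf.trans hb.symm) hef hWe hWf
      (inOrder_perm_not _ _ _) hW fun hcode => ?_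
    have := h (t ++ [(b, β')]) ([(f, β')] ++ u ++ [])
      ([] ++ v ++ if s₃ then [(b, !β')] else [(f, !β')])
      ((if s₃ then [(f, !β')] else [(b, !β')]) ++ w) a e c ha he hc
    simp only [triangleWord, threeStrands_append, inOrder_not, Bool.not_not] at this
    simp only [List.nil_append, List.append_nil] at this
    simp only [inOrder_not] at hcode ⊢
    exact this hcode
  cases s₁
  · exact key h
  · exact reverse (key (reverse (by simpa using h)))

theorem flip_c (h : TriangleInvariance β ka kb kc.inv α β' (!γ) s₁ (!s₂) (!s₃)) :
    TriangleInvariance β ka kb kc α β' γ s₁ s₂ s₃ := by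
  -- On strand 3 the crossing `c` is the second argument of `inOrder`; stating the claim for `!s₃`
  -- lets `inOrder_not` put it first.
  have key : ∀ {s₁ s₃}, TriangleInvariance β ka kb kc.inv α β' (!γ) s₁ true s₃ →
      TriangleInvariance β ka kb kc α β' γ s₁ false (!s₃) := by
    intro s₁ s₃ h t u v w a b c ha hb hc hW
    obtain ⟨e, f, he, hf, hef, hWe, hWf⟩ :=
      exists_fresh (triangleWord t u v w a b c α β' γ s₁ false (!s₃)) kc.inv kc
    simp only [triangleWord, inOrder_not, Bool.not_not] at hW hWe hWf ⊢
    rw [← inOrder_not s₃ (c, !γ)]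
    refine (context₂₃ β t u v w).flip (he.trans (by rw [hc])) (hf.trans hc.symm) hef hWe hWf
      ((inOrder_perm s₁ _ _).trans ((List.Perm.swap _ _ _).trans (inOrder_perm s₁ _ _).symm)) hW
      fun hcode => ?_
    have := h (t ++ []) ([] ++ u ++ [(c, γ)])
      ([(f, γ)] ++ v ++ if s₃ then [(c, !γ)] else [(f, !γ)])
      ((if s₃ then [(f, !γ)] else [(c, !γ)]) ++ w) a b e ha hb he
    simp only [triangleWord, threeStrands_append, inOrder_not, Bool.not_not] at this
    simp only [List.nil_append, List.append_nil] at this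
    simp only [inOrder_not] at hcode ⊢
    exact this hcode
  cases s₂
  · have := key (s₁ := s₁) (s₃ := !s₃) h
    simpa using this
  · refine reverse ?_
    exact key (reverse (by simpa using h))

end TriangleInvariance

end ThirdMove

/-! ### Reduction of all third moves to the standard one -/

section ThirdMoveBase

variable {X R : Type*} [Biquandle X] [CommRing R] {β : VirtualBracket X R}

theorem swapInOrder_append (s : Bool) {P P' Q Q' : List Passage} {x y : Passage}
    (h : (P ++ inOrder s x y ++ Q).Nodup) (h' : (P' ++ inOrder (!s) x y ++ Q').Nodup)
    (hl : P'.length = P.length) :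
    SwapInOrder s (P ++ inOrder s x y ++ Q) (P' ++ inOrder (!s) x y ++ Q') x y := by
  cases s
  · exact ⟨swapAt_append h h' hl, swapAt_append h' h hl.symm⟩
  · exact ⟨swapAt_append h h' hl, swapAt_append h' h hl.symm⟩

theorem idxOf_inOrder (s : Bool) {P Q : List Passage} {x y p : Passage} (hx : p ≠ x)
    (hy : p ≠ y) :
    (P ++ inOrder s x y ++ Q).idxOf p = (P ++ inOrder (!s) x y ++ Q).idxOf p := by
  cases s
  · exact idxOf_swap_pair hy hx
  · exact idxOf_swap_pair hx hy

theorem inOrder_length (s : Bool) (p q : Passage) : (inOrder s p q).length = 2 := by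
  cases s <;> rfl

theorem threeStrands_eq₁ (t u v w x y z : List Passage) :
    threeStrands t u v w x y z = t ++ x ++ (u ++ y ++ v ++ z ++ w) := by
  simp [threeStrands]

theorem threeStrands_eq₂ (t u v w x y z : List Passage) :
    threeStrands t u v w x y z = t ++ x ++ u ++ y ++ (v ++ z ++ w) := by
  simp [threeStrands]

theorem wordEquiv_triangleWord {t u v w : List Passage} {a b c : Crossing}
    {α β' γ s₁ s₂ s₃ : Bool} (hW : IsCode (triangleWord t u v w a b c α β' γ s₁ s₂ s₃))
    (hk : TriangleKinds a.kind b.kind c.kind)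
    (face₁ : (α == (s₁ == s₂)) = (β' == (s₁ == s₃)))
    (face₂ : (β' == (s₁ == s₃)) = (γ == (s₂ == s₃)))
    (hacyclic : (α = true ∧ β' = true) ∨ (α = false ∧ γ = true) ∨ (β' = false ∧ γ = false)) :
    WordEquiv β (triangleWord t u v w a b c α β' γ s₁ s₂ s₃)
      (triangleWord t u v w a b c α β' γ (!s₁) (!s₂) (!s₃)) := by
  have hp := triangleWord_perm t u v w a b c α β' γ s₁ s₂ s₃
  have hnd := hW.1
  have hnd' := (hW.perm hp).1
  have hsub : ([(a, α), (b, β'), (a, !α), (c, γ), (b, !β'), (c, !γ)] ++ (t ++ u ++ v ++ w)).Perm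
      (triangleWord t u v w a b c α β' γ s₁ s₂ s₃) := by
    refine ((threeStrands_perm _ _ _ _ _ _ _).trans ?_).symm
    exact (((inOrder_perm _ _ _).append (inOrder_perm _ _ _)).append
      (inOrder_perm _ _ _)).append_right _
  have hnd₆ := (List.nodup_append.1 (hsub.nodup_iff.2 hnd)).1
  have hmem : ∀ {x : Crossing} {b' : Bool},
      (x, b') ∈ triangleWord t u v w a b c α β' γ s₁ s₂ s₃ →
      x ∈ crossings (triangleWord t u v w a b c α β' γ s₁ s₂ s₃) := fun {x b'} hx => by
    refine mem_crossings.2 ?_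
    cases b'
    · exact hW.2 _ _ hx
    · exact hx
  have hab : a ≠ b := by rintro rfl; revert hnd₆; cases α <;> cases β' <;> simp
  have hac : a ≠ c := by rintro rfl; revert hnd₆; cases α <;> cases γ <;> simp
  have hbc : b ≠ c := by rintro rfl; revert hnd₆; cases β' <;> cases γ <;> simp
  refine wordEquiv_of_swapInOrder hW hp (hmem (b' := α) (hsub.subset (by simp)))
    (hmem (b' := β') (hsub.subset (by simp))) (hmem (b' := γ) (hsub.subset (by simp)))
    hab hac hbc (s₁ := s₁) (s₂ := s₂) (s₃ := s₃) (α := α) (β' := β') (γ := γ) ?_ ?_ ?_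
    (fun e ha hb hc b' => ?_) hk face₁ face₂ hacyclic
  · simp only [triangleWord, threeStrands_eq₁] at hnd hnd' ⊢
    exact swapInOrder_append s₁ hnd hnd' rfl
  · simp only [triangleWord, threeStrands_eq₂] at hnd hnd' ⊢
    exact swapInOrder_append s₂ hnd hnd' (by simp [inOrder_length])
  · exact swapInOrder_append s₃ hnd hnd' (by simp [inOrder_length])
  · have h : ∀ {x : Crossing} {b' b'' : Bool}, e ≠ x → (e, b') ≠ (x, b'') := fun hx h' =>
      hx (congrArg Prod.fst h')
    rw [triangleWord, triangleWord, threeStrands, idxOf_inOrder s₃ (h hb) (h hc)]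
    change (threeStrands t u v w _ _ _).idxOf _ = _
    rw [threeStrands_eq₂, idxOf_inOrder s₂ (h ha) (h hc), ← threeStrands_eq₂, threeStrands_eq₁,
      idxOf_inOrder s₁ (h ha) (h hb), threeStrands_eq₁]

theorem triangleInvariance_of_acyclic {ka kb kc : CrossingKind} {α β' γ s₁ s₂ s₃ : Bool}
    (hk : TriangleKinds ka kb kc)
    (face₁ : (α == (s₁ == s₂)) = (β' == (s₁ == s₃)))
    (face₂ : (β' == (s₁ == s₃)) = (γ == (s₂ == s₃)))
    (hacyclic : (α = true ∧ β' = true) ∨ (α = false ∧ γ = true) ∨ (β' = false ∧ γ = false)) :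
    TriangleInvariance β ka kb kc α β' γ s₁ s₂ s₃ := by
  rintro t u v w a b c rfl rfl rfl hW
  exact wordEquiv_triangleWord hW hk face₁ face₂ hacyclic

/-- A virtual crossing is its own inverse, so a flip there only exchanges `true` and `false`. If the
strands are ordered cyclically, one such exchange makes the order linear. -/
theorem triangleInvariance_of_virt {ka kb kc : CrossingKind} {α β' γ s₁ s₂ s₃ : Bool}
    (hk : (ka = .virt ∧ kb = .virt) ∨ (ka = .virt ∧ kc = .virt) ∨ (kb = .virt ∧ kc = .virt))
    (face₁ : (α == (s₁ == s₂)) = (β' == (s₁ == s₃)))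
    (face₂ : (β' == (s₁ == s₃)) = (γ == (s₂ == s₃))) :
    TriangleInvariance β ka kb kc α β' γ s₁ s₂ s₃ := by
  by_cases hacyclic : (α = true ∧ β' = true) ∨ (α = false ∧ γ = true) ∨ (β' = false ∧ γ = false)
  · exact triangleInvariance_of_acyclic (.inr hk) face₁ face₂ hacyclic
  · by_cases ha : ka = .virt
    · subst ha
      refine TriangleInvariance.flip_a (triangleInvariance_of_acyclic (.inr hk) ?_ ?_ ?_)
      all_goals revert face₁ face₂ hacyclic; revert α β' γ s₁ s₂ s₃; decide
    · obtain ⟨rfl, rfl⟩ := (hk.resolve_left fun h => ha h.1).resolve_left fun h => ha h.1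
      refine TriangleInvariance.flip_b (triangleInvariance_of_acyclic (.inr (.inr (.inr
        ⟨rfl, rfl⟩))) ?_ ?_ ?_)
      all_goals revert face₁ face₂ hacyclic; revert α β' γ s₁ s₂ s₃; decide

/-- The passage `b` at a crossing of kind `k` goes over. -/
def CrossingKind.Over (k : CrossingKind) (b : Bool) : Prop :=
  (k = .pos ∧ b = true) ∨ (k = .neg ∧ b = false)

/-- Flipping every negative crossing makes all crossings positive without changing what lies over
what. Now `true` means over, and the strand on top supplies the acyclicity condition. -/
theorem triangleInvariance_of_classical {ka kb kc : CrossingKind} {α β' γ s₁ s₂ s₃ : Bool}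
    (ha : ka ≠ .virt) (hb : kb ≠ .virt) (hc : kc ≠ .virt)
    (h : (ka.Over α ∧ kb.Over β') ∨ (ka.Over (!α) ∧ kc.Over γ) ∨ (kb.Over (!β') ∧ kc.Over (!γ)))
    (face₁ : (α == (s₁ == s₂)) = (β' == (s₁ == s₃)))
    (face₂ : (β' == (s₁ == s₃)) = (γ == (s₂ == s₃))) :
    TriangleInvariance β ka kb kc α β' γ s₁ s₂ s₃ := by
  have key : ∀ {α β' γ s₁ s₂ s₃ : Bool},
      (α = true ∧ β' = true) ∨ (α = false ∧ γ = true) ∨ (β' = false ∧ γ = false) →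
      (α == (s₁ == s₂)) = (β' == (s₁ == s₃)) → (β' == (s₁ == s₃)) = (γ == (s₂ == s₃)) →
      TriangleInvariance β .pos .pos .pos α β' γ s₁ s₂ s₃ := fun h face₁ face₂ =>
    triangleInvariance_of_acyclic (.inl ⟨rfl, rfl, rfl⟩) face₁ face₂ h
  simp only [CrossingKind.Over] at h
  cases ka <;> cases kb <;> cases kc <;> first | contradiction | skip
  all_goals simp only [reduceCtorEq, true_and, false_and, or_false, false_or] at h
  -- The goals are handled from the last one backwards because each reduction leaves three goals in
  -- place of one.
  on_goal 8 => refine .flip_a (.flip_b (.flip_c (key ?_ ?_ ?_)))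
  on_goal 7 => refine .flip_a (.flip_b (key ?_ ?_ ?_))
  on_goal 6 => refine .flip_a (.flip_c (key ?_ ?_ ?_))
  on_goal 5 => refine .flip_a (key ?_ ?_ ?_)
  on_goal 4 => refine .flip_b (.flip_c (key ?_ ?_ ?_))
  on_goal 3 => refine .flip_b (key ?_ ?_ ?_)
  on_goal 2 => refine .flip_c (key ?_ ?_ ?_)
  on_goal 1 => refine key ?_ ?_ ?_
  all_goals first
    | clear face₁ face₂; revert h; revert α β' γ; decide
    | clear h; revert face₁ face₂; revert α β' γ s₁ s₂ s₃; decide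

theorem wordEquiv_of_step [Finite X] {w w' : List Passage} (h : ReidemeisterStep w w')
    (hw : IsCode w) : WordEquiv β w w' := by
  induction h with
  | rename ρ hρ hk w => exact wordEquiv_rename w hρ hk
  | r1 u v c b => exact wordEquiv_kink hw
  | r2 u v w c d b s h =>
    refine wordEquiv_bigon ?_ hw
    rcases h with ⟨h, h'⟩ | ⟨h, h'⟩ | ⟨h, h'⟩ <;> rw [h, h'] <;> rfl
  | r3 t u v w a b c α β' γ s₁ s₂ s₃ face₁ face₂ h =>
    rcases h with ⟨ha, hb, hc, h⟩ | h
    · exact triangleInvariance_of_classical ha hb hc h face₁ face₂ t u v w a b c rfl rfl rfl hw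
    · exact triangleInvariance_of_virt h face₁ face₂ t u v w a b c rfl rfl rfl hw

end ThirdMoveBase

/-! ### Brackets of codes as state sums -/

section StateExpansion

open KnotoidCode

section Smoothed

variable {R : Type*}

/-- The coefficient of a smoothing. -/
def Weights.at (wt : Weights R) : Smoothing → R
  | .oriented => wt.a
  | .unoriented => wt.b
  | .virt => wt.v

/-- The arcs that a smoothing of the chord joins are related. -/
def Chord.JoinedBy (c : Chord R) (s : Setoid ℕ) : Smoothing → Prop
  | .oriented => s c.tI c.fO ∧ s c.fI c.tO
  | .unoriented => s c.tI c.fI ∧ s c.tO c.fO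
  | .virt => s c.tI c.tO ∧ s c.fI c.fO

/-- The relation generated by `r` and by smoothings of a family of chords. -/
def smoothed {ι : Type*} (r : Setoid ℕ) (g : ι → Chord R) (S : ι → Smoothing) : Setoid ℕ :=
  sInf {s | r ≤ s ∧ ∀ i, (g i).JoinedBy s (S i)}

theorem Chord.JoinedBy.mono {c : Chord R} {s s' : Setoid ℕ} {σ : Smoothing} (h : c.JoinedBy s σ)
    (hs : s ≤ s') : c.JoinedBy s' σ := by
  cases σ <;> exact ⟨hs h.1, hs h.2⟩

/-- The universal property, as for `glue`: it identifies relations generated recursively, chord by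
chord, with relations generated all at once. -/
theorem smoothed_le_iff {ι : Type*} {r s : Setoid ℕ} {g : ι → Chord R} {S : ι → Smoothing} :
    smoothed r g S ≤ s ↔ r ≤ s ∧ ∀ i, (g i).JoinedBy s (S i) := by
  constructor
  · intro h
    refine ⟨(le_sInf fun _ h => h.1).trans h, fun i => Chord.JoinedBy.mono ?_ h⟩
    have : ∀ {x y : ℕ}, (∀ s', r ≤ s' ∧ (∀ i, (g i).JoinedBy s' (S i)) → s' x y) →
        smoothed r g S x y := fun h => h
    have hi : ∀ s', r ≤ s' ∧ (∀ i, (g i).JoinedBy s' (S i)) → (g i).JoinedBy s' (S i) :=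
      fun s' h => h.2 i
    revert hi
    cases S i <;> exact fun hi => ⟨this fun s' h => (hi s' h).1, this fun s' h => (hi s' h).2⟩
  · exact fun h => sInf_le h

theorem smoothed_fin_zero (r : Setoid ℕ) (g : Fin 0 → Chord R) (S : Fin 0 → Smoothing) :
    smoothed r g S = r :=
  eq_of_forall_ge_iff fun s => by simp [smoothed_le_iff]

theorem smoothed_cons {n : ℕ} (r : Setoid ℕ) (g : Fin (n + 1) → Chord R) (σ : Smoothing)
    (S : Fin n → Smoothing) : smoothed r g (Fin.cons σ S : Fin (n + 1) → Smoothing) =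
      smoothed (match σ with
        | .oriented => glue (glue r (g 0).tI (g 0).fO) (g 0).fI (g 0).tO
        | .unoriented => glue (glue r (g 0).tI (g 0).fI) (g 0).tO (g 0).fO
        | .virt => glue (glue r (g 0).tI (g 0).tO) (g 0).fI (g 0).fO) (Fin.tail g) S :=
  eq_of_forall_ge_iff fun s => by
    simp only [smoothed_le_iff, Fin.forall_fin_succ, Fin.cons_zero, Fin.cons_succ, Fin.tail]
    cases σ <;> simp only [Chord.JoinedBy, glue_le_iff] <;> tauto

end Smoothed

variable {R : Type*} [CommRing R] (δ : R)

theorem stateSum_ofFn {n : ℕ} (g : Fin n → Chord R) (r : Setoid ℕ) :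
    stateSum δ (List.ofFn g) r =
      ∑ S : Fin n → Smoothing, (∏ i, (g i).wt.at (S i)) * δ ^ classCount (smoothed r g S) := by
  induction n generalizing r with
  | zero => simp [stateSum, smoothed_fin_zero]
  | succ n ih =>
    have h3 : ∀ F : Smoothing → R, ∑ σ, F σ = F .oriented + F .unoriented + F .virt := fun F => by
      change ∑ σ ∈ {Smoothing.oriented, Smoothing.unoriented, Smoothing.virt}, F σ = _
      rw [Finset.sum_insert (by simp), Finset.sum_insert (by simp), Finset.sum_singleton,
        add_assoc]
    have hc : ∀ σ (S : Fin n → Smoothing),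
        (∏ i, (g i).wt.at (Fin.consEquiv (fun _ => Smoothing) (σ, S) i)) *
          δ ^ classCount (smoothed r g (Fin.consEquiv (fun _ => Smoothing) (σ, S))) =
        (g 0).wt.at σ * ((∏ i, (Fin.tail g i).wt.at (S i)) * δ ^ classCount (smoothed r g
          (Fin.cons σ S : Fin (n + 1) → Smoothing))) := fun σ S => by
      rw [Fin.prod_univ_succ, mul_assoc]
      rfl
    rw [List.ofFn_succ, stateSum, ih, ih, ih,
      ← (Fin.consEquiv fun _ : Fin (n + 1) => Smoothing).sum_comp, Fintype.sum_prod_type, h3]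
    simp only [hc, smoothed_cons, ← Finset.mul_sum]
    rfl

theorem stateSum_ofFn_equiv {ι : Type*} [Fintype ι] {n : ℕ} (e : Fin n ≃ ι) (g : ι → Chord R)
    (r : Setoid ℕ) [Fintype (ι → Smoothing)] :
    stateSum δ (List.ofFn fun i => g (e i)) r =
      ∑ S : ι → Smoothing, (∏ i, (g i).wt.at (S i)) * δ ^ classCount (smoothed r g S) := by
  rw [stateSum_ofFn, ← (Equiv.arrowCongr e (Equiv.refl Smoothing)).sum_comp]
  refine Finset.sum_congr rfl fun S _ => ?_
  rw [← e.prod_comp]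
  congr 2
  · simp
  · refine congrArg _ (eq_of_forall_ge_iff fun s => ?_)
    rw [smoothed_le_iff, smoothed_le_iff, ← e.forall_congr_right]
    simp

/-- Virtual crossings can be removed at the price of joining arcs. -/
theorem exists_stateSum_virtual_append (V : List (Chord R)) (hV : ∀ c ∈ V, c.wt = .virtual R)
    (r : Setoid ℕ) : ∃ r' : Setoid ℕ,
      (∀ s, r' ≤ s ↔ r ≤ s ∧ ∀ c ∈ V, s c.tI c.tO ∧ s c.fI c.fO) ∧
      ∀ l, stateSum δ (V ++ l) r = stateSum δ l r' := by
  induction V generalizing r with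
  | nil => exact ⟨r, by simp, fun _ => rfl⟩
  | cons c V ih =>
    obtain ⟨r', h, h'⟩ := ih (fun c hc => hV c (List.mem_cons_of_mem _ hc))
      (glue (glue r c.tI c.tO) c.fI c.fO)
    refine ⟨r', fun s => ?_, fun l => ?_⟩
    · rw [h, glue_le_iff, glue_le_iff, List.forall_mem_cons, and_assoc, and_assoc, and_assoc]
    · rw [← h', ← stateSum_virtual, ← hV c List.mem_cons_self]
      rfl

end StateExpansion

/-! ### Writhe, components, colorings and bracket of a code in terms of its sites -/

namespace KnotoidCode

variable {X R : Type*}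

theorem isCode (D : KnotoidCode) : IsCode D.word := ⟨D.nodup, D.paired⟩

/-- The labels of the arcs, as a function on all numbers. -/
def extend {D : KnotoidCode} (f : D.Arc → X) (i : ℕ) : X := f ⟨min i D.word.length, by omega⟩

theorem extend_inArc {D : KnotoidCode} (f : D.Arc → X) (c : D.Cr) (b : Bool) :
    extend f (D.word.idxOf (c.1, b)) = f (c.inArc b) :=
  congrArg f (Fin.ext (min_eq_left (Nat.lt_succ_iff.1 (c.inArc b).2)))

theorem extend_outArc {D : KnotoidCode} (f : D.Arc → X) (c : D.Cr) (b : Bool) :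
    extend f (D.word.idxOf (c.1, b) + 1) = f (c.outArc b) :=
  congrArg f (Fin.ext (min_eq_left (Nat.lt_succ_iff.1 (c.outArc b).2)))

theorem forall_mem_sites {D : KnotoidCode} {p : Site → Prop} :
    (∀ s ∈ sites D.word, p s) ↔ ∀ c : D.Cr, p (siteOf D.word c.1) := by
  simp only [sites, List.forall_mem_map, mem_crossings]
  exact ⟨fun h c => h c.1 c.2, fun h c hc => h ⟨c, hc⟩⟩

theorem writhe_eq (D : KnotoidCode) : D.writhe = signSum (sites D.word) := by
  obtain ⟨val, hval⟩ : ∃ val : D.Cr → Crossing, ∀ c, val c = c.1 := ⟨_, fun _ => rfl⟩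
  have hp : ((Finset.univ : Finset D.Cr).toList.map val).Perm (crossings D.word) := by
    have hinj : Function.Injective val := fun c d h =>
      Subtype.ext ((hval c).symm.trans (h.trans (hval d)))
    rw [List.perm_ext_iff_of_nodup ((Finset.nodup_toList _).map hinj) (crossings_nodup D.nodup)]
    intro c
    rw [mem_crossings, List.mem_map]
    exact ⟨fun ⟨d, _, h⟩ => h ▸ hval d ▸ d.2, fun h =>
      ⟨⟨c, h⟩, Finset.mem_toList.2 (Finset.mem_univ _), hval _⟩⟩
  rw [signSum, sites, List.map_map]
  change _ = ((crossings D.word).map fun c => c.kind.sign).sum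
  rw [← (hp.map _).sum_eq, List.map_map, Function.comp_def, Finset.sum_map_toList]
  refine Finset.sum_congr rfl fun c _ => ?_
  rw [hval]
  change _ = c.kind.sign
  cases c.kind <;> rfl

/-- Both sides count classes of relations generated by the same pairs of arcs; `capRel` accounts for
the passage from `Fin` to `ℕ`. The smoothed relation is shown to be the kernel of the surjection
from numbers to components. -/
theorem componentCount_eq {D : KnotoidCode} {S : D.State} {r : Setoid ℕ}
    {g : D.ClassicalCr → Chord R}
    (hr : ∀ s, r ≤ s ↔ capRel D.word.length ≤ s ∧ ∀ c : D.Cr, c.kind = .virt →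
      ∀ b, s (D.word.idxOf (c.1, b)) (D.word.idxOf (c.1, b) + 1))
    (hg : ∀ c, (g c).tI = D.word.idxOf (c.1.1, true) ∧ (g c).tO = D.word.idxOf (c.1.1, true) + 1 ∧
      (g c).fI = D.word.idxOf (c.1.1, false) ∧ (g c).fO = D.word.idxOf (c.1.1, false) + 1) :
    D.componentCount S = classCount (smoothed r g S) := by
  have hR : ∀ {x y : ℕ}, capRel D.word.length x y → smoothed r g S x y := fun h =>
    ((hr r).1 le_rfl).1.trans (smoothed_le_iff.1 le_rfl).1 h
  have hclass := (smoothed_le_iff (r := r) (g := g) (S := S)).1 le_rfl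
  have hvirt := ((hr _).1 hclass.1).2
  let φ : ℕ → Quot (D.Joined S) := extend (D := D) (Quot.mk (D.Joined S))
  have hin : ∀ (c : D.Cr) b, φ (D.word.idxOf (c.1, b)) = Quot.mk _ (c.inArc b) := fun c b =>
    extend_inArc _ c b
  have hout : ∀ (c : D.Cr) b, φ (D.word.idxOf (c.1, b) + 1) = Quot.mk _ (c.outArc b) :=
    fun c b => extend_outArc _ c b
  have hker : smoothed r g S = Setoid.ker φ := by
    refine le_antisymm (smoothed_le_iff.2 ⟨(hr _).2 ⟨fun x y h => ?_, fun c hc b => ?_⟩,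
      fun c => ?_⟩) fun x y h => ?_
    · exact congrArg (Quot.mk (D.Joined S)) (Fin.ext h)
    · change φ _ = φ _
      rw [hin, hout]
      exact Quot.sound (.virt_crossing c b hc)
    · obtain ⟨h₁, h₂, h₃, h₄⟩ := hg c
      have o := Joined.oriented (S := S) c
      have u := Joined.unoriented_in (S := S) c
      have u' := Joined.unoriented_out (S := S) c
      have v := Joined.virt (S := S) c
      generalize S c = σ at *
      cases σ <;> simp only [Chord.JoinedBy, h₁, h₂, h₃, h₄, Setoid.ker_def, hin, hout]
      · exact ⟨Quot.sound (o true rfl), Quot.sound (o false rfl)⟩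
      · exact ⟨Quot.sound (u rfl), Quot.sound (u' rfl)⟩
      · exact ⟨Quot.sound (v true rfl), Quot.sound (v false rfl)⟩
    -- Components map back to classes because each generator of `Joined` holds in the smoothed
    -- relation; this gives the inclusion of the kernel.
    · let ψ : Quot (D.Joined S) → Quotient (smoothed r g S) :=
        Quot.lift (fun a => Quotient.mk _ a.1) fun a a' h => Quotient.sound (by
          cases h with
          | virt_crossing c b h => exact hvirt c h b
          | virt c b h =>
            obtain ⟨h₁, h₂, h₃, h₄⟩ := hg c
            have := hclass.2 c
            rw [h, Chord.JoinedBy, h₁, h₂, h₃, h₄] at this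
            cases b
            exacts [this.2, this.1]
          | oriented c b h =>
            obtain ⟨h₁, h₂, h₃, h₄⟩ := hg c
            have := hclass.2 c
            rw [h, Chord.JoinedBy, h₁, h₂, h₃, h₄] at this
            cases b
            exacts [this.2, this.1]
          | unoriented_in c h =>
            obtain ⟨h₁, h₂, h₃, h₄⟩ := hg c
            have := hclass.2 c
            rw [h, Chord.JoinedBy, h₁, h₂, h₃, h₄] at this
            exact this.1
          | unoriented_out c h =>
            obtain ⟨h₁, h₂, h₃, h₄⟩ := hg c
            have := hclass.2 c
            rw [h, Chord.JoinedBy, h₁, h₂, h₃, h₄] at this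
            exact this.2)
      have hmin : ∀ x, smoothed r g S x (min x D.word.length) := fun x => hR (by
        rw [capRel_iff]; omega)
      have := Quotient.exact (congrArg ψ h)
      exact Setoid.trans' _ (hmin x) (Setoid.trans' _ this (Setoid.symm' _ (hmin y)))
  rw [hker, componentCount, classCount]
  refine (Nat.card_congr (Setoid.quotientKerEquivOfSurjective φ fun q => ?_)).symm
  induction q using Quot.inductionOn with | _ a
  refine ⟨a.1, congrArg (Quot.mk (D.Joined S)) (Fin.ext ?_)⟩
  change min a.1 _ = a.1
  omega

variable [Biquandle X] [CommRing R]

theorem isColoring_iff {D : KnotoidCode} {f : D.Arc → X} :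
    D.IsColoring f ↔ ∀ s ∈ sites D.word, s.Fits (extend f) := by
  rw [forall_mem_sites]
  refine forall_congr' fun c => ?_
  simp only [Site.Fits, siteOf, extend_inArc, extend_outArc, KnotoidCode.Cr.kind]
  cases c.1.kind <;> simp only [Fit, Bool.forall_bool]
  exact and_comm

variable (X) in
/-- Colorings of a code as colorings of its list of crossings. -/
def coloringEquiv (D : KnotoidCode) :
    D.Coloring X ≃ Labelling X D.word.length (sites D.word) where
  toFun f := ⟨extend f.1, fun i => congrArg f.1 (Fin.ext (by simp)), isColoring_iff.1 f.2⟩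
  invFun g := ⟨fun a => g.1 a.1, isColoring_iff.2 (by
    have : extend (D := D) (fun a => g.1 a.1) = g.1 := funext fun i => (g.2.1 i).symm
    rw [this]
    exact g.2.2)⟩
  left_inv f := Subtype.ext (funext fun a => congrArg f.1 (Fin.ext (by
    change min a.1 _ = a.1
    omega)))
  right_inv g := Subtype.ext (funext fun i => (g.2.1 i).symm)

theorem coefficient_eq (β : VirtualBracket X R) {D : KnotoidCode} (f : D.Arc → X) {c : D.Cr}
    (hc : c.kind ≠ .virt) (σ : Smoothing) : coefficient β f c σ =
      (β.weights c.kind (f (c.outArc true)) (f (c.inArc false))).at σ := by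
  unfold coefficient
  revert hc
  generalize c.kind = k
  cases k <;> intro hc <;> first | exact absurd rfl hc | cases σ <;> rfl

theorem bracket_eq (β : VirtualBracket X R) (D : KnotoidCode) (f : D.Arc → X) :
    D.bracket β f = siteBracket β D.word.length (sites D.word) (extend f) := by
  let e := (Fintype.equivFin D.ClassicalCr).symm
  let g : D.ClassicalCr → Chord R := fun c => (siteOf D.word c.1.1).chord β (extend f)
  -- The state sum of sites also runs through the virtual crossings, while states smooth only the
  -- classical ones. The virtual crossings are put in front and absorbed into the relation `r`.
  have hperm : ((crossings D.word).filter (·.kind = .virt) ++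
      List.ofFn fun i => (e i).1.1).Perm (crossings D.word) := by
    rw [List.perm_ext_iff_of_nodup _ (crossings_nodup D.nodup)]
    · intro c
      simp only [List.mem_append, List.mem_filter, List.mem_ofFn, decide_eq_true_eq]
      constructor
      · rintro (h | ⟨i, rfl⟩)
        · exact h.1
        · exact mem_crossings.2 (e i).1.2
      · intro h
        by_cases hc : c.kind = .virt
        · exact .inl ⟨h, hc⟩
        · exact .inr ⟨e.symm ⟨⟨c, mem_crossings.1 h⟩, hc⟩, by simp⟩
    · refine List.nodup_append.2 ⟨(crossings_nodup D.nodup).filter _, List.nodup_ofFn.2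
        (Subtype.val_injective.comp (Subtype.val_injective.comp e.injective)), ?_⟩
      rintro c hc _ hd rfl
      obtain ⟨i, rfl⟩ := List.mem_ofFn.1 hd
      exact (e i).2 (of_decide_eq_true (List.mem_filter.1 hc).2)
  obtain ⟨r, hr, hsum⟩ := exists_stateSum_virtual_append β.δ
    (((crossings D.word).filter (·.kind = .virt)).map fun c =>
      (siteOf D.word c).chord β (extend f)) (by
        intro c hc
        obtain ⟨d, hd, rfl⟩ := List.mem_map.1 hc
        have : d.kind = .virt := of_decide_eq_true (List.mem_filter.1 hd).2
        simp only [Site.chord, siteOf, this, VirtualBracket.weights]) (capRel D.word.length)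
  have key : stateSum β.δ ((sites D.word).map (Site.chord β (extend f))) (capRel D.word.length) =
      stateSum β.δ (List.ofFn fun i => g (e i)) r := by
    rw [← hsum, sites, List.map_map]
    refine stateSum_perm _ ?_ _
    have := hperm.symm.map (Site.chord β (extend f) ∘ siteOf D.word)
    rwa [List.map_append, List.map_ofFn] at this
  rw [siteBracket, key, stateSum_ofFn_equiv, bracket, Finset.sum_mul]
  refine Finset.sum_congr rfl fun S _ => ?_
  rw [stateValue, writhe_eq, componentCount_eq (r := r) (g := g) _ fun c => ⟨rfl, rfl, rfl, rfl⟩]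
  · congr 2
    refine Finset.prod_congr rfl fun c _ => ?_
    simp only [g, Site.chord, siteOf, extend_inArc, extend_outArc]
    exact coefficient_eq β f c.2 (S c)
  · intro s
    rw [hr, List.forall_mem_map]
    refine and_congr_right fun _ => ⟨fun h c hc b => ?_, fun h c hc => ?_⟩
    · have := h c.1 (List.mem_filter.2 ⟨mem_crossings.2 c.2, decide_eq_true hc⟩)
      cases b
      exacts [this.2, this.1]
    · have h' := List.mem_filter.1 hc
      have := h ⟨c, mem_crossings.1 h'.1⟩ (of_decide_eq_true h'.2)
      exact ⟨this true, this false⟩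

/-! ### Colorings and the fundamental biquandle -/

section FundamentalBiquandle

open FundamentalBiquandle

variable {X : Type*} [Biquandle X] {D : KnotoidCode}

/-- The value of a term at a labelling of the generators. -/
noncomputable def BTerm.eval {α : Type} (f : α → X) : BTerm α → X
  | gen a => f a
  | un s t => s.eval f ▷ᵤ t.eval f
  | ov s t => s.eval f ▷ₒ t.eval f
  | underInv s t => (Equiv.ofBijective _ (Biquandle.under_bijective (t.eval f))).symm (s.eval f)
  | overInv s t => (Equiv.ofBijective _ (Biquandle.over_bijective (t.eval f))).symm (s.eval f)
  | switchInv₁ s t =>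
    ((Equiv.ofBijective _ (Biquandle.switch_bijective (X := X))).symm (s.eval f, t.eval f)).1
  | switchInv₂ s t =>
    ((Equiv.ofBijective _ (Biquandle.switch_bijective (X := X))).symm (s.eval f, t.eval f)).2

/-- Soundness of the presentation: the formal inverses in terms are evaluated by the actual inverses
that the bijectivity axioms provide in `X`. -/
theorem BRel.eval_eq {f : D.Arc → X} (hf : D.IsColoring f) {s t : BTerm D.Arc} (h : BRel D s t) :
    s.eval f = t.eval f := by
  have switch : ∀ x y : X, ((Equiv.ofBijective _ (Biquandle.switch_bijective (X := X))).symm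
      (y ▷ₒ x, x ▷ᵤ y)) = (x, y) := fun x y =>
    (Equiv.ofBijective _ (Biquandle.switch_bijective (X := X))).symm_apply_apply (x, y)
  have switch' : ∀ x y : X, (fun p : X × X => (p.2 ▷ₒ p.1, p.1 ▷ᵤ p.2))
      ((Equiv.ofBijective _ (Biquandle.switch_bijective (X := X))).symm (x, y)) = (x, y) :=
    fun x y => (Equiv.ofBijective _ (Biquandle.switch_bijective (X := X))).apply_symm_apply (x, y)
  induction h with
  | refl s => rfl
  | symm _ ih => exact ih.symm
  | trans _ _ ih ih' => exact ih.trans ih'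
  | congr_under _ _ ih ih' => simp only [BTerm.eval, ih, ih']
  | congr_over _ _ ih ih' => simp only [BTerm.eval, ih, ih']
  | congr_underInv _ _ ih ih' => simp only [BTerm.eval, ih, ih']
  | congr_overInv _ _ ih ih' => simp only [BTerm.eval, ih, ih']
  | congr_switchInv₁ _ _ ih ih' => simp only [BTerm.eval, ih, ih']
  | congr_switchInv₂ _ _ ih ih' => simp only [BTerm.eval, ih, ih']
  | under_self s => exact Biquandle.under_self _
  | under_underInv s t => exact (Equiv.ofBijective _
      (Biquandle.under_bijective (t.eval f))).apply_symm_apply (s.eval f)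
  | underInv_under s t => exact (Equiv.ofBijective _
      (Biquandle.under_bijective (t.eval f))).symm_apply_apply (s.eval f)
  | over_overInv s t => exact (Equiv.ofBijective _
      (Biquandle.over_bijective (t.eval f))).apply_symm_apply (s.eval f)
  | overInv_over s t => exact (Equiv.ofBijective _
      (Biquandle.over_bijective (t.eval f))).symm_apply_apply (s.eval f)
  | switch_inv₁ s t => exact congrArg Prod.fst (switch' (s.eval f) (t.eval f))
  | switch_inv₂ s t => exact congrArg Prod.snd (switch' (s.eval f) (t.eval f))
  | inv_switch₁ s t => exact congrArg Prod.fst (switch (s.eval f) (t.eval f))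
  | inv_switch₂ s t => exact congrArg Prod.snd (switch (s.eval f) (t.eval f))
  | exchange_under x y z => exact Biquandle.exchange_under _ _ _
  | exchange_mixed x y z => exact Biquandle.exchange_mixed _ _ _
  | exchange_over x y z => exact Biquandle.exchange_over _ _ _
  | pos_under c hc =>
    have := hf c
    rw [hc] at this
    exact this.1
  | pos_over c hc =>
    have := hf c
    rw [hc] at this
    exact this.2
  | neg_under c hc =>
    have := hf c
    rw [hc] at this
    exact this.1
  | neg_over c hc =>
    have := hf c
    rw [hc] at this
    exact this.2
  | virt c b hc =>
    have := hf c
    rw [hc] at this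
    exact this b

/-- The homomorphism that extends a coloring. -/
noncomputable def Coloring.lift (f : D.Coloring X) : BiquandleHom D.FundamentalBiquandle X where
  toFun := Quotient.lift (BTerm.eval f.1) fun _ _ h => BRel.eval_eq f.2 h
  map_under x y := by
    induction x using FundamentalBiquandle.ind with | _ s => ?_
    induction y using FundamentalBiquandle.ind with | _ t => ?_
    rfl
  map_over x y := by
    induction x using FundamentalBiquandle.ind with | _ s => ?_
    induction y using FundamentalBiquandle.ind with | _ t => ?_
    rfl

theorem isColoring_hom (φ : BiquandleHom D.FundamentalBiquandle X) :
    D.IsColoring fun a => φ.toFun (gen a) := by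
  intro c
  generalize hc : c.kind = k
  cases k
  · exact ⟨(congrArg φ.toFun
      (sound (.pos_under c hc))).trans (φ.map_under (gen _) (gen _)),
      (congrArg φ.toFun
      (sound (.pos_over c hc))).trans (φ.map_over (gen _) (gen _))⟩
  · exact ⟨(congrArg φ.toFun
      (sound (.neg_under c hc))).trans (φ.map_under (gen _) (gen _)),
      (congrArg φ.toFun
      (sound (.neg_over c hc))).trans (φ.map_over (gen _) (gen _))⟩
  · exact fun b => congrArg φ.toFun (sound (.virt c b hc))

variable (X D) in
/-- Homomorphisms from the fundamental biquandle are colorings. -/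
noncomputable def homEquivColoring :
    BiquandleHom D.FundamentalBiquandle X ≃ D.Coloring X where
  toFun φ := ⟨fun a => φ.toFun (gen a), isColoring_hom φ⟩
  invFun f := Coloring.lift f
  left_inv _ := hom_ext fun _ => rfl
  right_inv _ := rfl

end FundamentalBiquandle

/-! ### Bracket multisets and their invariance -/

section Multiset

variable {X R : Type*} [Biquandle X] [CommRing R] [Finite X] (β : VirtualBracket X R)

theorem map_univ_val_eq {ι κ S : Type*} [Fintype ι] [Fintype κ] (e : ι ≃ κ) {F : ι → S}
    {G : κ → S} (h : ∀ i, F i = G (e i)) :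
    (Finset.univ : Finset ι).val.map F = (Finset.univ : Finset κ).val.map G := by
  rw [← Finset.map_univ_equiv e, Finset.map_val, Multiset.map_map]
  exact Multiset.map_congr rfl fun i _ => h i

theorem bracketMultiset_eq (D : KnotoidCode) :
    D.bracketMultiset β = D.coloringBracketMultiset β :=
  let _ := Fintype.ofFinite (BiquandleHom D.FundamentalBiquandle X)
  let _ := Fintype.ofFinite (D.Coloring X)
  map_univ_val_eq (homEquivColoring X D) fun _ => rfl

theorem card_coloringBracketMultiset (D : KnotoidCode) :
    (D.coloringBracketMultiset β).card = D.coloringCount X := by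
  let _ := Fintype.ofFinite (D.Coloring X)
  rw [coloringCount, Nat.card_eq_fintype_card]
  exact Multiset.card_map _ _

/-- The bijection of labellings attached to the move is transported to colorings, and through these
to homomorphisms. -/
theorem bracketMultiset_eq_of_step {D E : KnotoidCode} (h : ReidemeisterStep D.word E.word) :
    D.bracketMultiset β = E.bracketMultiset β := by
  obtain ⟨e, he⟩ := wordEquiv_of_step (β := β) h D.isCode
  rw [bracketMultiset_eq, bracketMultiset_eq]
  let _ := Fintype.ofFinite (D.Coloring X)
  let _ := Fintype.ofFinite (E.Coloring X)
  refine map_univ_val_eq ((coloringEquiv X D).trans (e.trans (coloringEquiv X E).symm))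
    fun f => ?_
  rw [bracket_eq, bracket_eq]
  refine (he (coloringEquiv X D f)).trans (congrArg _ ?_)
  exact (congrArg Subtype.val ((coloringEquiv X E).apply_symm_apply
    (e (coloringEquiv X D f)))).symm

end Multiset

end KnotoidCode

theorem mainTheorem6 (X : Type*) [Biquandle X] [Finite X] (R : Type*) [CommRing R]
    (β : VirtualBracket X R) :
    (∀ K L : VirtualKnotoidDiagram, K.Equivalent L →
      K.1.bracketMultiset β = L.1.bracketMultiset β) ∧
    (∀ K L : ClassicalKnotoidDiagram, K.Equivalent L →
      K.1.1.bracketMultiset β = L.1.1.bracketMultiset β) ∧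
    (∀ K : VirtualKnotoidDiagram,
      K.1.bracketMultiset β = K.1.coloringBracketMultiset β ∧
      (K.1.bracketMultiset β).card = K.1.coloringCount X) := by
  refine ⟨fun K L h => ?_, fun K L h => ?_, fun K => ⟨KnotoidCode.bracketMultiset_eq β K.1, ?_⟩⟩
  · induction h with
    | rel _ _ h => exact KnotoidCode.bracketMultiset_eq_of_step β h
    | refl _ => rfl
    | symm _ _ _ ih => exact ih.symm
    | trans _ _ _ _ _ ih ih' => exact ih.trans ih'
  · induction h with
    | rel _ _ h => exact KnotoidCode.bracketMultiset_eq_of_step β h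
    | refl _ => rfl
    | symm _ _ _ ih => exact ih.symm
    | trans _ _ _ _ _ ih ih' => exact ih.trans ih'
  · rw [KnotoidCode.bracketMultiset_eq, KnotoidCode.card_coloringBracketMultiset]
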